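/- Let $M$ be a complex manifold of dimension two with a Kähler metric $g$, given in holomorphic coordinates by $g_{k\bar l}=\partial_k\partial_{\bar l}\Phi$ with local real potentials $\Phi$, and suppose that $M$ is locally symmetric: $\nabla_{\partial_E}R_{ABC}{}^{D}=0$ for all $A,B,C,D,E\in\{1,2,\bar1,\bar2\}$, where $R(\partial_A,\partial_B)\partial_C=R_{ABC}{}^D\partial_D$. Let $\ast$ be a star product on $M$: an associative $\mathbb C[[\hbar]]$-bilinear product with unit $1$ on formal power series in $\hbar$ of smooth functions, $f\ast h=\sum_k C_k(f,h)\hbar^k$, with bidifferential operators $C_k$, $C_0(f,h)=fh$ and $C_1(f,h)-C_1(h,f)=\{f,h\}:=g^{\bar l k}(\partial_{\bar l}f\,\partial_k h-\partial_{\bar l}h\,\partial_k f)$. Assume that $\ast$ is the star product with separation of variables determined by the Kähler form in the sense of Karabegov. That is, on every open set $a\ast f=af$ for holomorphic $a$ and $f\ast b=fb$ for antiholomorphic $b$; and for every local Kähler potential $\Phi$, every $l$ and every smooth $f$, the operator $L_f=f\ast\,\cdot$ commutes with $\partial_{\bar l}\Phi+\hbar\,\partial_{\bar l}$. Let $U\subset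 M$ be an open set contained in the domain of a holomorphic coordinate system $(z^1,z^2)$, and put $D^k=g^{k\bar l}\partial_{\bar l}$, $D^{\bar k}=g^{\bar k l}\partial_l$, and $$R_{\bar i}{}^{\bar k\bar l}{}_{\bar c}=g^{\bar k p}g^{\bar l q}R_{\bar i pq\bar c},\qquad R_{ABCD}=g_{DE}R_{ABC}{}^{E}.$$ For $k\ge1$ let $X_k=k\,\mathrm{Id}_{k+1}+\hbar H_k$, where $H_k=(H^k_{ij})_{1\le i,j\le k+1}$ is the pentadiagonal matrix with $H^k_{ij}=0$ for $|i-j|>2$ and $$\begin{aligned} H^k_{j-2,j}&=\tbinom{k-j+3}{2}R_{\bar2}{}^{\bar1\bar1}{}_{\bar2},\\ H^k_{j-1,j}&=2\tbinom{k-j+2}{2}R_{\bar2}{}^{\bar1\bar1}{}_{\bar1}+(k-j+2)(j-2)R_{\bar2}{}^{\bar2\bar1}{}_{\bar2},\\ H^k_{j,j}&=\tbinom{k-j+1}{2}R_{\bar1}{}^{\bar1\bar1}{}_{\bar1}+\tbinom{j-1}{2}R_{\bar2}{}^{\bar2\bar2}{}_{\bar2}+2(k-j+1)(j-1)R_{\bar2}{}^{\bar2\bar1}{}_{\bar1},\\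 H^k_{j+1,j}&=2\tbinom{j}{2}R_{\bar2}{}^{\bar2\bar2}{}_{\bar1}+j(k-j)R_{\bar1}{}^{\bar2\bar1}{}_{\bar1},\\ H^k_{j+2,j}&=\tbinom{j+1}{2}R_{\bar1}{}^{\bar2\bar2}{}_{\bar1}. \end{aligned}$$ For a square matrix $A$ let $A(\infty)$ be the infinite matrix (indexed by $i,j\ge1$) with $A$ as upper left block and zeros elsewhere. Let $\mathrm{Id}(\infty)$ be the infinite identity matrix, $F_d(\infty)$ the infinite matrix with ones on the first subdiagonal and zeros elsewhere, and $F_r(\infty)=F_d(\infty)^{T}$. For smooth functions $\Theta^p_{\nu},\Theta^p_{\bar\mu}$ on $U$ ($1\le p\le4$, $\mu,\nu\in\{1,2\}$) with $g_{\bar\mu\nu}=\sum_{p=1}^4\Theta^p_{\bar\mu}\Theta^p_\nu$, put, for every $k\ge1$, $$F^p_k(\infty)=\Theta^p_1\,\mathrm{Id}(\infty)+\Theta^p_2\,F_d(\infty),\qquad B^p_k(\infty)=\Theta^p_{\bar1}\,\mathrm{Id}(\infty)+\Theta^p_{\bar2}\,F_r(\infty).$$ Then each $X_k$, $k\ge1$,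 is invertible, with $X_k^{-1}=\sum_{p\ge0}\frac{(-\hbar)^p}{k^{p+1}}H_k^{\,p}$; functions $\Theta$ as above exist; and there are matrices $T_n=(T^n_{ij})_{1\le i,j\le n+1}$, $n\ge0$, of formal power series in $\hbar$ whose coefficients are functions on $U$, such that for all $f,h\in C^\infty(U)$, at every point of $U$ and with $\hbar$-adic convergence, $$f\ast h=\sum_{n=0}^\infty\sum_{i,j=1}^{n+1}T^n_{ij}\,\bigl\{(D^1)^{n-i+1}(D^2)^{i-1}f\bigr\}\bigl\{(D^{\bar1})^{n-j+1}(D^{\bar2})^{j-1}h\bigr\},$$ and such that for every choice of $\Theta$ and every $n\ge0$, with $T_0=(1)$, $$T_n(\infty)=\hbar^n\sum_{p_1,\dots,p_n=1}^{4}F^{p_n}_n(\infty)\cdots F^{p_1}_1(\infty)\,T_0(\infty)\,\bigl(B^{p_1}_1(\infty)X_1^{-1}(\infty)\bigr)\cdots\bigl(B^{p_n}_n(\infty)X_n^{-1}(\infty)\bigr),$$ where $X_k^{-1}(\infty)$ denotes the embedding of $X_k^{-1}$. -/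

import Mathlib

open Filter
open scoped Manifold ContDiff

noncomputable section

/-! ## Local complex differential geometry on `ℂ²` -/

/-- The model space of complex surfaces. -/
abbrev C2 : Type := Fin 2 → ℂ

/-- Index set `{1, 2, 1̄, 2̄}`: `inl k` is the holomorphic index `k`, `inr k` the
antiholomorphic index `k̄` (`0, 1 : Fin 2` stand for `1, 2`). -/
abbrev Idx : Type := Fin 2 ⊕ Fin 2

namespace KaehlerLocal

/-- Wirtinger derivatives: `∂_k = ∂/∂z^k` for `inl k`, `∂_k̄ = ∂/∂z̄^k` for `inr k`. -/
def pd : Idx → (C2 → ℂ) → C2 → ℂ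
  | Sum.inl k, h, z =>
      (fderiv ℝ h z (Pi.single k 1) - Complex.I * fderiv ℝ h z (Pi.single k Complex.I)) / 2
  | Sum.inr k, h, z =>
      (fderiv ℝ h z (Pi.single k 1) + Complex.I * fderiv ℝ h z (Pi.single k Complex.I)) / 2

/-- `∂^I = ∂_1^{I_1} ∂_2^{I_2} ∂_1̄^{I_1̄} ∂_2̄^{I_2̄}`. -/
def pdMulti (I : Idx → ℕ) (h : C2 → ℂ) : C2 → ℂ :=
  (pd (Sum.inl 0))^[I (Sum.inl 0)] ((pd (Sum.inl 1))^[I (Sum.inl 1)]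
    ((pd (Sum.inr 0))^[I (Sum.inr 0)] ((pd (Sum.inr 1))^[I (Sum.inr 1)] h)))

/- Below, `G z k l` are the components `g_{k l̄}` at `z`. -/
variable (G : C2 → Matrix (Fin 2) (Fin 2) ℂ)

/-- The matrix `g_{AB}`: `g_{k l̄} = g_{l̄ k}`, and `g_{kl} = g_{k̄ l̄} = 0`. -/
def gLow (z : C2) : Matrix Idx Idx ℂ :=
  Matrix.fromBlocks 0 (G z) (G z).transpose 0

/-- The inverse matrix `g^{AB}`. -/
def gUp (z : C2) : Matrix Idx Idx ℂ := (gLow G z)⁻¹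

/-- Christoffel symbols `Γ^A_{BC}`. -/
def christoffel (A B C : Idx) (z : C2) : ℂ :=
  (1 / 2) * ∑ D, gUp G z A D *
    (pd B (fun w => gLow G w D C) z + pd C (fun w => gLow G w D B) z
      - pd D (fun w => gLow G w B C) z)

/-- Components `R_{ABC}^D` of the curvature, `R(∂_A, ∂_B) ∂_C = R_{ABC}^D ∂_D`. -/
def riem (A B C D : Idx) (z : C2) : ℂ :=
  pd A (christoffel G D B C) z - pd B (christoffel G D A C) z
    + ∑ E, (christoffel G E B C z * christoffel G D A E z
      - christoffel G E A C z * christoffel G D B E z)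

/-- Components `∇_E R_{ABC}^D` of the covariant derivative of the curvature. -/
def nablaRiem (E A B C D : Idx) (z : C2) : ℂ :=
  pd E (riem G A B C D) z
    + ∑ F, (christoffel G D E F z * riem G A B C F z
      - christoffel G F E A z * riem G F B C D z
      - christoffel G F E B z * riem G A F C D z
      - christoffel G F E C z * riem G A B F D z)

/-- `R_{ABCD} = g_{DE} R_{ABC}^E`. -/
def riemLow (A B C D : Idx) (z : C2) : ℂ := ∑ E, gLow G z D E * riem G A B C E z

/-- `curv G i k l c = R_ī^{k̄ l̄}_c̄ = g^{k̄ p} g^{l̄ q} R_{ī p q c̄}`. -/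
def curv (i k l c : Fin 2) (z : C2) : ℂ :=
  ∑ p : Fin 2, ∑ q : Fin 2, gUp G z (Sum.inr k) (Sum.inl p) * gUp G z (Sum.inr l) (Sum.inl q) *
    riemLow G (Sum.inr i) (Sum.inl p) (Sum.inl q) (Sum.inr c) z

/-- `D^k = g^{k l̄} ∂_l̄`. -/
def Dhol (k : Fin 2) (h : C2 → ℂ) (z : C2) : ℂ :=
  ∑ l : Fin 2, gUp G z (Sum.inl k) (Sum.inr l) * pd (Sum.inr l) h z

/-- `D^k̄ = g^{k̄ l} ∂_l`. -/
def Dbar (k : Fin 2) (h : C2 → ℂ) (z : C2) : ℂ :=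
  ∑ l : Fin 2, gUp G z (Sum.inr k) (Sum.inl l) * pd (Sum.inl l) h z

/-- `(D^1)^a (D^2)^b`. -/
def DholPow (a b : ℕ) (h : C2 → ℂ) : C2 → ℂ := (Dhol G 0)^[a] ((Dhol G 1)^[b] h)

/-- `(D^1̄)^a (D^2̄)^b`. -/
def DbarPow (a b : ℕ) (h : C2 → ℂ) : C2 → ℂ := (Dbar G 0)^[a] ((Dbar G 1)^[b] h)

end KaehlerLocal

/-! ## Kähler surfaces -/

section Manifold

variable (M : Type*) [TopologicalSpace M] [ChartedSpace C2 M]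

/-- Holomorphic coordinate systems of `M`. -/
def holCharts : Set (OpenPartialHomeomorph M C2) := IsManifold.maximalAtlas 𝓘(ℂ, C2) ω M

variable {M}

/-- `f` restricts to an element of `C^∞(U)` (in the real sense, complex valued). -/
def SmoothOn (f : M → ℂ) (U : Set M) : Prop := ContMDiffOn 𝓘(ℝ, C2) 𝓘(ℝ, ℂ) ∞ f U

/-- `∂_A f` for a function `f` on `M`, in the coordinates `φ`. -/
def chartPd (φ : OpenPartialHomeomorph M C2) (A : Idx) (f : M → ℂ) (x : M) : ℂ :=
  KaehlerLocal.pd A (f ∘ φ.symm) (φ x)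

/-- Components `h(∂_k, ∂_l)`, in the coordinates `φ`, of a family of sesquilinear forms (linear in
the first and antilinear in the second argument) on the holomorphic tangent spaces. -/
def hermComponents
    (h : (x : M) → TangentSpace 𝓘(ℂ, C2) x → TangentSpace 𝓘(ℂ, C2) x → ℂ)
    (φ : OpenPartialHomeomorph M C2) (z : C2) : Matrix (Fin 2) (Fin 2) ℂ :=
  Matrix.of fun k l =>
    h (φ.symm z)
      (mfderiv 𝓘(ℂ, C2) 𝓘(ℂ, C2) φ.symm z (Pi.single k (1 : ℂ) : C2))
      (mfderiv 𝓘(ℂ, C2) 𝓘(ℂ, C2) φ.symm z (Pi.single l (1 : ℂ) : C2))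

/-- `Φ` is a smooth real function on `V` with `∂_k ∂_l̄ Φ = h(∂_k, ∂_l)` in all holomorphic
coordinates. -/
def IsPotentialOf
    (h : (x : M) → TangentSpace 𝓘(ℂ, C2) x → TangentSpace 𝓘(ℂ, C2) x → ℂ)
    (Φ : M → ℝ) (V : Set M) : Prop :=
  SmoothOn (fun y => (Φ y : ℂ)) V ∧
    ∀ φ ∈ holCharts M, ∀ y ∈ V ∩ φ.source, ∀ k l,
      hermComponents h φ (φ y) k l =
        chartPd φ (Sum.inl k) (chartPd φ (Sum.inr l) (fun y => (Φ y : ℂ))) y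

variable (M) in
/-- A Kähler metric: a smooth Hermitian metric on the holomorphic tangent bundle that locally has
a smooth real potential `Φ`, `g_{k l̄} = ∂_k ∂_l̄ Φ`
(so that `ω = i g_{k l̄} dz^k ∧ dz̄^l` is closed). -/
structure KaehlerMetric where
  /-- the Hermitian inner product `h_x(v, w)`, linear in `v` and antilinear in `w` -/
  form : (x : M) → TangentSpace 𝓘(ℂ, C2) x → TangentSpace 𝓘(ℂ, C2) x → ℂ
  form_add : ∀ x u v w, form x (u + v) w = form x u w + form x v w
  form_smul : ∀ (x) (c : ℂ) (v w), form x (c • v) w = c * form x v w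
  form_symm : ∀ x v w, form x w v = (starRingEnd ℂ) (form x v w)
  form_pos : ∀ x v, v ≠ 0 → 0 < (form x v v).re
  smooth : ∀ φ ∈ holCharts M, ∀ k l,
    ContDiffOn ℝ ∞ (fun z => hermComponents form φ z k l) φ.target
  potential : ∀ x : M, ∃ V : Set M, IsOpen V ∧ x ∈ V ∧ ∃ Φ : M → ℝ, IsPotentialOf form Φ V

namespace KaehlerMetric

/-- Components `g_{k l̄}` in the coordinates `φ`, as functions on the image of `φ`. -/
def comp (g : KaehlerMetric M) (φ : OpenPartialHomeomorph M C2) :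
    C2 → Matrix (Fin 2) (Fin 2) ℂ :=
  hermComponents g.form φ

/-- The curvature components `R_ī^{k̄ l̄}_c̄` at the point `x`, in the coordinates `φ`. -/
def curvAt (g : KaehlerMetric M) (φ : OpenPartialHomeomorph M C2) (x : M)
    (i k l c : Fin 2) : ℂ :=
  KaehlerLocal.curv (g.comp φ) i k l c (φ x)

/-- `Φ` is a Kähler potential on `V`. -/
def IsPotential (g : KaehlerMetric M) (Φ : M → ℝ) (V : Set M) : Prop :=
  IsPotentialOf g.form Φ V

/-- `M` is locally symmetric: `∇_E R_{ABC}^D = 0` in all holomorphic coordinates. -/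
def IsLocallySymmetric (g : KaehlerMetric M) : Prop :=
  ∀ φ ∈ holCharts M, ∀ z ∈ φ.target, ∀ E A B C D,
    KaehlerLocal.nablaRiem (g.comp φ) E A B C D z = 0

/-- The Poisson bracket `{f, g} = g^{l̄ k} (∂_l̄ f ∂_k g - ∂_l̄ g ∂_k f)` in the coordinates `φ`. -/
def poisson (g : KaehlerMetric M) (φ : OpenPartialHomeomorph M C2) (f₁ f₂ : M → ℂ) (x : M) : ℂ :=
  ∑ k : Fin 2, ∑ l : Fin 2, KaehlerLocal.gUp (g.comp φ) (φ x) (Sum.inr l) (Sum.inl k) *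
    (chartPd φ (Sum.inr l) f₁ x * chartPd φ (Sum.inl k) f₂ x
      - chartPd φ (Sum.inr l) f₂ x * chartPd φ (Sum.inl k) f₁ x)

end KaehlerMetric

/-! ## Star products

Elements of `C^∞(U)⟦ħ⟧` are represented by power series `F : PowerSeries (M → ℂ)` in the variable
`ħ = PowerSeries.X` whose coefficients are smooth on `U`; only their values on `U` matter. -/

/-- All coefficients of `F` are smooth on `U`, i.e. `F` restricts to an element of `C^∞(U)⟦ħ⟧`. -/
def SeriesSmoothOn (F : PowerSeries (M → ℂ)) (U : Set M) : Prop :=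
  ∀ n, SmoothOn (PowerSeries.coeff n F) U

/-- The value `F(x) ∈ ℂ⟦ħ⟧`. -/
def seriesAt (x : M) (F : PowerSeries (M → ℂ)) : PowerSeries ℂ :=
  PowerSeries.mk fun n => PowerSeries.coeff n F x

/-- `F = H` on `U`. -/
def SeriesEqOn (F H : PowerSeries (M → ℂ)) (U : Set M) : Prop :=
  ∀ x ∈ U, seriesAt x F = seriesAt x H

/-- `B` is a bidifferential operator on `M`: near each point, in each holomorphic coordinate
system, `B(f₁, f₂) = ∑ a_{I,J} ∂^I f₁ ∂^J f₂` is a finite sum with smooth coefficients. -/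
def IsBidifferential (B : (M → ℂ) → (M → ℂ) → M → ℂ) : Prop :=
  ∀ φ ∈ holCharts M, ∀ x ∈ φ.source, ∃ V : Set M, IsOpen V ∧ x ∈ V ∧ V ⊆ φ.source ∧
    ∃ (S : Finset ((Idx → ℕ) × (Idx → ℕ))) (a : (Idx → ℕ) × (Idx → ℕ) → M → ℂ),
      (∀ IJ ∈ S, SmoothOn (a IJ) V) ∧
      ∀ U : Set M, IsOpen U → U ⊆ V → ∀ f₁ f₂ : M → ℂ, SmoothOn f₁ U → SmoothOn f₂ U →
        ∀ y ∈ U, B f₁ f₂ y = ∑ IJ ∈ S, a IJ y *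
          KaehlerLocal.pdMulti IJ.1 (f₁ ∘ φ.symm) (φ y) *
          KaehlerLocal.pdMulti IJ.2 (f₂ ∘ φ.symm) (φ y)

/-- The `ħ`-bilinear product `F ∗ H` defined by the cochains `B_k`, so that
`f₁ ∗ f₂ = ∑ B_k(f₁, f₂) ħ^k` for functions. -/
def starOf (B : ℕ → (M → ℂ) → (M → ℂ) → M → ℂ) (F H : PowerSeries (M → ℂ)) :
    PowerSeries (M → ℂ) :=
  PowerSeries.mk fun n =>
    ∑ p ∈ Finset.HasAntidiagonal.antidiagonal n, ∑ q ∈ Finset.HasAntidiagonal.antidiagonal p.2,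
      B p.1 (PowerSeries.coeff q.1 F) (PowerSeries.coeff q.2 H)

/-- A star product (deformation quantization) on a Kähler manifold. The cochains are bidifferential,
so the value of `B_k(f₁, f₂)` at a point depends only on the germs of `f₁`, `f₂` there, and `∗` is
defined on `C^∞(U)⟦ħ⟧` for every open set `U`. -/
structure StarProduct (g : KaehlerMetric M) where
  /-- the cochains -/
  B : ℕ → (M → ℂ) → (M → ℂ) → M → ℂ
  bidifferential : ∀ k, IsBidifferential (B k)
  assoc : ∀ U : Set M, IsOpen U → ∀ F₁ F₂ F₃ : PowerSeries (M → ℂ),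
    SeriesSmoothOn F₁ U → SeriesSmoothOn F₂ U → SeriesSmoothOn F₃ U →
    SeriesEqOn (starOf B F₁ (starOf B F₂ F₃)) (starOf B (starOf B F₁ F₂) F₃) U
  classical : ∀ U : Set M, IsOpen U → ∀ f₁ f₂ : M → ℂ, SmoothOn f₁ U → SmoothOn f₂ U →
    ∀ x ∈ U, B 0 f₁ f₂ x = f₁ x * f₂ x
  poisson : ∀ φ ∈ holCharts M, ∀ U : Set M, IsOpen U → U ⊆ φ.source →
    ∀ f₁ f₂ : M → ℂ, SmoothOn f₁ U → SmoothOn f₂ U →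
    ∀ x ∈ U, B 1 f₁ f₂ x - B 1 f₂ f₁ x = g.poisson φ f₁ f₂ x
  unit : ∀ U : Set M, IsOpen U → ∀ F : PowerSeries (M → ℂ), SeriesSmoothOn F U →
    SeriesEqOn (starOf B F 1) F U ∧ SeriesEqOn (starOf B 1 F) F U

namespace StarProduct

variable {g : KaehlerMetric M}

/-- The product `F ∗ H`. -/
def star (S : StarProduct g) (F H : PowerSeries (M → ℂ)) : PowerSeries (M → ℂ) := starOf S.B F H

/-- Separation of variables: `a ∗ f = a f` for holomorphic `a` and `f ∗ b = f b` for
antiholomorphic `b`, on every open set. -/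
def SeparatesVariables (S : StarProduct g) : Prop :=
  ∀ U : Set M, IsOpen U → ∀ f : M → ℂ, SmoothOn f U →
    (∀ a : M → ℂ, MDifferentiableOn 𝓘(ℂ, C2) 𝓘(ℂ, ℂ) a U →
      SeriesEqOn (S.star (PowerSeries.C a) (PowerSeries.C f)) (PowerSeries.C (a * f)) U) ∧
    (∀ b : M → ℂ, MDifferentiableOn 𝓘(ℂ, C2) 𝓘(ℂ, ℂ) (fun x => (starRingEnd ℂ) (b x)) U →
      SeriesEqOn (S.star (PowerSeries.C f) (PowerSeries.C b)) (PowerSeries.C (f * b)) U)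

/-- The operator `∂_l̄ Φ + ħ ∂_l̄` on formal series of functions, in the coordinates `φ`. -/
def rightPotential (φ : OpenPartialHomeomorph M C2) (Φ : M → ℝ) (l : Fin 2)
    (F : PowerSeries (M → ℂ)) : PowerSeries (M → ℂ) :=
  PowerSeries.C (chartPd φ (Sum.inr l) (fun y => (Φ y : ℂ))) * F
    + PowerSeries.X * PowerSeries.mk fun n => chartPd φ (Sum.inr l) (PowerSeries.coeff n F)

/-- Karabegov's condition, which singles out the star product with separation of variables
attached to the Kähler form itself: each left multiplication `L_f = f ∗ ·` commutes with
`R_{∂_l̄ Φ} = ∂_l̄ Φ + ħ ∂_l̄`, for every local Kähler potential `Φ`. -/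
def IsKarabegov (S : StarProduct g) : Prop :=
  ∀ φ ∈ holCharts M, ∀ V : Set M, IsOpen V → V ⊆ φ.source → ∀ Φ : M → ℝ, g.IsPotential Φ V →
    ∀ (l : Fin 2) (f₁ f₂ : M → ℂ), SmoothOn f₁ V → SmoothOn f₂ V →
      SeriesEqOn (S.star (PowerSeries.C f₁) (rightPotential φ Φ l (PowerSeries.C f₂)))
        (rightPotential φ Φ l (S.star (PowerSeries.C f₁) (PowerSeries.C f₂))) V

end StarProduct

end Manifold

/-! ## The coefficient matrices

Rows and columns are indexed from `0` here: the entry `(i, j)` in the usual indexing from `1` is the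
entry `(i - 1, j - 1)` of the matrices below. -/

namespace StarCoeff

/-- The pentadiagonal matrix `H_k` of curvature components; `R i k l c` is `R_ī^{k̄ l̄}_c̄`
(with `0, 1` for the indices `1, 2`). The row is `r + 1` and the column is `j = c + 1`
in indexing from `1`. -/
def H (R : Fin 2 → Fin 2 → Fin 2 → Fin 2 → ℂ) (k : ℕ) :
    Matrix (Fin (k + 1)) (Fin (k + 1)) ℂ :=
  Matrix.of fun r c =>
    let i : ℕ := (r : ℕ) + 1
    let j : ℕ := (c : ℕ) + 1
    if i + 2 = j then ((k + 3 - j).choose 2 : ℂ) * R 1 0 0 1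
    else if i + 1 = j then
      2 * ((k + 2 - j).choose 2 : ℂ) * R 1 0 0 0 + ((k : ℂ) - j + 2) * ((j : ℂ) - 2) * R 1 1 0 1
    else if i = j then
      ((k + 1 - j).choose 2 : ℂ) * R 0 0 0 0 + ((j - 1).choose 2 : ℂ) * R 1 1 1 1
        + 2 * ((k : ℂ) - j + 1) * ((j : ℂ) - 1) * R 1 1 0 0
    else if i = j + 1 then
      2 * (j.choose 2 : ℂ) * R 1 1 1 0 + (j : ℂ) * ((k : ℂ) - j) * R 0 1 0 0
    else if i = j + 2 then ((j + 1).choose 2 : ℂ) * R 0 1 1 0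
    else 0

/-- `X_k = k Id + ħ H_k`. -/
def X (R : Fin 2 → Fin 2 → Fin 2 → Fin 2 → ℂ) (k : ℕ) :
    Matrix (Fin (k + 1)) (Fin (k + 1)) (PowerSeries ℂ) :=
  (k : PowerSeries ℂ) • (1 : Matrix (Fin (k + 1)) (Fin (k + 1)) (PowerSeries ℂ))
    + (PowerSeries.X : PowerSeries ℂ) • (H R k).map (PowerSeries.C (R := ℂ))

/-- `X_k⁻¹ = ∑_p (-ħ)^p / k^{p+1} (H_k)^p`, for `k ≥ 1`. -/
def XInv (R : Fin 2 → Fin 2 → Fin 2 → Fin 2 → ℂ) (k : ℕ) :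
    Matrix (Fin (k + 1)) (Fin (k + 1)) (PowerSeries ℂ) :=
  Matrix.of fun i j => PowerSeries.mk fun p => (-1) ^ p / (k : ℂ) ^ (p + 1) * (H R k ^ p) i j

/-- Infinite matrices over `ℂ⟦ħ⟧`. -/
abbrev InfMat : Type := Matrix ℕ ℕ (PowerSeries ℂ)

/-- The product of infinite matrices; in all products formed below, each of the sums has only
finitely many nonzero terms. -/
def mulInf (A B : InfMat) : InfMat := Matrix.of fun i j => ∑ᶠ k, A i k * B k j

/-- The embedding `A ↦ A(∞)`, by zeros outside the upper left block. -/
def embed {m : ℕ} (A : Matrix (Fin m) (Fin m) (PowerSeries ℂ)) : InfMat :=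
  Matrix.of fun i j => if h : i < m ∧ j < m then A ⟨i, h.1⟩ ⟨j, h.2⟩ else 0

/-- `F_d(∞)`: ones on the first subdiagonal. -/
def shiftDown : InfMat := Matrix.of fun i j => if i = j + 1 then 1 else 0

/-- `F_r(∞) = F_d(∞)ᵀ`. -/
def shiftRight : InfMat := shiftDown.transpose

/-- `F^p(∞) = Θ^p_1 Id(∞) + Θ^p_2 F_d(∞)`, with `θ μ = Θ^p_μ`. -/
def Fmat (θ : Fin 2 → ℂ) : InfMat :=
  PowerSeries.C (θ 0) • (1 : InfMat) + PowerSeries.C (θ 1) • shiftDown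

/-- `B^p(∞) = Θ^p_1̄ Id(∞) + Θ^p_2̄ F_r(∞)`, with `θ' μ = Θ^p_μ̄`. -/
def Bmat (θ' : Fin 2 → ℂ) : InfMat :=
  PowerSeries.C (θ' 0) • (1 : InfMat) + PowerSeries.C (θ' 1) • shiftRight

/-- `F^{p_n}_n(∞) ⋯ F^{p_1}_1(∞)`, with `p (k - 1) = p_k`. -/
def leftProd (θ : Fin 4 → Fin 2 → ℂ) : (n : ℕ) → (Fin n → Fin 4) → InfMat
  | 0, _ => 1
  | n + 1, p => mulInf (Fmat (θ (p (Fin.last n)))) (leftProd θ n fun k => p k.castSucc)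

/-- `(B^{p_1}_1(∞) X_1⁻¹(∞)) ⋯ (B^{p_n}_n(∞) X_n⁻¹(∞))`, with `p (k - 1) = p_k`. -/
def rightProd (R : Fin 2 → Fin 2 → Fin 2 → Fin 2 → ℂ) (θ' : Fin 4 → Fin 2 → ℂ) :
    (n : ℕ) → (Fin n → Fin 4) → InfMat
  | 0, _ => 1
  | n + 1, p => mulInf (rightProd R θ' n fun k => p k.castSucc)
      (mulInf (Bmat (θ' (p (Fin.last n)))) (embed (XInv R (n + 1))))

/-- `T_0(∞)`, the embedding of the `1 × 1` matrix `(1)`. -/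
def T0 : InfMat := embed (1 : Matrix (Fin 1) (Fin 1) (PowerSeries ℂ))

/-- `ħ^n ∑_{p_1, …, p_n = 1}^4 F^{p_n}_n(∞) ⋯ F^{p_1}_1(∞) T_0(∞)
(B^{p_1}_1(∞) X_1⁻¹(∞)) ⋯ (B^{p_n}_n(∞) X_n⁻¹(∞))`. -/
def formulaT (R : Fin 2 → Fin 2 → Fin 2 → Fin 2 → ℂ) (θ θ' : Fin 4 → Fin 2 → ℂ) (n : ℕ) :
    InfMat :=
  (PowerSeries.X : PowerSeries ℂ) ^ n •
    ∑ p : Fin n → Fin 4, mulInf (mulInf (leftProd θ n p) T0) (rightProd R θ' n p)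

/-- The series `∑ a_n` of elements of `ℂ⟦ħ⟧` converges `ħ`-adically to `s`: each coefficient of the
partial sums is eventually equal to that of `s`. -/
def HasFormalSum (a : ℕ → PowerSeries ℂ) (s : PowerSeries ℂ) : Prop :=
  ∀ m : ℕ, ∀ᶠ N in atTop, PowerSeries.coeff m (∑ n ∈ Finset.range N, a n) = PowerSeries.coeff m s

end StarCoeff

section Factorization

variable {M : Type*} [TopologicalSpace M] [ChartedSpace C2 M]

/-- Smooth functions `Θ p μ = Θ^p_μ` and `Θ' p μ = Θ^p_μ̄` on `U` with
`g_{μ̄ ν} = ∑_{p=1}^4 Θ^p_μ̄ Θ^p_ν` in the coordinates `φ`. -/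
def IsFactorization (g : KaehlerMetric M) (φ : OpenPartialHomeomorph M C2) (U : Set M)
    (Θ Θ' : Fin 4 → Fin 2 → M → ℂ) : Prop :=
  (∀ p μ, SmoothOn (Θ p μ) U ∧ SmoothOn (Θ' p μ) U) ∧
    ∀ x ∈ U, ∀ μ ν : Fin 2,
      KaehlerLocal.gLow (g.comp φ) (φ x) (Sum.inr μ) (Sum.inl ν) = ∑ p, Θ' p μ x * Θ p ν x

end Factorization

end

/-!
# The star product with separation of variables on a locally symmetric Kähler surface

Near a point with a Kähler potential `Φ`, work in the algebra of smooth functions with the commuting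
frame `D^k̄ = g^{k̄ l} ∂_l`, which is dual to the functions `a_l = ∂_l̄ Φ` and kills `z̄_k`
(`frame_dual`, `frame_comm`). By associativity and separation of variables, the coefficients `L_m` of
left multiplication by `f` commute with the functions `z̄_k`; Karabegov's condition says that
`[L_{m+1}, a_l] = [∂_l̄, L_m]`. These conditions, together with `f ∗ 1 = f`, determine the `L_m`: the
functions `z̄_k - z̄_k(x)` and `a_l - a_l(x)` are coordinates at `x`, and a functional of finite order
at `x` is determined by its value at `1` and by its values on the functions
`(z̄_k - z̄_k(x)) h` and `∑ (a_l - a_l(x)) D^l̄ h` (`functional_eq_zero`, a consequence of Euler's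
formula for functions that vanish to some order; `IsLeftMul.unique`).

It remains to exhibit operators with these properties. They are sought as `∑ T^n_{ij} D^α f D^β̄ h`,
encoded by polynomial symbols in `η` (for `D^k f`) and `ξ` (for `D^k̄ h`). The commutator with `a_l` is
`∂/∂ξ_l` on symbols, so that `∑ [L_m, a_l] D^l̄` is the Euler operator in `ξ`. Since
`[∂_l̄, D^k̄] = - Γ^k̄_{l̄ q̄} D^q̄` and `D^p̄ Γ^k̄_{l̄ q̄}` is the curvature, which is killed by all
`D^j̄` on a locally symmetric space, the commutator with `∂_l̄` consists of the covariant derivative of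
the symbol, the metric term `∑ g_{k l̄} η_k` coming from `∂_l̄ f`, and a second order curvature term
(`d_inr_ev`). Symbols built from the metric and the curvature alone are covariantly constant
(`nab_symb_tcoef`), so the conditions reduce to the recursion
`(n + 1) T_{n+1} = ħ (∑ g_{k l̄} inc_k T_n inc_lᵀ - T_{n+1} H_{n+1})`, where the pentadiagonal matrix
`H_{n+1}` is the curvature operator on monomials of degree `n + 1` (`curvSymbol_monos`) and `inc_k`
multiplies monomials by a variable. In other words
`T_{n+1} X_{n+1} = ħ ∑ g_{k l̄} inc_k T_n inc_lᵀ`, and a factorization of the metric solves this in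
closed form (`embed_TMat`).
-/

noncomputable section

/-! ### Commuting frames dual to functions -/

section Frame

variable {A : Type*} [CommRing A]

theorem eq_zero_of_sum_mul_eq_zero {N P : Matrix (Fin 2) (Fin 2) A}
    (hN' : P * N = 1) {c : Fin 2 → A}
    (h : ∀ l, ∑ m, c m * P m l = 0) : c = 0 := by
  have h1 : Matrix.vecMul c P = 0 := by
    ext l; simpa [Matrix.vecMul, dotProduct] using h l
  have h2 : Matrix.vecMul (Matrix.vecMul c P) N = c := by
    rw [Matrix.vecMul_vecMul, hN', Matrix.vecMul_one]
  rw [← h2, h1, Matrix.zero_vecMul]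

variable [Algebra ℂ A]

/-- The frame `D^k = ∑ m, N^{k m} p_m` obtained from derivations `p_m` and coefficients `N`. -/
def frame (N : Matrix (Fin 2) (Fin 2) A) (p : Fin 2 → Derivation ℂ A A) (k : Fin 2) :
    Derivation ℂ A A :=
  ∑ m, N k m • p m

theorem frame_apply (N : Matrix (Fin 2) (Fin 2) A) (p : Fin 2 → Derivation ℂ A A) (k : Fin 2)
    (f : A) : frame N p k f = ∑ m, N k m * p m f := by
  simp [frame]

/-- If `N` is the inverse of the matrix `(p_m a_l)`, the frame is dual to the functions `a_l`. -/
theorem frame_dual {N P : Matrix (Fin 2) (Fin 2) A} {p : Fin 2 → Derivation ℂ A A}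
    {a : Fin 2 → A} (hP : ∀ m l, p m (a l) = P m l) (hN : N * P = 1) (k l : Fin 2) :
    frame N p k (a l) = if k = l then 1 else 0 := by
  have := congrFun (congrFun hN k) l
  rw [Matrix.mul_apply, Matrix.one_apply] at this
  simp only [frame_apply, hP, this]

/-- A frame of commuting derivations that is dual to functions consists of commuting derivations:
the commutator of two members is a combination of the `p_m` which kills every `a_l`. -/
theorem frame_comm {N P : Matrix (Fin 2) (Fin 2) A} {p : Fin 2 → Derivation ℂ A A}
    {a : Fin 2 → A} (hP : ∀ m l, p m (a l) = P m l) (hN : N * P = 1) (hN' : P * N = 1)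
    (hp : ∀ m n f, p m (p n f) = p n (p m f)) (k l : Fin 2) (f : A) :
    frame N p k (frame N p l f) = frame N p l (frame N p k f) := by
  have key : ∀ f, frame N p k (frame N p l f) - frame N p l (frame N p k f)
      = ∑ n, (frame N p k (N l n) - frame N p l (N k n)) * p n f := by
    intro f
    have e := hp 0 1 f
    simp only [frame_apply, Fin.sum_univ_two, map_add, Derivation.leibniz, smul_eq_mul]
    linear_combination (N k 0 * N l 1 - N k 1 * N l 0) * e
  have hc : (fun n => frame N p k (N l n) - frame N p l (N k n)) = 0 := by
    refine eq_zero_of_sum_mul_eq_zero hN' fun j => ?_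
    have := key (a j)
    rw [frame_dual hP hN, frame_dual hP hN] at this
    simp only [← hP]
    rw [← this]
    split_ifs <;> simp
  rw [← sub_eq_zero, key]
  exact Finset.sum_eq_zero fun n _ => by rw [show _ - _ = (0 : A) from congrFun hc n, zero_mul]

end Frame

/-! ### Kähler geometry of a commutative algebra -/

/-- The algebraic shadow of a Kähler surface with a global potential and global holomorphic
coordinates: an algebra `A` of functions with commuting derivations `∂_B`, a potential `Φ` and
the inverse of the matrix `g_{k l̄} = ∂_k ∂_l̄ Φ`, and the antiholomorphic coordinates `z̄_k`. -/
structure KaehlerAlgebra (A : Type*) [CommRing A] [Algebra ℂ A] where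
  /-- the derivations `∂_B` -/
  d : Idx → Derivation ℂ A A
  d_comm : ∀ B C f, d B (d C f) = d C (d B f)
  /-- the potential -/
  pot : A
  /-- the inverse metric, `Gi k l = g^{k̄ l}` -/
  Gi : Matrix (Fin 2) (Fin 2) A
  G_mul_Gi : (Matrix.of fun k l => d (Sum.inl k) (d (Sum.inr l) pot)) * Gi = 1
  Gi_mul_G : Gi * (Matrix.of fun k l => d (Sum.inl k) (d (Sum.inr l) pot)) = 1
  /-- the antiholomorphic coordinates -/
  zb : Fin 2 → A
  d_inl_zb : ∀ k l, d (Sum.inl k) (zb l) = 0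
  d_inr_zb : ∀ k l, d (Sum.inr k) (zb l) = if k = l then 1 else 0

namespace KaehlerAlgebra

variable {A : Type*} [CommRing A] [Algebra ℂ A] (K : KaehlerAlgebra A)

/-- The metric `g_{k l̄}`. -/
def G : Matrix (Fin 2) (Fin 2) A :=
  Matrix.of fun k l => K.d (Sum.inl k) (K.d (Sum.inr l) K.pot)

theorem G_apply (k l : Fin 2) : K.G k l = K.d (Sum.inl k) (K.d (Sum.inr l) K.pot) := rfl

/-- `a_l = ∂_l̄ Φ`. -/
def a (l : Fin 2) : A := K.d (Sum.inr l) K.pot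

theorem Gi_G : K.Gi * K.G = 1 := K.Gi_mul_G
theorem G_Gi : K.G * K.Gi = 1 := K.G_mul_Gi

theorem sum_Gi_G (k l : Fin 2) : ∑ m, K.Gi k m * K.G m l = if k = l then 1 else 0 := by
  have := congrFun (congrFun K.Gi_G k) l
  rwa [Matrix.mul_apply, Matrix.one_apply] at this

theorem sum_G_Gi (k l : Fin 2) : ∑ m, K.G k m * K.Gi m l = if k = l then 1 else 0 := by
  have := congrFun (congrFun K.G_Gi k) l
  rwa [Matrix.mul_apply, Matrix.one_apply] at this

/-- `D^k̄ = g^{k̄ l} ∂_l`. -/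
def D : Fin 2 → Derivation ℂ A A := frame K.Gi fun m => K.d (Sum.inl m)

/-- `D^k = g^{k l̄} ∂_l̄`. -/
def E : Fin 2 → Derivation ℂ A A := frame K.Gi.transpose fun m => K.d (Sum.inr m)

theorem D_apply (k : Fin 2) (f : A) : K.D k f = ∑ m, K.Gi k m * K.d (Sum.inl m) f :=
  frame_apply _ _ _ _

theorem E_apply (k : Fin 2) (f : A) : K.E k f = ∑ m, K.Gi m k * K.d (Sum.inr m) f :=
  frame_apply _ _ _ _

theorem D_a (k l : Fin 2) : K.D k (K.a l) = if k = l then 1 else 0 :=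
  frame_dual (P := K.G) (fun _ _ => rfl) K.Gi_G k l

theorem D_comm (k l : Fin 2) (f : A) : K.D k (K.D l f) = K.D l (K.D k f) :=
  frame_comm (P := K.G) (a := K.a) (fun _ _ => rfl) K.Gi_G K.G_Gi (fun _ _ _ => K.d_comm _ _ _) k l f

theorem E_comm (k l : Fin 2) (f : A) : K.E k (K.E l f) = K.E l (K.E k f) := by
  refine frame_comm (P := K.G.transpose) (a := fun l => K.d (Sum.inl l) K.pot)
    (fun m l => K.d_comm _ _ _) ?_ ?_ (fun _ _ _ => K.d_comm _ _ _) k l f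
  · rw [← Matrix.transpose_mul, K.G_Gi, Matrix.transpose_one]
  · rw [← Matrix.transpose_mul, K.Gi_G, Matrix.transpose_one]

theorem D_zb (k l : Fin 2) : K.D k (K.zb l) = 0 := by
  simp [D_apply, K.d_inl_zb]

/-- `∂_l = g_{l k̄} D^k̄`. -/
theorem d_inl_eq (l : Fin 2) (f : A) : K.d (Sum.inl l) f = ∑ k, K.G l k * K.D k f := by
  have h0 := K.sum_G_Gi l 0
  have h1 := K.sum_G_Gi l 1
  simp only [D_apply, Fin.sum_univ_two] at *
  fin_cases l <;> simp at h0 h1 ⊢ <;>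
    linear_combination -(K.d (Sum.inl 0) f) * h0 - (K.d (Sum.inl 1) f) * h1

/-- `∂_l̄ = g_{k l̄} D^k`. -/
theorem d_inr_eq (l : Fin 2) (f : A) : K.d (Sum.inr l) f = ∑ k, K.G k l * K.E k f := by
  have h0 := K.sum_Gi_G 0 l
  have h1 := K.sum_Gi_G 1 l
  simp only [E_apply, Fin.sum_univ_two] at *
  fin_cases l <;> simp at h0 h1 ⊢ <;>
    linear_combination -(K.d (Sum.inr 0) f) * h0 - (K.d (Sum.inr 1) f) * h1

/-- The Kähler condition. -/
theorem d_inl_G (m k l : Fin 2) : K.d (Sum.inl m) (K.G k l) = K.d (Sum.inl k) (K.G m l) :=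
  K.d_comm _ _ _

/-- The Kähler condition. -/
theorem d_inr_G (m k l : Fin 2) : K.d (Sum.inr m) (K.G k l) = K.d (Sum.inr l) (K.G k m) := by
  simp only [G_apply]
  rw [K.d_comm (Sum.inr m), K.d_comm (Sum.inr m), K.d_comm (Sum.inl k), K.d_comm (Sum.inl k)]

/-- `Γ^k̄_{l̄ q̄} = g^{k̄ n} ∂_l̄ g_{n q̄}`. -/
def Gam (k l q : Fin 2) : A := ∑ n, K.Gi k n * K.d (Sum.inr l) (K.G n q)

/-- `Γ^k_{l m} = g^{k n̄} ∂_l g_{m n̄}`. -/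
def gamh (k l m : Fin 2) : A := ∑ n, K.Gi n k * K.d (Sum.inl l) (K.G m n)

theorem Gam_symm (k l q : Fin 2) : K.Gam k l q = K.Gam k q l := by
  simp only [Gam]
  exact Finset.sum_congr rfl fun n _ => by rw [K.d_inr_G]

/-- The metric is covariantly constant. -/
theorem d_inr_G_eq (e m c : Fin 2) :
    K.d (Sum.inr e) (K.G m c) = ∑ f, K.Gam f e c * K.G m f := by
  have h0 := K.sum_G_Gi m 0
  have h1 := K.sum_G_Gi m 1
  simp only [Gam, Fin.sum_univ_two] at *
  fin_cases m <;> simp at h0 h1 ⊢ <;>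
    linear_combination -(K.d (Sum.inr e) (K.G 0 c)) * h0 - (K.d (Sum.inr e) (K.G 1 c)) * h1

theorem d_inl_G_eq (e m c : Fin 2) :
    K.d (Sum.inl e) (K.G m c) = ∑ f, K.gamh f e m * K.G f c := by
  have h0 := K.sum_Gi_G 0 c
  have h1 := K.sum_Gi_G 1 c
  simp only [gamh, Fin.sum_univ_two] at *
  fin_cases c <;> simp at h0 h1 ⊢ <;>
    linear_combination -(K.d (Sum.inl e) (K.G m 0)) * h0 - (K.d (Sum.inl e) (K.G m 1)) * h1

theorem d_Gi (B : Idx) (k p : Fin 2) :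
    K.d B (K.Gi k p) = -∑ s, ∑ t, K.Gi k s * K.d B (K.G s t) * K.Gi t p := by
  have e : ∀ t, ∑ s, (K.Gi k s * K.d B (K.G s t) + K.G s t * K.d B (K.Gi k s)) = 0 := by
    intro t
    have := congrArg (K.d B) (K.sum_Gi_G k t)
    rw [map_sum] at this
    simp only [Derivation.leibniz, smul_eq_mul] at this
    rw [this]; split_ifs <;> simp
  have e0 := e 0
  have e1 := e 1
  have h0 := K.sum_G_Gi 0 p
  have h1 := K.sum_G_Gi 1 p
  simp only [Fin.sum_univ_two] at *
  fin_cases p <;> simp at h0 h1 ⊢ <;>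
    [linear_combination K.Gi 0 0 * e0 + K.Gi 1 0 * e1 - K.d B (K.Gi k 0) * h0
      - K.d B (K.Gi k 1) * h1;
     linear_combination K.Gi 0 1 * e0 + K.Gi 1 1 * e1 - K.d B (K.Gi k 0) * h0
      - K.d B (K.Gi k 1) * h1]

theorem d_inr_Gi (e k p : Fin 2) :
    K.d (Sum.inr e) (K.Gi k p) = -∑ f, K.Gam k e f * K.Gi f p := by
  simp only [d_Gi, Gam, Fin.sum_univ_two]; ring

theorem d_inl_Gi (e k p : Fin 2) :
    K.d (Sum.inl e) (K.Gi k p) = -∑ s, K.gamh p e s * K.Gi k s := by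
  simp only [d_Gi, gamh, Fin.sum_univ_two]; ring

/-- `[∂_l̄, D^k̄] = - Γ^k̄_{l̄ q̄} D^q̄`. -/
theorem d_inr_D (l k : Fin 2) (f : A) :
    K.d (Sum.inr l) (K.D k f) = K.D k (K.d (Sum.inr l) f) - ∑ q, K.Gam k l q * K.D q f := by
  simp only [D_apply, map_add, Derivation.leibniz, smul_eq_mul, d_inr_Gi, Fin.sum_univ_two,
    K.d_comm (Sum.inr l) (Sum.inl _)]
  ring

/-- `R_l̄^{k̄ p̄}_q̄`, as the derivative `D^p̄ Γ^k̄_{l̄ q̄}` of the connection. -/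
def Rc (l k p q : Fin 2) : A := K.D p (K.Gam k l q)

theorem Rc_symm_lower (l k p q : Fin 2) : K.Rc l k p q = K.Rc q k p l := by
  simp only [Rc]; rw [K.Gam_symm]

/-- Symmetry in the upper indices: the Jacobi identity for `∂_l̄`, `D^k̄`, `D^p̄`. -/
theorem Rc_symm_upper (l k p q : Fin 2) : K.Rc l k p q = K.Rc l p k q := by
  have h : ∀ f, ∑ q, (K.Rc l k p q - K.Rc l p k q) * K.D q f = 0 := by
    intro f
    have e1 := congrArg (K.D p) (K.d_inr_D l k f)
    have e2 := congrArg (K.D k) (K.d_inr_D l p f)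
    have e3 := K.d_inr_D l p (K.D k f)
    have e4 := K.d_inr_D l k (K.D p f)
    have e5 : K.d (Sum.inr l) (K.D p (K.D k f)) = K.d (Sum.inr l) (K.D k (K.D p f)) := by
      rw [K.D_comm]
    have e6 := K.D_comm p k (K.d (Sum.inr l) f)
    have c1 := K.D_comm p 0 f
    have c2 := K.D_comm p 1 f
    have c3 := K.D_comm k 0 f
    have c4 := K.D_comm k 1 f
    simp only [Rc, map_sub, map_add, Derivation.leibniz, smul_eq_mul, Fin.sum_univ_two] at *
    linear_combination e1 - e2 + e3 - e4 - e5 + e6 - K.Gam k l 0 * c1 - K.Gam k l 1 * c2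
      + K.Gam p l 0 * c3 + K.Gam p l 1 * c4
  have := h (K.a q)
  simp only [D_a, Fin.sum_univ_two] at this
  fin_cases q <;> simp at this ⊢ <;> linear_combination this

end KaehlerAlgebra

namespace KaehlerAlgebra

variable {A : Type*} [CommRing A] [Algebra ℂ A] (K : KaehlerAlgebra A)

/-! ### Curvature of a locally symmetric Kähler algebra -/

/-- `R_{ī p q}^m = ∂_ī Γ^m_{p q}`. -/
def rh (i p q m : Fin 2) : A := K.d (Sum.inr i) (K.gamh m p q)

/-- The curvature `R_ī^{k̄ l̄}_c̄`, obtained from `R_{ī p q}^m` by lowering and raising indices. -/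
def cv (i k l c : Fin 2) : A :=
  ∑ p, ∑ q, K.Gi k p * K.Gi l q * ∑ m, K.G m c * K.rh i p q m

/-- The equations `∇_e R_{ī p q}^m = 0` and `∇_ē R_{ī p q}^m = 0`; the other Christoffel symbols
that occur in these covariant derivatives vanish. -/
structure LocallySymmetric : Prop where
  inl : ∀ e i p q m, K.d (Sum.inl e) (K.rh i p q m)
    + ∑ f, (K.gamh m e f * K.rh i p q f - K.gamh f e p * K.rh i f q m
      - K.gamh f e q * K.rh i p f m) = 0
  inr : ∀ e i p q m, K.d (Sum.inr e) (K.rh i p q m) - ∑ f, K.Gam f e i * K.rh f p q m = 0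

theorem gamh_symm (k l m : Fin 2) : K.gamh k l m = K.gamh k m l := by
  simp only [gamh]
  exact Finset.sum_congr rfl fun n _ => by rw [K.d_inl_G]

/-- The lowered curvature `R_{ī p q c̄}`. -/
theorem sum_G_rh (i p q c : Fin 2) : ∑ m, K.G m c * K.rh i p q m
    = K.d (Sum.inr i) (K.d (Sum.inl p) (K.G q c))
      - ∑ m, K.d (Sum.inr i) (K.G m c) * K.gamh m p q := by
  rw [K.d_inl_G_eq p q c]
  simp only [rh, Fin.sum_univ_two, map_add, Derivation.leibniz, smul_eq_mul]
  ring

theorem cv_eq_Rc (i k l c : Fin 2) : K.cv i k l c = K.Rc i k l c := by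
  have h0 := K.d_comm (Sum.inr i) (Sum.inl 0) (K.G 0 c)
  have h1 := K.d_comm (Sum.inr i) (Sum.inl 1) (K.G 0 c)
  have h2 := K.d_comm (Sum.inr i) (Sum.inl 1) (K.G 1 c)
  have h3 := K.d_inl_G 0 1 c
  have h4 : K.d (Sum.inl 0) (K.d (Sum.inr i) (K.G 1 c))
      = K.d (Sum.inl 1) (K.d (Sum.inr i) (K.G 0 c)) := by
    rw [← h1, ← h3, K.d_comm]
  have s0 := K.gamh_symm 0 0 1
  have s1 := K.gamh_symm 1 0 1
  simp only [cv, sum_G_rh]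
  simp only [Rc, Gam, D_apply, map_add, Derivation.leibniz, smul_eq_mul,
    Fin.sum_univ_two, d_inl_Gi, h0, h1, h2, h3, s0, s1]
  linear_combination -(K.Gi k 1 * K.Gi l 0) * h4

variable {K}

theorem LocallySymmetric.d_inl_Rc (hK : K.LocallySymmetric) (e i k l c : Fin 2) :
    K.d (Sum.inl e) (K.Rc i k l c) = 0 := by
  rw [← cv_eq_Rc]
  have h := hK.inl e i
  have h2 : ∀ p q, ∑ m, K.G m c * (K.d (Sum.inl e) (K.rh i p q m)
    + ∑ f, (K.gamh m e f * K.rh i p q f - K.gamh f e p * K.rh i f q m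
      - K.gamh f e q * K.rh i p f m)) = 0 := fun p q =>
    Finset.sum_eq_zero fun m _ => by rw [h, mul_zero]
  have h3 : ∑ p, ∑ q, K.Gi k p * K.Gi l q * ∑ m, K.G m c * (K.d (Sum.inl e) (K.rh i p q m)
    + ∑ f, (K.gamh m e f * K.rh i p q f - K.gamh f e p * K.rh i f q m
      - K.gamh f e q * K.rh i p f m)) = 0 := by simp only [h2, mul_zero, Finset.sum_const_zero]
  simp only [cv, map_add, Derivation.leibniz, smul_eq_mul,
    Fin.sum_univ_two, d_inl_Gi, d_inl_G_eq] at h3 ⊢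
  linear_combination h3

theorem LocallySymmetric.D_Rc (hK : K.LocallySymmetric) (e i k l c : Fin 2) :
    K.D e (K.Rc i k l c) = 0 := by
  simp [D_apply, hK.d_inl_Rc]

/-- `∇_ē R_ī^{k̄ l̄}_c̄ = 0`. -/
theorem LocallySymmetric.d_inr_Rc (hK : K.LocallySymmetric) (e i k l c : Fin 2) :
    K.d (Sum.inr e) (K.Rc i k l c) = ∑ f, (K.Gam f e i * K.Rc f k l c + K.Gam f e c * K.Rc i k l f
      - K.Gam k e f * K.Rc i f l c - K.Gam l e f * K.Rc i k f c) := by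
  simp only [← cv_eq_Rc]
  have h := hK.inr e i
  have h2 : ∀ p q, ∑ m, K.G m c * (K.d (Sum.inr e) (K.rh i p q m)
      - ∑ f, K.Gam f e i * K.rh f p q m) = 0 := fun p q =>
    Finset.sum_eq_zero fun m _ => by rw [h, mul_zero]
  have h3 : ∑ p, ∑ q, K.Gi k p * K.Gi l q * ∑ m, K.G m c * (K.d (Sum.inr e) (K.rh i p q m)
      - ∑ f, K.Gam f e i * K.rh f p q m) = 0 := by
    simp only [h2, mul_zero, Finset.sum_const_zero]
  simp only [cv, map_add, Derivation.leibniz, smul_eq_mul,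
    Fin.sum_univ_two, d_inr_Gi, d_inr_G_eq] at h3 ⊢
  linear_combination h3

end KaehlerAlgebra

/-! ### Symbols -/

section CoeffDeriv

open MvPolynomial

variable {A : Type*} [CommRing A] [Algebra ℂ A] {σ : Type*}

theorem coeff_sum_monomial_map (d : A →ₗ[ℂ] A) (p : MvPolynomial σ A) (s : σ →₀ ℕ) :
    coeff s (∑ s ∈ p.support, monomial s (d (coeff s p))) = d (coeff s p) := by
  classical
  rw [coeff_sum]
  simp only [coeff_monomial, Finset.sum_ite_eq', mem_support_iff]
  split_ifs with h
  · rfl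
  · rw [not_not.mp h, map_zero]

/-- The coefficientwise application of a linear map to a polynomial. -/
def mapCoeffs (d : A →ₗ[ℂ] A) : MvPolynomial σ A →ₗ[ℂ] MvPolynomial σ A where
  toFun p := ∑ s ∈ p.support, monomial s (d (coeff s p))
  map_add' p q := by
    ext s
    rw [coeff_add, coeff_sum_monomial_map, coeff_sum_monomial_map, coeff_sum_monomial_map,
      coeff_add, map_add]
  map_smul' c p := by
    ext s
    rw [RingHom.id_apply, coeff_smul, coeff_sum_monomial_map, coeff_sum_monomial_map, coeff_smul,
      map_smul]

theorem coeff_mapCoeffs (d : A →ₗ[ℂ] A) (p : MvPolynomial σ A) (s : σ →₀ ℕ) :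
    coeff s (mapCoeffs d p) = d (coeff s p) :=
  coeff_sum_monomial_map d p s

theorem mapCoeffs_C (d : A →ₗ[ℂ] A) (c : A) :
    mapCoeffs d (C c : MvPolynomial σ A) = C (d c) := by
  classical
  ext s
  rw [coeff_mapCoeffs, coeff_C, coeff_C]
  split_ifs <;> simp

theorem mapCoeffs_mul_X (d : A →ₗ[ℂ] A) (p : MvPolynomial σ A) (i : σ) :
    mapCoeffs d (p * X i) = mapCoeffs d p * X i := by
  classical
  ext s
  rw [coeff_mapCoeffs, coeff_mul_X', coeff_mul_X', coeff_mapCoeffs]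
  split_ifs <;> simp

theorem mapCoeffs_C_mul (d : Derivation ℂ A A) (c : A) (p : MvPolynomial σ A) :
    mapCoeffs (d : A →ₗ[ℂ] A) (C c * p)
      = C c * mapCoeffs (d : A →ₗ[ℂ] A) p + C (d c) * p := by
  classical
  ext s
  simp only [coeff_mapCoeffs, coeff_add, coeff_C_mul,
    Derivation.coeFn_coe, Derivation.leibniz, smul_eq_mul]
  ring

/-- The coefficientwise extension of a derivation of the coefficients to polynomials. -/
def coeffDeriv (d : Derivation ℂ A A) : Derivation ℂ (MvPolynomial σ A) (MvPolynomial σ A) :=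
  Derivation.mk' (mapCoeffs (d : A →ₗ[ℂ] A)) fun p q => by
    induction p using MvPolynomial.induction_on with
    | C c =>
      rw [mapCoeffs_C_mul, mapCoeffs_C]; simp only [smul_eq_mul]
      rw [mul_comm q]; rfl
    | add p p' h h' =>
      rw [add_mul, map_add, h, h', map_add]; simp only [smul_eq_mul]; ring
    | mul_X p i h =>
      rw [show p * X i * q = p * q * X i by ring, mapCoeffs_mul_X, h, mapCoeffs_mul_X]
      simp only [smul_eq_mul]; ring

@[simp]
theorem coeffDeriv_C (d : Derivation ℂ A A) (c : A) :
    coeffDeriv d (C c : MvPolynomial σ A) = C (d c) := mapCoeffs_C _ _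

@[simp]
theorem coeffDeriv_X (d : Derivation ℂ A A) (i : σ) :
    coeffDeriv d (X i : MvPolynomial σ A) = 0 := by
  have h : mapCoeffs (d : A →ₗ[ℂ] A) (X i : MvPolynomial σ A) = 0 := by
    have := mapCoeffs_mul_X (d : A →ₗ[ℂ] A) (C 1) i
    rw [mapCoeffs_C] at this
    simpa using this
  exact h

end CoeffDeriv

namespace KaehlerAlgebra

open MvPolynomial

variable {A : Type*} [CommRing A] [Algebra ℂ A] (K : KaehlerAlgebra A)

/-- Evaluation of symbols: polynomials in `η_k = X (inl k)` and `ξ_k = X (inr k)` act by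
`η^α ξ^β ↦ (D^α f) (D^β̄ h)`. -/
def ev (f h : A) : MvPolynomial Idx A →ₗ[A] A :=
  (basisMonomials Idx A).constr A fun s =>
    (K.E 0)^[s (Sum.inl 0)] ((K.E 1)^[s (Sum.inl 1)] f)
      * (K.D 0)^[s (Sum.inr 0)] ((K.D 1)^[s (Sum.inr 1)] h)

theorem ev_monomial (f h : A) (s : Idx →₀ ℕ) (c : A) :
    K.ev f h (monomial s c) = c * ((K.E 0)^[s (Sum.inl 0)] ((K.E 1)^[s (Sum.inl 1)] f)
      * (K.D 0)^[s (Sum.inr 0)] ((K.D 1)^[s (Sum.inr 1)] h)) := by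
  have h1 : (monomial s c : MvPolynomial Idx A) = c • basisMonomials Idx A s := by
    simp [smul_monomial]
  rw [h1, map_smul, ev, Module.Basis.constr_basis, smul_eq_mul]

theorem ev_C (f h c : A) : K.ev f h (C c) = c * (f * h) := by
  rw [← monomial_zero', ev_monomial]; simp

theorem ev_C_mul (f h c : A) (p : MvPolynomial Idx A) :
    K.ev f h (C c * p) = c * K.ev f h p := by
  rw [C_mul', map_smul, smul_eq_mul]

theorem ev_mul_X_inr (f h : A) (p : MvPolynomial Idx A) (j : Fin 2) :
    K.ev f h (p * X (Sum.inr j)) = K.ev f (K.D j h) p := by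
  induction p using MvPolynomial.induction_on' with
  | add p q hp hq => rw [add_mul, map_add, map_add, hp, hq]
  | monomial s c =>
    have hc : Function.Commute (K.D 0) (K.D 1) := fun f => K.D_comm 0 1 f
    rw [X, monomial_mul, mul_one, ev_monomial, ev_monomial]
    fin_cases j
    · have := (hc.iterate_right (s (Sum.inr 1))) h
      simp [Function.iterate_succ_apply, this]
    · simp [Function.iterate_succ_apply]

theorem ev_mul_X_inl (f h : A) (p : MvPolynomial Idx A) (j : Fin 2) :
    K.ev f h (p * X (Sum.inl j)) = K.ev (K.E j f) h p := by
  induction p using MvPolynomial.induction_on' with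
  | add p q hp hq => rw [add_mul, map_add, map_add, hp, hq]
  | monomial s c =>
    have hc : Function.Commute (K.E 0) (K.E 1) := fun f => K.E_comm 0 1 f
    rw [X, monomial_mul, mul_one, ev_monomial, ev_monomial]
    fin_cases j
    · have := (hc.iterate_right (s (Sum.inl 1))) f
      simp [Function.iterate_succ_apply, this]
    · simp [Function.iterate_succ_apply]

theorem ev_add (f h h' : A) (p : MvPolynomial Idx A) :
    K.ev f (h + h') p = K.ev f h p + K.ev f h' p := by
  induction p using MvPolynomial.induction_on generalizing f h h' with
  | C c => simp only [ev_C]; ring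
  | add p q hp hq => rw [map_add, map_add, map_add, hp, hq]; ring
  | mul_X p i hp =>
    rcases i with i | i
    · simp only [ev_mul_X_inl, hp]
    · simp only [ev_mul_X_inr, map_add, hp]

theorem ev_smul (f h : A) (c : ℂ) (p : MvPolynomial Idx A) :
    K.ev f (c • h) p = c • K.ev f h p := by
  induction p using MvPolynomial.induction_on generalizing f h with
  | C c => simp only [ev_C, mul_smul_comm]
  | add p q hp hq => rw [map_add, map_add, hp, hq, smul_add]
  | mul_X p i hp =>
    rcases i with i | i
    · simp only [ev_mul_X_inl, hp]
    · rw [ev_mul_X_inr, ev_mul_X_inr, Derivation.map_smul, hp]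

/-- `ev f · p` as a linear map. -/
def evLin (f : A) (p : MvPolynomial Idx A) : A →ₗ[ℂ] A where
  toFun h := K.ev f h p
  map_add' h h' := K.ev_add f h h' p
  map_smul' c h := K.ev_smul f h c p

theorem evLin_apply (f h : A) (p : MvPolynomial Idx A) : K.evLin f p h = K.ev f h p := rfl

theorem ev_sub (f h h' : A) (p : MvPolynomial Idx A) :
    K.ev f (h - h') p = K.ev f h p - K.ev f h' p := map_sub (K.evLin f p) h h'

theorem ev_sum {ι : Type*} (s : Finset ι) (f : A) (h : ι → A) (p : MvPolynomial Idx A) :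
    K.ev f (∑ i ∈ s, h i) p = ∑ i ∈ s, K.ev f (h i) p := map_sum (K.evLin f p) h s

/-- Leibniz rule for a factor `c` whose derivatives `r_k = D^k c` are killed by all `D^j`:
`p(D)(c u) = c p(D) u + ∑ k, r_k (∂p/∂ξ_k)(D) u`. -/
theorem ev_mul {c : A} {r : Fin 2 → A} (hr : ∀ k, K.D k c = r k) (hr' : ∀ j k, K.D j (r k) = 0)
    (f u : A) (p : MvPolynomial Idx A) :
    K.ev f (c * u) p = c * K.ev f u p + ∑ k, r k * K.ev f u (pderiv (Sum.inr k) p) := by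
  have hconst : ∀ (r : A), (∀ j, K.D j r = 0) → ∀ (p : MvPolynomial Idx A) (f u : A),
      K.ev f (r * u) p = r * K.ev f u p := by
    intro r hr p
    induction p using MvPolynomial.induction_on with
    | C c => intro f u; simp only [ev_C]; ring
    | add p q hp hq => intro f u; rw [map_add, map_add, hp, hq]; ring
    | mul_X p i hp =>
      intro f u
      rcases i with i | i
      · simp only [ev_mul_X_inl, hp]
      · simp only [ev_mul_X_inr, Derivation.leibniz, smul_eq_mul, hr, mul_zero, add_zero, hp]
  induction p using MvPolynomial.induction_on generalizing f u with
  | C b => simp only [ev_C, pderiv_C, map_zero, mul_zero, Finset.sum_const_zero]; ring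
  | add p q hp hq =>
    simp only [map_add, hp, hq, Fin.sum_univ_two]; ring
  | mul_X p i hp =>
    rcases i with i | i
    · simp only [Derivation.leibniz, smul_eq_mul, pderiv_X]
      simp [ev_mul_X_inl, hp, mul_comm (X _)]
    · simp only [Derivation.leibniz, smul_eq_mul, ev_mul_X_inr, hr, ev_add, hp,
        pderiv_X, mul_comm u, hconst (r _) (fun j => hr' j _), map_add, mul_comm (X _),
        Fin.sum_univ_two]
      fin_cases i <;> simp <;> ring

theorem ev_zb_mul (k : Fin 2) (f u : A) (p : MvPolynomial Idx A) :
    K.ev f (K.zb k * u) p = K.zb k * K.ev f u p := by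
  rw [K.ev_mul (r := 0) (fun j => K.D_zb j k) (fun _ _ => by simp)]; simp

theorem ev_a_mul (l : Fin 2) (f u : A) (p : MvPolynomial Idx A) :
    K.ev f (K.a l * u) p = K.a l * K.ev f u p + K.ev f u (pderiv (Sum.inr l) p) := by
  rw [K.ev_mul (r := fun k => if k = l then 1 else 0) (fun j => K.D_a j l)
    (fun _ _ => by split_ifs <;> simp)]
  simp

/-- The covariant derivative `∇_l̄` on symbols: coefficientwise `∂_l̄`, corrected by the connection
acting on the indices `ξ`. -/
def nab (l : Fin 2) : Derivation ℂ (MvPolynomial Idx A) (MvPolynomial Idx A) :=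
  coeffDeriv (K.d (Sum.inr l))
    - ∑ k, ∑ q, (C (K.Gam k l q) * X (Sum.inr q) : MvPolynomial Idx A) •
        (pderiv (Sum.inr k) : Derivation A (MvPolynomial Idx A) _).restrictScalars ℂ

/-- The symbol `∑ g_{k l̄} η_k ξ_l` of the metric. -/
def metricSymbol : MvPolynomial Idx A :=
  ∑ k, ∑ l, C (K.G k l) * X (Sum.inl k) * X (Sum.inr l)

/-- The operator `∑ R_l̄^{k̄ j̄}_q̄ ξ_q ∂²/∂ξ_k∂ξ_j` on symbols. -/
def curvSymbolAux (l : Fin 2) (p : MvPolynomial Idx A) : MvPolynomial Idx A :=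
  ∑ k, ∑ j, ∑ q, C (K.Rc l k j q) * X (Sum.inr q) *
    pderiv (Sum.inr k) (pderiv (Sum.inr j) p)

/-- The curvature operator `½ ∑ R_l̄^{k̄ j̄}_q̄ ξ_l ξ_q ∂²/∂ξ_k∂ξ_j` on symbols. -/
def curvSymbol (p : MvPolynomial Idx A) : MvPolynomial Idx A :=
  (1 / 2 : ℂ) • ∑ l, X (Sum.inr l) * K.curvSymbolAux l p

theorem nab_apply (l : Fin 2) (p : MvPolynomial Idx A) :
    K.nab l p = coeffDeriv (K.d (Sum.inr l)) p
      - ∑ k, ∑ q, C (K.Gam k l q) * X (Sum.inr q) * pderiv (Sum.inr k) p := by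
  simp [nab, Fin.sum_univ_two]

theorem nab_C (l : Fin 2) (c : A) : K.nab l (C c) = C (K.d (Sum.inr l) c) := by
  simp [nab_apply]

theorem nab_X_inl (l k : Fin 2) : K.nab l (X (Sum.inl k)) = 0 := by
  simp [nab_apply, pderiv_X]

theorem nab_X_inr (l k : Fin 2) :
    K.nab l (X (Sum.inr k)) = -∑ q, C (K.Gam k l q) * X (Sum.inr q) := by
  rw [nab_apply, coeffDeriv_X, zero_sub]
  fin_cases k <;> simp [pderiv_X, Fin.sum_univ_two]

theorem nab_pderiv (l k : Fin 2) (p : MvPolynomial Idx A) :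
    K.nab l (pderiv (Sum.inr k) p) = pderiv (Sum.inr k) (K.nab l p)
      + ∑ j, C (K.Gam j l k) * pderiv (Sum.inr j) p := by
  induction p using MvPolynomial.induction_on with
  | C c => simp [nab_C]
  | add p q hp hq => simp only [map_add, hp, hq, Fin.sum_univ_two]; ring
  | mul_X p i hp =>
    rcases i with i | i
    · simp only [Derivation.leibniz, smul_eq_mul, pderiv_X, map_add, nab_X_inl, hp,
        Fin.sum_univ_two]
      simp
      ring
    · simp only [Derivation.leibniz, smul_eq_mul, pderiv_X, map_add, nab_X_inr, hp,
        Fin.sum_univ_two]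
      fin_cases i <;> fin_cases k <;> simp [pderiv_X] <;> ring

/-- The metric is covariantly constant. -/
theorem nab_metricSymbol (l : Fin 2) : K.nab l K.metricSymbol = 0 := by
  simp only [metricSymbol, map_add, Derivation.leibniz, smul_eq_mul, nab_X_inl, nab_X_inr, nab_C,
    d_inr_G_eq, Fin.sum_univ_two, map_mul]
  ring

end KaehlerAlgebra

namespace KaehlerAlgebra

open MvPolynomial

variable {A : Type*} [CommRing A] [Algebra ℂ A] {K : KaehlerAlgebra A}

theorem curvSymbolAux_add (l : Fin 2) (p q : MvPolynomial Idx A) :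
    K.curvSymbolAux l (p + q) = K.curvSymbolAux l p + K.curvSymbolAux l q := by
  simp only [curvSymbolAux, map_add, mul_add, Finset.sum_add_distrib]

variable (K) in
/-- The Leibniz rule for a second order operator; its two cross terms agree by the symmetry of `R`
in its upper indices. -/
theorem curvSymbolAux_mul_X_inr (l i : Fin 2) (p : MvPolynomial Idx A) :
    K.curvSymbolAux l (p * X (Sum.inr i)) = X (Sum.inr i) * K.curvSymbolAux l p
      + 2 * ∑ k, ∑ q, C (K.Rc l i k q) * X (Sum.inr q) * pderiv (Sum.inr k) p := by
  have h0 := K.Rc_symm_upper l 0 1 0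
  have h1 := K.Rc_symm_upper l 0 1 1
  simp only [curvSymbolAux, Derivation.leibniz, smul_eq_mul, pderiv_X, map_add, Fin.sum_univ_two]
  fin_cases i <;> simp [h0, h1] <;> ring

variable (K) in
theorem curvSymbolAux_mul_X_inl (l i : Fin 2) (p : MvPolynomial Idx A) :
    K.curvSymbolAux l (p * X (Sum.inl i)) = X (Sum.inl i) * K.curvSymbolAux l p := by
  simp only [curvSymbolAux, Derivation.leibniz, smul_eq_mul, pderiv_X, map_add, Fin.sum_univ_two]
  simp
  ring

/-- `∂_l̄` applied to the evaluation of a symbol. The coefficients and the factor `D^α f` are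
differentiated directly; moving `∂_l̄` past `D^β̄` produces the connection (first order in
`∂/∂ξ`) and, since `D^p̄ Γ = R`, the curvature (second order in `∂/∂ξ`). -/
theorem d_inr_ev (hK : K.LocallySymmetric) (l : Fin 2) (f h : A) (p : MvPolynomial Idx A) :
    K.d (Sum.inr l) (K.ev f h p) = K.ev f (K.d (Sum.inr l) h) p + K.ev f h (K.nab l p)
      + K.ev f h (∑ k, C (K.G k l) * X (Sum.inl k) * p)
      - (1 / 2 : ℂ) • K.ev f h (K.curvSymbolAux l p) := by
  induction p using MvPolynomial.induction_on generalizing f h with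
  | C c =>
    have h1 : K.curvSymbolAux l (C c) = 0 := by simp [curvSymbolAux]
    have h2 : ∀ k, C (K.G k l) * X (Sum.inl k) * C c
        = (C (K.G k l * c) * X (Sum.inl k) : MvPolynomial Idx A) := fun k => by
      rw [C_mul]; ring
    have hf := K.d_inr_eq l f
    simp only [h1, h2, nab_C, ev_C, Derivation.leibniz, smul_eq_mul, map_add, ev_mul_X_inl, map_zero,
      smul_zero, Fin.sum_univ_two] at hf ⊢
    linear_combination c * h * hf
  | add p q hp hq =>
    simp only [map_add, hp, hq, curvSymbolAux_add, mul_add, Finset.sum_add_distrib, smul_add]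
    ring
  | mul_X p i hp =>
    rcases i with i | i
    · have h2 : ∀ k, C (K.G k l) * X (Sum.inl k) * (p * X (Sum.inl i))
        = (C (K.G k l) * X (Sum.inl k) * p) * X (Sum.inl i) := fun k => by ring
      simp only [h2, ← Finset.sum_mul, ev_mul_X_inl, hp, Derivation.leibniz, smul_eq_mul, nab_X_inl,
        mul_zero, zero_add, curvSymbolAux_mul_X_inl, mul_comm (X (Sum.inl i) : MvPolynomial Idx A)]
    · have h2 : ∀ k, C (K.G k l) * X (Sum.inl k) * (p * X (Sum.inr i))
        = (C (K.G k l) * X (Sum.inl k) * p) * X (Sum.inr i) := fun k => by ring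
      have hG : ∀ q, K.ev f (K.Gam i l q * K.D q h) p = K.Gam i l q * K.ev f (K.D q h) p
          + ∑ k, K.Rc l i k q * K.ev f (K.D q h) (pderiv (Sum.inr k) p) := fun q =>
        K.ev_mul (r := fun k => K.Rc l i k q) (fun k => rfl) (fun j k => hK.D_Rc _ _ _ _ _) f _ p
      have hX : ∀ q r, K.ev f (K.D q h) r = K.ev f h (r * X (Sum.inr q)) := fun q r =>
        (K.ev_mul_X_inr f h r q).symm
      have hN : K.nab l (p * X (Sum.inr i)) = K.nab l p * X (Sum.inr i)
          - ∑ q, C (K.Gam i l q) * (p * X (Sum.inr q)) := by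
        simp only [Derivation.leibniz, smul_eq_mul, nab_X_inr, Fin.sum_univ_two]; ring
      have hR : K.curvSymbolAux l (p * X (Sum.inr i)) = K.curvSymbolAux l p * X (Sum.inr i)
          + (∑ k, ∑ q, C (K.Rc l i k q) * (pderiv (Sum.inr k) p * X (Sum.inr q))
            + ∑ k, ∑ q, C (K.Rc l i k q) * (pderiv (Sum.inr k) p * X (Sum.inr q))) := by
        rw [curvSymbolAux_mul_X_inr]
        simp only [Fin.sum_univ_two]
        ring
      have half : ∀ b c : A, (1 / 2 : ℂ) • (b + (c + c)) = (1 / 2 : ℂ) • b + c := fun b c => by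
        rw [smul_add, ← two_smul ℂ c, smul_smul]; norm_num
      rw [K.ev_mul_X_inr, hp, d_inr_D, ev_sub, ev_sum, hN, hR, map_add, map_add, half,
        K.ev_mul_X_inr f h (K.curvSymbolAux l p)]
      rw [K.ev_mul_X_inr f (K.d (Sum.inr l) h)]
      simp only [h2, ← Finset.sum_mul, map_sub, hX, hG]
      simp only [map_add, ev_C_mul, Fin.sum_univ_two]
      ring

/-- The curvature operator is covariantly constant on a locally symmetric algebra. -/
theorem nab_curvSymbol (hK : K.LocallySymmetric) (e : Fin 2) (p : MvPolynomial Idx A) :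
    K.nab e (K.curvSymbol p) = K.curvSymbol (K.nab e p) := by
  have comm : ∀ p : MvPolynomial Idx A, pderiv (Sum.inr 1) (pderiv (Sum.inr 0) p)
      = pderiv (Sum.inr 0) (pderiv (Sum.inr 1) p) := by
    intro p
    induction p using MvPolynomial.induction_on with
    | C c => simp
    | add p q hp hq => simp only [map_add, hp, hq]
    | mul_X p i hp =>
      simp only [Derivation.leibniz, smul_eq_mul, pderiv_X, map_add, hp]
      rcases i with i | i
      · simp
      · fin_cases i <;> simp [add_comm]
  simp only [curvSymbol, Derivation.map_smul]
  congr 1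
  simp only [curvSymbolAux, Fin.sum_univ_two, map_add, Derivation.leibniz, smul_eq_mul,
    nab_C, nab_X_inr, nab_pderiv, hK.d_inr_Rc, map_sub, map_mul, pderiv_C, comm, mul_zero]
  ring

end KaehlerAlgebra

/-! ### Uniqueness of the left multiplication operators -/

namespace KaehlerAlgebra

variable {A : Type*} [CommRing A] [Algebra ℂ A] (K : KaehlerAlgebra A)

/-- The elements whose derivatives of order less than `n` vanish at the point `ε` of `A`. -/
def vanish (ε : A →ₐ[ℂ] ℂ) : ℕ → Set A
  | 0 => Set.univ
  | n + 1 => {h | ε h = 0 ∧ ∀ B, K.d B h ∈ vanish ε n}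

variable {K} {ε : A →ₐ[ℂ] ℂ}

theorem vanish_add {n : ℕ} {f h : A} (hf : f ∈ K.vanish ε n) (hh : h ∈ K.vanish ε n) :
    f + h ∈ K.vanish ε n := by
  induction n generalizing f h with
  | zero => trivial
  | succ n ih =>
    exact ⟨by rw [map_add, hf.1, hh.1, add_zero], fun B => by
      rw [map_add]; exact ih (hf.2 B) (hh.2 B)⟩

theorem vanish_succ_subset {n : ℕ} {h : A} (hh : h ∈ K.vanish ε (n + 1)) : h ∈ K.vanish ε n := by
  induction n generalizing h with
  | zero => trivial
  | succ n ih => exact ⟨hh.1, fun B => ih (hh.2 B)⟩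

theorem vanish_anti {m n : ℕ} (hmn : m ≤ n) {h : A} (hh : h ∈ K.vanish ε n) :
    h ∈ K.vanish ε m := by
  induction hmn with
  | refl => exact hh
  | step _ ih => exact ih (vanish_succ_subset hh)

theorem vanish_mul_left {n : ℕ} (c : A) {h : A} (hh : h ∈ K.vanish ε n) :
    c * h ∈ K.vanish ε n := by
  induction n generalizing c h with
  | zero => trivial
  | succ n ih =>
    refine ⟨by rw [map_mul, hh.1, mul_zero], fun B => ?_⟩
    rw [Derivation.leibniz, smul_eq_mul, smul_eq_mul]
    refine vanish_add (ih c (hh.2 B)) ?_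
    rw [mul_comm]
    exact ih _ (vanish_succ_subset hh)

theorem vanish_zero_mem (n : ℕ) : (0 : A) ∈ K.vanish ε n := by
  induction n with
  | zero => trivial
  | succ n ih => exact ⟨map_zero _, fun B => by rwa [map_zero]⟩

theorem vanish_neg {n : ℕ} {h : A} (hh : h ∈ K.vanish ε n) : -h ∈ K.vanish ε n := by
  rw [← neg_one_mul]; exact vanish_mul_left _ hh

theorem vanish_sum {ι : Type*} {n : ℕ} (s : Finset ι) {h : ι → A}
    (hh : ∀ i ∈ s, h i ∈ K.vanish ε n) : ∑ i ∈ s, h i ∈ K.vanish ε n :=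
  Finset.sum_induction _ (· ∈ K.vanish ε n) (fun _ _ => vanish_add) (vanish_zero_mem n) hh

theorem vanish_mul {n : ℕ} {u h : A} (hu : ε u = 0) (hh : h ∈ K.vanish ε n) :
    u * h ∈ K.vanish ε (n + 1) := by
  induction n generalizing u h with
  | zero => exact ⟨by rw [map_mul, hu, zero_mul], fun B => trivial⟩
  | succ n ih =>
    refine ⟨by rw [map_mul, hu, zero_mul], fun B => ?_⟩
    rw [Derivation.leibniz, smul_eq_mul, smul_eq_mul]
    refine vanish_add (ih hu (hh.2 B)) ?_
    rw [mul_comm]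
    exact vanish_mul_left _ hh

theorem D_mem_vanish {n : ℕ} {h : A} (hh : h ∈ K.vanish ε (n + 1)) (k : Fin 2) :
    K.D k h ∈ K.vanish ε n := by
  rw [D_apply]
  exact vanish_sum _ fun m _ => vanish_mul_left _ (hh.2 _)

/-- Euler's formula modulo higher order: if `u_i` are functions vanishing at the point and `X_i`
vector fields with `∂_B = ∑ (∂_B u_i) X_i`, then `n h ≡ ∑ u_i X_i h` for functions `h` vanishing
to order `n`. -/
theorem euler_vanish {ι : Type*} [Fintype ι] {u : ι → A} (M : ι → Idx → A)
    (hu : ∀ i, ε (u i) = 0)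
    (hX : ∀ B f, K.d B f = ∑ i, K.d B (u i) * ∑ C, M i C * K.d C f) {n : ℕ} {h : A}
    (hh : h ∈ K.vanish ε n) :
    (n : A) * h - ∑ i, u i * ∑ C, M i C * K.d C h ∈ K.vanish ε (n + 1) := by
  induction n generalizing h with
  | zero =>
    refine ⟨?_, fun _ => trivial⟩
    simp [hu]
  | succ n ih =>
    refine ⟨?_, fun B => ?_⟩
    · simp [hu, hh.1]
    · have h1 := ih (hh.2 B)
      have h2 : ∑ i, u i * ∑ C, K.d B (M i C) * K.d C h ∈ K.vanish ε (n + 1) :=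
        vanish_sum _ fun i _ => vanish_mul (hu i) <|
          vanish_sum _ fun C _ => vanish_mul_left _ (hh.2 C)
      have e : K.d B (((n + 1 : ℕ) : A) * h - ∑ i, u i * ∑ C, M i C * K.d C h)
          = (n : A) * K.d B h - ∑ i, u i * ∑ C, M i C * K.d C (K.d B h)
            + -∑ i, u i * ∑ C, K.d B (M i C) * K.d C h := by
        have e1 : K.d B (∑ i, u i * ∑ C, M i C * K.d C h)
            = ∑ i, u i * ∑ C, M i C * K.d C (K.d B h)
              + ∑ i, u i * ∑ C, K.d B (M i C) * K.d C h + K.d B h := by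
          refine Eq.trans ?_ (congrArg (_ + ·) (hX B h).symm)
          rw [map_sum, ← Finset.sum_add_distrib, ← Finset.sum_add_distrib]
          refine Finset.sum_congr rfl fun i _ => ?_
          rw [Derivation.leibniz, map_sum, smul_eq_mul, smul_eq_mul, mul_comm (∑ C, _), ← mul_add,
            ← Finset.sum_add_distrib]
          congr 2
          refine Finset.sum_congr rfl fun C _ => ?_
          rw [Derivation.leibniz, smul_eq_mul, smul_eq_mul, K.d_comm B C, mul_comm (K.d C h)]
        rw [map_sub, e1, Derivation.leibniz, Derivation.map_natCast]
        simp only [smul_eq_mul, mul_zero, add_zero]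
        push_cast; ring
      rw [e]
      exact vanish_add h1 (vanish_neg h2)

/-- A functional of finite order at a point is determined by its value at `1`, its values on
multiples of the functions `z̄_k - z̄_k(ε)`, and its values on
`∑ l, (a_l - a_l(ε)) D^l̄ h`. -/
theorem functional_eq_zero (Λ : A →ₗ[ℂ] ℂ) {N : ℕ} (hN : ∀ h ∈ K.vanish ε N, Λ h = 0)
    (hz : ∀ k h, Λ ((K.zb k - algebraMap ℂ A (ε (K.zb k))) * h) = 0)
    (ha : ∀ h, ∑ l, Λ ((K.a l - algebraMap ℂ A (ε (K.a l))) * K.D l h) = 0)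
    (h1 : Λ 1 = 0) : Λ = 0 := by
  -- The vector fields dual to the functions `z̄_k`, `a_l`.
  let u : Fin 2 ⊕ Fin 2 → A := Sum.elim (fun k => K.zb k - algebraMap ℂ A (ε (K.zb k)))
    (fun l => K.a l - algebraMap ℂ A (ε (K.a l)))
  let M : Fin 2 ⊕ Fin 2 → Idx → A := Sum.elim
    (fun k => Sum.elim (fun m => -∑ l, K.d (Sum.inr k) (K.a l) * K.Gi l m)
      (fun m => if m = k then 1 else 0))
    (fun l => Sum.elim (fun m => K.Gi l m) 0)
  have hu : ∀ i, ε (u i) = 0 := by rintro (i | i) <;> simp [u]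
  have hMD : ∀ l f, ∑ C, M (Sum.inr l) C * K.d C f = K.D l f := by
    intro l f; simp [M, D_apply]
  have hMz : ∀ k f, ∑ C, M (Sum.inl k) C * K.d C f
      = K.d (Sum.inr k) f - ∑ l, K.d (Sum.inr k) (K.a l) * K.D l f := by
    intro l f
    simp only [M, D_apply, Fintype.sum_sum_type, Sum.elim_inl, Sum.elim_inr, ite_mul, one_mul,
      zero_mul, Finset.sum_ite_eq', Finset.mem_univ, if_true, Fin.sum_univ_two]
    ring
  have hX : ∀ B f, K.d B f = ∑ i, K.d B (u i) * ∑ C, M i C * K.d C f := by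
    intro B f
    rw [Fintype.sum_sum_type]
    simp only [hMD, hMz]
    rcases B with b | b
    · simp [u, K.d_inl_zb, K.d_inl_eq b f, a, G_apply]
    · simp [u, K.d_inr_zb]
  -- Euler's formula and the hypotheses show that if `Λ` kills the functions vanishing to order
  -- `m + 1 ≥ 2`, it kills those vanishing to order `m`; this descends from `N` to `1`.
  have key : ∀ n, n ≤ N → ∀ h ∈ K.vanish ε (N - n + 1), Λ h = 0 := by
    intro n hn
    induction n with
    | zero => exact fun h hh => hN h (vanish_succ_subset hh)
    | succ n ih =>
      intro h hh
      have h2 := euler_vanish M hu hX hh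
      rw [show N - (n + 1) + 1 = N - n by omega] at h2
      have h3 := ih (by omega) _ h2
      rw [Fintype.sum_sum_type] at h3
      simp only [hMD] at h3
      simp only [u, Sum.elim_inl, Sum.elim_inr, map_sub, map_add, map_sum] at h3
      rw [ha, Finset.sum_eq_zero (fun k _ => hz k _), ← nsmul_eq_mul, map_nsmul, add_zero, sub_zero,
        smul_eq_zero] at h3
      rcases h3 with h3 | h3
      · omega
      · exact h3
  ext h
  have h4 : h = ε h • (1 : A) + (h - ε h • (1 : A)) := by ring
  have h5 : h - ε h • (1 : A) ∈ K.vanish ε (N - N + 1) := by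
    rw [Nat.sub_self]
    exact ⟨by simp, fun _ => trivial⟩
  rw [h4, map_add, key N le_rfl _ h5, map_smul, h1]
  simp

/-- The conditions on the family of operators `L_m h = C_m(f, h)` that determine it: `f ∗ 1 = f`,
`f ∗ (z̄_k h) = z̄_k (f ∗ h)`, finite order, and the contraction with the frame `D^l̄` of the
condition that `f ∗ ·` commutes with `a_l + ħ ∂_l̄`. -/
structure IsLeftMul (P : Set (A →ₐ[ℂ] ℂ)) (f : A) (L : ℕ → A →ₗ[ℂ] A) : Prop where
  one_zero : L 0 1 = f
  one_succ : ∀ m, L (m + 1) 1 = 0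
  zb : ∀ m k h, L m (K.zb k * h) = K.zb k * L m h
  finite_order : ∀ m, ∀ ε ∈ P, ∃ N, ∀ h ∈ K.vanish ε N, ε (L m h) = 0
  euler_zero : ∀ h, ∑ l, (L 0 (K.a l * K.D l h) - K.a l * L 0 (K.D l h)) = 0
  euler_succ : ∀ m h, ∑ l, (L (m + 1) (K.a l * K.D l h) - K.a l * L (m + 1) (K.D l h))
    = ∑ l, (K.d (Sum.inr l) (L m (K.D l h)) - L m (K.d (Sum.inr l) (K.D l h)))

/-- By induction on `m`, the difference of `L_m` and `L'_m` at a point is a functional of finite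
order, and so vanishes by `functional_eq_zero`. -/
theorem IsLeftMul.unique {P : Set (A →ₐ[ℂ] ℂ)} (hP : ∀ a b : A, (∀ ε ∈ P, ε a = ε b) → a = b)
    {f : A} {L L' : ℕ → A →ₗ[ℂ] A} (hL : K.IsLeftMul P f L) (hL' : K.IsLeftMul P f L') :
    ∀ m, L m = L' m := by
  have step : ∀ m, L m 1 = L' m 1 →
      (∀ h, ∑ l, (L m (K.a l * K.D l h) - K.a l * L m (K.D l h))
        = ∑ l, (L' m (K.a l * K.D l h) - K.a l * L' m (K.D l h))) → L m = L' m := by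
    intro m h1 he
    ext h
    refine hP _ _ fun ε hε => ?_
    obtain ⟨N, hN⟩ := hL.finite_order m ε hε
    obtain ⟨N', hN'⟩ := hL'.finite_order m ε hε
    have hΛ := functional_eq_zero (K := K) (ε := ε) (ε.toLinearMap ∘ₗ (L m - L' m)) (N := max N N')
      (fun h hh => by
        simp [hN h (vanish_anti (le_max_left _ _) hh), hN' h (vanish_anti (le_max_right _ _) hh)])
      (fun k h => by
        rw [sub_mul, ← Algebra.smul_def]
        simp [hL.zb, hL'.zb])
      (fun h => by
        have := congrArg ε (he h)
        simp only [sub_mul, ← Algebra.smul_def, map_add, map_sub, map_mul, map_smul,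
          LinearMap.comp_apply, LinearMap.sub_apply, AlgHom.toLinearMap_apply, smul_eq_mul,
          Fin.sum_univ_two] at this ⊢
        linear_combination this)
      (by simp [h1])
    have := congrArg (fun Λ : A →ₗ[ℂ] ℂ => Λ h) hΛ
    simpa [sub_eq_zero] using this
  intro m
  induction m with
  | zero =>
    exact step 0 (by rw [hL.one_zero, hL'.one_zero]) fun h => by
      rw [hL.euler_zero, hL'.euler_zero]
  | succ m ih =>
    exact step (m + 1) (by rw [hL.one_succ, hL'.one_succ]) fun h => by
      rw [hL.euler_succ, hL'.euler_succ, ih]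

end KaehlerAlgebra

/-! ### The coefficients of the star product -/

namespace StarCoeff

variable {S : Type*} [CommRing S]

/-- The pentadiagonal matrix `H_k` over an arbitrary commutative ring. -/
def HMat (R : Fin 2 → Fin 2 → Fin 2 → Fin 2 → S) (k : ℕ) : Matrix (Fin (k + 1)) (Fin (k + 1)) S :=
  Matrix.of fun r c =>
    let i : ℕ := (r : ℕ) + 1
    let j : ℕ := (c : ℕ) + 1
    if i + 2 = j then ((k + 3 - j).choose 2 : S) * R 1 0 0 1
    else if i + 1 = j then
      2 * ((k + 2 - j).choose 2 : S) * R 1 0 0 0 + ((k : S) - j + 2) * ((j : S) - 2) * R 1 1 0 1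
    else if i = j then
      ((k + 1 - j).choose 2 : S) * R 0 0 0 0 + ((j - 1).choose 2 : S) * R 1 1 1 1
        + 2 * ((k : S) - j + 1) * ((j : S) - 1) * R 1 1 0 0
    else if i = j + 1 then
      2 * (j.choose 2 : S) * R 1 1 1 0 + (j : S) * ((k : S) - j) * R 0 1 0 0
    else if i = j + 2 then ((j + 1).choose 2 : S) * R 0 1 1 0
    else 0

theorem HMat_eq_H (R : Fin 2 → Fin 2 → Fin 2 → Fin 2 → ℂ) (k : ℕ) : HMat R k = H R k := rfl

/-- The inclusion of the exponents of degree `n` into those of degree `n + 1` given by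
multiplication with the variable of index `k`. -/
def inc (S : Type*) [CommRing S] (n : ℕ) (k : Fin 2) : Matrix (Fin (n + 2)) (Fin (n + 1)) S :=
  Matrix.of fun i j => if (i : ℕ) = j + k then 1 else 0

/-- The coefficient of `ħ^m` in the matrix `T_n`, determined by the recursion
`(n + 1) T_{n+1} = ħ (∑ g_{k l̄} inc_k T_n inc_lᵀ - T_{n+1} H_{n+1})`. -/
def tcoef [Algebra ℂ S] (G : Matrix (Fin 2) (Fin 2) S) (R : Fin 2 → Fin 2 → Fin 2 → Fin 2 → S) :
    (m n : ℕ) → Matrix (Fin (n + 1)) (Fin (n + 1)) S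
  | 0, 0 => 1
  | 0, _ + 1 => 0
  | _ + 1, 0 => 0
  | m + 1, n + 1 => ((n + 1 : ℂ)⁻¹) •
      (∑ k, ∑ l, G k l • (inc S n k * tcoef G R m n * (inc S n l).transpose)
        - tcoef G R m (n + 1) * HMat R (n + 1))

theorem tcoef_eq_zero [Algebra ℂ S] (G : Matrix (Fin 2) (Fin 2) S)
    (R : Fin 2 → Fin 2 → Fin 2 → Fin 2 → S) {m n : ℕ} (h : m < n) : tcoef G R m n = 0 := by
  induction m generalizing n with
  | zero =>
    obtain ⟨n, rfl⟩ := Nat.exists_eq_succ_of_ne_zero h.ne'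
    rfl
  | succ m ih =>
    obtain ⟨n, rfl⟩ := Nat.exists_eq_succ_of_ne_zero (Nat.ne_zero_of_lt h)
    simp [tcoef, ih (show m < n by omega), ih (show m < n + 1 by omega)]

/-- The coefficients are polynomial in the metric and the curvature, and so compatible with
homomorphisms. -/
theorem tcoef_map {S' : Type*} [CommRing S'] [Algebra ℂ S] [Algebra ℂ S'] (ε : S →ₐ[ℂ] S')
    (G : Matrix (Fin 2) (Fin 2) S) (R : Fin 2 → Fin 2 → Fin 2 → Fin 2 → S) (m n : ℕ) :
    (tcoef G R m n).map ε = tcoef (G.map ε) (fun i k l c => ε (R i k l c)) m n := by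
  have hH : ∀ k, (HMat R k).map ε = HMat (fun i k l c => ε (R i k l c)) k := by
    intro k
    ext r c
    have h2 : ε 2 = 2 := map_ofNat ε 2
    simp only [HMat, Matrix.map_apply, Matrix.of_apply]
    split_ifs <;> simp [h2]
  have hinc : ∀ n k, (inc S n k).map ε = inc S' n k := by
    intro n k
    ext r c
    simp only [inc, Matrix.map_apply, Matrix.of_apply]
    split_ifs <;> simp
  have hmul : ∀ {a b c : ℕ} (M : Matrix (Fin a) (Fin b) S) (N : Matrix (Fin b) (Fin c) S),
      (M * N).map ε = M.map ε * N.map ε := fun M N => by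
    ext; simp [Matrix.mul_apply]
  induction m generalizing n with
  | zero => rcases n with _ | n <;> ext <;> simp [tcoef, Matrix.one_apply]
  | succ m ih =>
    rcases n with _ | n
    · ext; simp [tcoef]
    · have hmul' : ∀ {a b c : ℕ} (M : Matrix (Fin a) (Fin b) S) (N : Matrix (Fin b) (Fin c) S) i j,
          ε ((M * N) i j) = (M.map ε * N.map ε) i j := fun M N i j => by
        rw [← hmul, Matrix.map_apply]
      simp only [tcoef, ← ih, ← hH, ← hinc]
      ext i j
      simp [Fin.sum_univ_two, hmul', hmul, Matrix.transpose_map]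

end StarCoeff

namespace KaehlerAlgebra

open MvPolynomial StarCoeff

variable {A : Type*} [CommRing A]

/-- The monomials of degree `n` in two variables. -/
def monos (u : Fin 2 → Idx) (n : ℕ) (i : Fin (n + 1)) : MvPolynomial Idx A :=
  X (u 0) ^ (n - (i : ℕ)) * X (u 1) ^ (i : ℕ)

/-- The symbol `∑ M_{ij} η_1^{n-i} η_2^i ξ_1^{n-j} ξ_2^j` of a matrix `M`. -/
def symb (n : ℕ) (M : Matrix (Fin (n + 1)) (Fin (n + 1)) A) : MvPolynomial Idx A :=
  ∑ i, ∑ j, C (M i j) * (monos Sum.inl n i * monos Sum.inr n j)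

theorem symb_add (n : ℕ) (M N : Matrix (Fin (n + 1)) (Fin (n + 1)) A) :
    symb n (M + N) = symb n M + symb n N := by
  simp only [symb, Matrix.add_apply, map_add, add_mul, Finset.sum_add_distrib]

theorem symb_smul' (n : ℕ) (c : A) (M : Matrix (Fin (n + 1)) (Fin (n + 1)) A) :
    symb n (c • M) = C c * symb n M := by
  simp only [symb, Matrix.smul_apply, smul_eq_mul, C_mul, Finset.mul_sum, mul_assoc]

theorem symb_zero (n : ℕ) : symb n (0 : Matrix (Fin (n + 1)) (Fin (n + 1)) A) = 0 := by
  simp [symb]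

theorem symb_sub (n : ℕ) (M N : Matrix (Fin (n + 1)) (Fin (n + 1)) A) :
    symb n (M - N) = symb n M - symb n N := by
  simp only [symb, Matrix.sub_apply, map_sub, sub_mul, Finset.sum_sub_distrib]

theorem sum_inc_mul_monos (u : Fin 2 → Idx) (n : ℕ) (k : Fin 2) (j : Fin (n + 1)) :
    ∑ i, C (inc A n k i j) * monos u (n + 1) i = (X (u k) * monos u n j : MvPolynomial Idx A) := by
  have hj := j.2
  fin_cases k
  · rw [Finset.sum_eq_single j.castSucc]
    · simp only [inc, monos, Matrix.of_apply, Fin.val_castSucc]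
      simp only [Fin.zero_eta, add_zero, if_true, C_1, one_mul]
      rw [show n + 1 - (j : ℕ) = (n - j) + 1 by omega]; ring
    · intro i _ hi
      have : ¬ (i : ℕ) = j := fun h => hi (Fin.ext h)
      simp [inc, this]
    · simp
  · rw [Finset.sum_eq_single j.succ]
    · simp only [inc, monos, Matrix.of_apply, Fin.val_succ]
      simp only [Fin.mk_one, if_true, C_1, one_mul]
      rw [show n + 1 - ((j : ℕ) + 1) = n - j by omega]; ring
    · intro i _ hi
      have : ¬ (i : ℕ) = j + 1 := fun h => hi (Fin.ext h)
      simp [inc, this]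
    · simp

/-- The shift of the indices is multiplication by `η_k ξ_l` on symbols. -/
theorem symb_inc (n : ℕ) (k l : Fin 2) (M : Matrix (Fin (n + 1)) (Fin (n + 1)) A) :
    symb (n + 1) (inc A n k * M * (inc A n l).transpose)
      = X (Sum.inl k) * X (Sum.inr l) * symb n M := by
  have h1 : symb (n + 1) (inc A n k * M * (inc A n l).transpose)
      = ∑ a, ∑ b, C (M a b) * ((∑ i, C (inc A n k i a) * monos Sum.inl (n + 1) i)
        * (∑ j, C (inc A n l j b) * monos Sum.inr (n + 1) j)) := by
    simp only [symb, Matrix.mul_apply, Matrix.transpose_apply, map_sum, Finset.sum_mul,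
      Finset.mul_sum, C_mul]
    rw [Finset.sum_congr rfl fun i _ => Finset.sum_comm]
    rw [Finset.sum_comm]
    rw [Finset.sum_congr rfl fun b _ => Finset.sum_congr rfl fun i _ => Finset.sum_comm]
    rw [Finset.sum_congr rfl fun b _ => Finset.sum_comm]
    rw [Finset.sum_comm]
    refine Finset.sum_congr rfl fun a _ => Finset.sum_congr rfl fun b _ => ?_
    rw [Finset.sum_comm]
    refine Finset.sum_congr rfl fun j _ => Finset.sum_congr rfl fun i _ => ?_
    ring
  rw [h1]
  simp only [sum_inc_mul_monos]
  rw [symb, Finset.mul_sum]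
  refine Finset.sum_congr rfl fun a _ => ?_
  rw [Finset.mul_sum]
  refine Finset.sum_congr rfl fun b _ => ?_
  ring

variable [Algebra ℂ A] {K : KaehlerAlgebra A}

theorem symb_smul (n : ℕ) (c : ℂ) (M : Matrix (Fin (n + 1)) (Fin (n + 1)) A) :
    symb n (c • M) = c • symb n M := by
  have h : ∀ a : A, (C (c • a) : MvPolynomial Idx A) = c • C a := fun a => by
    classical
    ext s
    rw [coeff_smul, coeff_C, coeff_C]
    split_ifs <;> simp
  simp only [symb, Matrix.smul_apply, h, Finset.smul_sum, smul_mul_assoc]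

theorem symb_metric (n : ℕ) (M : Matrix (Fin (n + 1)) (Fin (n + 1)) A) :
    symb (n + 1) (∑ k, ∑ l, K.G k l • (inc A n k * M * (inc A n l).transpose))
      = K.metricSymbol * symb n M := by
  simp only [Fin.sum_univ_two, symb_add, symb_smul', symb_inc, metricSymbol]
  ring

theorem curvSymbol_add (p q : MvPolynomial Idx A) :
    K.curvSymbol (p + q) = K.curvSymbol p + K.curvSymbol q := by
  simp only [curvSymbol, curvSymbolAux_add, mul_add, Finset.sum_add_distrib, smul_add]

theorem curvSymbol_zero : K.curvSymbol (0 : MvPolynomial Idx A) = 0 := by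
  simp [curvSymbol, curvSymbolAux]

theorem curvSymbol_sum {ι : Type*} (s : Finset ι) (p : ι → MvPolynomial Idx A) :
    K.curvSymbol (∑ i ∈ s, p i) = ∑ i ∈ s, K.curvSymbol (p i) :=
  map_sum (⟨⟨K.curvSymbol, curvSymbol_zero⟩, curvSymbol_add⟩ : _ →+ MvPolynomial Idx A) p s

theorem curvSymbol_C_mul (c : A) (p : MvPolynomial Idx A) :
    K.curvSymbol (C c * p) = C c * K.curvSymbol p := by
  simp only [curvSymbol, curvSymbolAux, pderiv_C_mul, Fin.sum_univ_two, mul_smul_comm]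
  congr 1
  ring

theorem curvSymbol_X_inl_mul (i : Fin 2) (p : MvPolynomial Idx A) :
    K.curvSymbol (X (Sum.inl i) * p) = X (Sum.inl i) * K.curvSymbol p := by
  rw [mul_comm, curvSymbol]
  simp only [curvSymbolAux_mul_X_inl, curvSymbol, mul_smul_comm, Finset.mul_sum]
  congr 1
  exact Finset.sum_congr rfl fun l _ => by ring

theorem curvSymbol_monos_inl_mul (n : ℕ) (i : Fin (n + 1)) (p : MvPolynomial Idx A) :
    K.curvSymbol (monos Sum.inl n i * p) = monos Sum.inl n i * K.curvSymbol p := by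
  have hpow : ∀ (k : Fin 2) (a : ℕ) (p : MvPolynomial Idx A),
      K.curvSymbol (X (Sum.inl k) ^ a * p) = X (Sum.inl k) ^ a * K.curvSymbol p := by
    intro k a
    induction a with
    | zero => intro p; simp
    | succ a ih => intro p; rw [pow_succ, mul_assoc, ih, curvSymbol_X_inl_mul, mul_assoc]
  rw [monos, mul_assoc, hpow, hpow, mul_assoc]

theorem choose_two_cast {S : Type*} [CommRing S] (n : ℕ) :
    (2 : S) * ((n + 2).choose 2 : S) = (n + 2) * (n + 1) := by
  have h : 2 * (n + 2).choose 2 = (n + 2) * (n + 1) := by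
    rw [Nat.choose_two_right, Nat.mul_div_cancel']
    · rfl
    · exact (Nat.even_mul_pred_self (n + 2)).two_dvd
  exact_mod_cast congrArg (Nat.cast : ℕ → S) h

end KaehlerAlgebra

namespace KaehlerAlgebra

open MvPolynomial StarCoeff

variable {A : Type*} [CommRing A]

theorem pderiv_zero_pow_mul_pow (a b : ℕ) :
    pderiv (Sum.inr 0) (X (Sum.inr 0) ^ a * X (Sum.inr 1) ^ b : MvPolynomial Idx A)
      = (a : MvPolynomial Idx A) * (X (Sum.inr 0) ^ (a - 1) * X (Sum.inr 1) ^ b) := by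
  simp [Derivation.leibniz, Derivation.leibniz_pow, pderiv_X]
  ring

theorem pderiv_one_pow_mul_pow (a b : ℕ) :
    pderiv (Sum.inr 1) (X (Sum.inr 0) ^ a * X (Sum.inr 1) ^ b : MvPolynomial Idx A)
      = (b : MvPolynomial Idx A) * (X (Sum.inr 0) ^ a * X (Sum.inr 1) ^ (b - 1)) := by
  simp [Derivation.leibniz, Derivation.leibniz_pow, pderiv_X]
  ring

theorem pderiv_natCast_mul (i : Idx) (n : ℕ) (p : MvPolynomial Idx A) :
    pderiv i ((n : MvPolynomial Idx A) * p) = (n : MvPolynomial Idx A) * pderiv i p := by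
  rw [← map_natCast C, pderiv_C_mul]

/-- Contraction of the row `r` of the matrix `H_k` with a family, where `x = k - r`; the entries
outside of the matrix do not contribute, since their coefficients vanish. -/
theorem sum_HMat_row (R : Fin 2 → Fin 2 → Fin 2 → Fin 2 → A) (k x r : ℕ) (hk : k = x + r)
    (F : ℕ → MvPolynomial Idx A) (hr : r < k + 1) :
    ∑ c : Fin (k + 1), C (HMat R k ⟨r, hr⟩ c) * F c
      = C ((x.choose 2 : A) * R 1 0 0 1) * F (r + 2)
        + C (2 * (x.choose 2 : A) * R 1 0 0 0 + (x : A) * (r : A) * R 1 1 0 1) * F (r + 1)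
        + C ((x.choose 2 : A) * R 0 0 0 0 + (r.choose 2 : A) * R 1 1 1 1
            + 2 * (x : A) * (r : A) * R 1 1 0 0) * F r
        + C (2 * (r.choose 2 : A) * R 1 1 1 0 + (r : A) * (x : A) * R 0 1 0 0) * F (r - 1)
        + C ((r.choose 2 : A) * R 0 1 1 0) * F (r - 2) := by
  subst hk
  have e : ∀ c : Fin (x + r + 1), C (HMat R (x + r) ⟨r, hr⟩ c) * F c
      = ((if (c : ℕ) = r + 2 then C ((x.choose 2 : A) * R 1 0 0 1) * F (r + 2) else 0)
        + (if (c : ℕ) = r + 1 then C (2 * (x.choose 2 : A) * R 1 0 0 0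
            + (x : A) * (r : A) * R 1 1 0 1) * F (r + 1) else 0)
        + (if (c : ℕ) = r then C ((x.choose 2 : A) * R 0 0 0 0 + (r.choose 2 : A) * R 1 1 1 1
            + 2 * (x : A) * (r : A) * R 1 1 0 0) * F r else 0)
        + (if (c : ℕ) + 1 = r then C (2 * (r.choose 2 : A) * R 1 1 1 0
            + (r : A) * (x : A) * R 0 1 0 0) * F (r - 1) else 0)
        + (if (c : ℕ) + 2 = r then C ((r.choose 2 : A) * R 0 1 1 0) * F (r - 2) else 0)) := by
    rintro ⟨c, hc⟩
    simp only [HMat, Matrix.of_apply]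
    by_cases h1 : c = r + 2
    · subst h1
      simp only [show r + 1 + 2 = r + 2 + 1 by omega, show x + r + 3 - (r + 2 + 1) = x by omega,
        show ¬ r + 2 = r + 1 by omega, show ¬ r + 2 = r by omega, show ¬ r + 2 + 1 = r by omega,
        show ¬ r + 2 + 2 = r by omega, if_true, if_false, add_zero]
    by_cases h2 : c = r + 1
    · subst h2
      simp only [show ¬ r + 1 + 2 = r + 1 + 1 by omega, show x + r + 2 - (r + 1 + 1) = x by omega,
        show ¬ r + 1 = r + 2 by omega, show ¬ r + 1 = r by omega, show ¬ r + 1 + 1 = r by omega,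
        show ¬ r + 1 + 2 = r by omega, if_true, if_false, add_zero, zero_add]
      congr 2
      push_cast
      ring
    by_cases h3 : c = r
    · subst h3
      simp only [show ¬ c + 1 + 2 = c + 1 by omega, show x + c + 1 - (c + 1) = x by omega,
        show ¬ c + 1 + 1 = c + 1 by omega, show c + 1 - 1 = c by omega,
        show ¬ c = c + 2 by omega, show ¬ c = c + 1 by omega, show ¬ c + 1 = c by omega,
        show ¬ c + 2 = c by omega, if_true, if_false, add_zero, zero_add]
      congr 2
      push_cast
      ring
    by_cases h4 : c + 1 = r
    · subst h4
      simp only [show ¬ c + 1 + 1 + 2 = c + 1 by omega, show ¬ c + 1 + 1 + 1 = c + 1 by omega,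
        show ¬ c + 1 + 1 = c + 1 by omega, show ¬ c = c + 1 + 2 by omega,
        show ¬ c = c + 1 + 1 by omega, show ¬ c = c + 1 by omega,
        show c + 1 - 1 = c by omega, if_true, if_false, add_zero, zero_add]
      congr 2
      push_cast
      ring
    by_cases h5 : c + 2 = r
    · subst h5
      simp only [show ¬ c + 2 + 1 + 2 = c + 1 by omega, show ¬ c + 2 + 1 + 1 = c + 1 by omega,
        show ¬ c + 2 + 1 = c + 1 by omega, show ¬ c + 2 + 1 = c + 1 + 1 by omega,
        show c + 2 + 1 = c + 1 + 2 by omega, show ¬ c = c + 2 + 2 by omega,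
        show ¬ c = c + 2 + 1 by omega, show ¬ c = c + 2 by omega, show ¬ c + 1 = c + 2 by omega,
        show c + 2 - 2 = c by omega, if_true, if_false, add_zero, zero_add]
    · rw [if_neg (by omega), if_neg (by omega), if_neg (by omega), if_neg (by omega),
        if_neg (by omega), if_neg h1, if_neg h2, if_neg h3, if_neg h4, if_neg h5]
      simp
  have hs : ∀ (p : ℕ) (Y : MvPolynomial Idx A), (p < x + r + 1 ∨ Y = 0) →
      ∑ c : Fin (x + r + 1), (if (c : ℕ) = p then Y else 0) = Y := by
    intro p Y h
    rcases h with h | h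
    · rw [Finset.sum_eq_single ⟨p, h⟩]
      · simp
      · intro c _ hc
        exact if_neg fun h' => hc (Fin.ext h')
      · simp
    · simp [h]
  have hs' : ∀ (p : ℕ) (Y : MvPolynomial Idx A), (p ≤ r ∨ Y = 0) →
      ∑ c : Fin (x + r + 1), (if (c : ℕ) + p = r then Y else 0) = Y := by
    intro p Y h
    rcases h with h | h
    · refine (Finset.sum_congr rfl fun c _ => ?_).trans (hs (r - p) Y (Or.inl (by omega)))
      exact if_congr (by omega) rfl rfl
    · simp [h]
  rw [Finset.sum_congr rfl fun c _ => e c]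
  simp only [Finset.sum_add_distrib]
  rw [hs, hs, hs, hs' 1, hs' 2]
  · rcases r with _ | _ | r
    · right; simp
    · right; simp
    · left; omega
  · rcases r with _ | r
    · right; simp
    · left; omega
  · left; omega
  · rcases x with _ | x
    · right; simp
    · left; omega
  · rcases x with _ | _ | x
    · right; simp
    · right; simp
    · left; omega

variable [Algebra ℂ A] {K : KaehlerAlgebra A}

/-- The rows of the matrix `H_n` describe the curvature operator on monomials. -/
theorem curvSymbol_monos (n : ℕ) (r : Fin (n + 1)) :
    K.curvSymbol (monos Sum.inr n r) = ∑ c, C (HMat K.Rc n r c) * monos Sum.inr n c := by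
  obtain ⟨r, hr⟩ := r
  obtain ⟨x, hx⟩ : ∃ x, n = x + r := ⟨n - r, by omega⟩
  have h := sum_HMat_row K.Rc n x r hx
    (fun c => X (Sum.inr 0) ^ (n - c) * X (Sum.inr 1) ^ c) hr
  simp only [monos] at h ⊢
  rw [h]
  have e1 := K.Rc_symm_lower 0 0 0 1
  have e3 := K.Rc_symm_lower 0 1 1 1
  have e4 := fun l q => K.Rc_symm_upper l 0 1 q
  have e5 := K.Rc_symm_lower 0 1 0 1
  have half : ∀ p q : MvPolynomial Idx A, p = 2 * q → (1 / 2 : ℂ) • p = q := fun p q h => by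
    rw [h, two_mul, ← two_smul ℂ, smul_smul]; norm_num
  rw [curvSymbol]
  apply half
  subst hx
  simp only [curvSymbolAux, Fin.sum_univ_two, show x + r - r = x by omega,
    pderiv_zero_pow_mul_pow, pderiv_one_pow_mul_pow, pderiv_natCast_mul, e4, e1, e3, e5]
  have hC : (C 2 : MvPolynomial Idx A) = 2 := map_ofNat C 2
  -- Twice the terms of the row that contain the binomial coefficient of `x`, respectively `r`.
  let P (x ρ : ℕ) : MvPolynomial Idx A :=
    C (K.Rc 1 0 0 1) * X (Sum.inr 0) ^ x * X (Sum.inr 1) ^ (ρ + 2)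
      + 2 * C (K.Rc 1 0 0 0) * X (Sum.inr 0) ^ (x + 1) * X (Sum.inr 1) ^ (ρ + 1)
      + C (K.Rc 0 0 0 0) * X (Sum.inr 0) ^ (x + 2) * X (Sum.inr 1) ^ ρ
  let Q (χ r : ℕ) : MvPolynomial Idx A :=
    C (K.Rc 1 1 1 1) * X (Sum.inr 0) ^ χ * X (Sum.inr 1) ^ (r + 2)
      + 2 * C (K.Rc 1 1 1 0) * X (Sum.inr 0) ^ (χ + 1) * X (Sum.inr 1) ^ (r + 1)
      + C (K.Rc 0 1 1 0) * X (Sum.inr 0) ^ (χ + 2) * X (Sum.inr 1) ^ r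
  rcases x with _ | _ | x <;> rcases r with _ | _ | r
  · simp
  · simp
  · have hr := choose_two_cast (S := MvPolynomial Idx A) r
    simp [hC, show r + 1 + 1 - r = 2 by omega]
    linear_combination -(Q 0 r) * hr
  · simp
  · simp [hC]; ring
  · have hr := choose_two_cast (S := MvPolynomial Idx A) r
    simp [hC, show 1 + (r + 1 + 1) - (r + 1 + 1 + 1) = 0 by omega,
      show 1 + (r + 1 + 1) - (r + 1) = 2 by omega, show 1 + (r + 1 + 1) - r = 3 by omega]
    linear_combination -(Q 1 r) * hr
  · have hx := choose_two_cast (S := MvPolynomial Idx A) x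
    simp [hC]
    linear_combination -(P x 0) * hx
  · have hx := choose_two_cast (S := MvPolynomial Idx A) x
    simp [hC, show x + 2 + 1 - 2 = x + 1 by omega]
    linear_combination -(P x 1) * hx
  · have hx := choose_two_cast (S := MvPolynomial Idx A) x
    have hr := choose_two_cast (S := MvPolynomial Idx A) r
    simp [hC, show x + 2 + (r + 2) - (r + 2 + 2) = x by omega,
      show x + 2 + (r + 2) - (r + 2 + 1) = x + 1 by omega,
      show x + 2 + (r + 2) - (r + 1) = x + 3 by omega, show x + 2 + (r + 2) - r = x + 4 by omega]
    linear_combination -(P x (r + 2)) * hx - (Q (x + 2) r) * hr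

end KaehlerAlgebra

namespace KaehlerAlgebra

open MvPolynomial StarCoeff

variable {A : Type*} [CommRing A]

/-- The Euler operator in the variables `ξ`. -/
def eulerSymbol (p : MvPolynomial Idx A) : MvPolynomial Idx A :=
  ∑ l, X (Sum.inr l) * pderiv (Sum.inr l) p

theorem eulerSymbol_add (p q : MvPolynomial Idx A) :
    eulerSymbol (p + q) = eulerSymbol p + eulerSymbol q := by
  simp only [eulerSymbol, map_add, mul_add, Finset.sum_add_distrib]

theorem eulerSymbol_zero : eulerSymbol (0 : MvPolynomial Idx A) = 0 := by
  simp [eulerSymbol]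

theorem eulerSymbol_sum {ι : Type*} (s : Finset ι) (p : ι → MvPolynomial Idx A) :
    eulerSymbol (∑ i ∈ s, p i) = ∑ i ∈ s, eulerSymbol (p i) :=
  map_sum (⟨⟨eulerSymbol, eulerSymbol_zero⟩, eulerSymbol_add⟩ : _ →+ MvPolynomial Idx A) p s

theorem eulerSymbol_monos (n : ℕ) (i j : Fin (n + 1)) (c : A) :
    eulerSymbol (C c * (monos Sum.inl n i * monos Sum.inr n j))
      = (n : MvPolynomial Idx A) * (C c * (monos Sum.inl n i * monos Sum.inr n j)) := by
  have h1 : ∀ l, pderiv (Sum.inr l) (monos Sum.inl n i : MvPolynomial Idx A) = 0 := fun l => by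
    simp [monos, Derivation.leibniz, Derivation.leibniz_pow, pderiv_X]
  have h2 : ∀ (u : MvPolynomial Idx A) (a : ℕ), u * ((a : MvPolynomial Idx A) * u ^ (a - 1))
      = a * u ^ a := fun u a => by
    rcases a with _ | a
    · simp
    · rw [Nat.add_sub_cancel, pow_succ]; ring
  have h3 : ((n - (j : ℕ) : ℕ) : MvPolynomial Idx A) + ((j : ℕ) : MvPolynomial Idx A) = n := by
    rw [← Nat.cast_add, Nat.sub_add_cancel (Nat.lt_succ_iff.mp j.2)]
  simp only [eulerSymbol, Derivation.leibniz, smul_eq_mul, h1, Fin.sum_univ_two, pderiv_C]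
  rw [show (monos Sum.inr n j : MvPolynomial Idx A)
    = X (Sum.inr 0) ^ (n - (j : ℕ)) * X (Sum.inr 1) ^ (j : ℕ) from rfl, pderiv_zero_pow_mul_pow,
    pderiv_one_pow_mul_pow, ← h3]
  have e0 := h2 (X (Sum.inr 0)) (n - (j : ℕ))
  have e1 := h2 (X (Sum.inr 1)) (j : ℕ)
  linear_combination C c * monos Sum.inl n i * X (Sum.inr 1) ^ (j : ℕ) * e0
    + C c * monos Sum.inl n i * X (Sum.inr 0) ^ (n - (j : ℕ)) * e1

theorem eulerSymbol_symb (n : ℕ) (M : Matrix (Fin (n + 1)) (Fin (n + 1)) A) :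
    eulerSymbol (symb n M) = (n : MvPolynomial Idx A) * symb n M := by
  simp only [symb, eulerSymbol_sum, eulerSymbol_monos, Finset.mul_sum]

theorem symb_zero_eq (M : Matrix (Fin 1) (Fin 1) A) : symb 0 M = C (M 0 0) := by
  simp [symb, monos]

variable [Algebra ℂ A] {K : KaehlerAlgebra A}

/-- Right multiplication by `H_n` is the curvature operator on symbols. -/
theorem curvSymbol_symb (n : ℕ) (M : Matrix (Fin (n + 1)) (Fin (n + 1)) A) :
    symb n (M * HMat K.Rc n) = K.curvSymbol (symb n M) := by
  simp only [symb, curvSymbol_sum, curvSymbol_C_mul, curvSymbol_monos_inl_mul, curvSymbol_monos,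
    Matrix.mul_apply, map_sum, C_mul, Finset.mul_sum, Finset.sum_mul]
  refine Finset.sum_congr rfl fun i _ => ?_
  rw [Finset.sum_comm]
  refine Finset.sum_congr rfl fun j _ => Finset.sum_congr rfl fun c _ => ?_
  ring

theorem natCast_mul_symb_tcoef_succ (m n : ℕ) :
    ((n + 1 : ℕ) : MvPolynomial Idx A) * symb (n + 1) (tcoef K.G K.Rc (m + 1) (n + 1))
      = K.metricSymbol * symb n (tcoef K.G K.Rc m n)
        - K.curvSymbol (symb (n + 1) (tcoef K.G K.Rc m (n + 1))) := by
  have h : (n + 1 : ℂ) ≠ 0 := Nat.cast_add_one_ne_zero n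
  rw [tcoef, symb_smul, symb_sub, symb_metric, curvSymbol_symb, ← nsmul_eq_mul,
    ← Nat.cast_smul_eq_nsmul ℂ, smul_smul, Nat.cast_add, Nat.cast_one, mul_inv_cancel₀ h, one_smul]

/-- The symbols of the matrices `T_n` are covariantly constant: so are the metric and the
curvature, out of which they are built. -/
theorem nab_symb_tcoef (hK : K.LocallySymmetric) (l : Fin 2) (m n : ℕ) :
    K.nab l (symb n (tcoef K.G K.Rc m n)) = 0 := by
  induction m generalizing n with
  | zero =>
    rcases n with _ | n
    · rw [symb_zero_eq, nab_C]; simp [tcoef]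
    · simp [tcoef, symb_zero]
  | succ m ih =>
    rcases n with _ | n
    · simp [tcoef, symb_zero]
    · have h : (n + 1 : ℂ) ≠ 0 := Nat.cast_add_one_ne_zero n
      rw [tcoef, symb_smul, symb_sub, symb_metric, curvSymbol_symb, Derivation.map_smul, map_sub,
        Derivation.leibniz, nab_metricSymbol, ih, nab_curvSymbol hK, ih, curvSymbol_zero]
      simp

variable (K) in
/-- The symbol of the coefficient of `ħ^m` of the star product. -/
def tau (m : ℕ) : MvPolynomial Idx A :=
  ∑ n ∈ Finset.range (m + 1), symb n (tcoef K.G K.Rc m n)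

theorem nab_tau (hK : K.LocallySymmetric) (l : Fin 2) (m : ℕ) : K.nab l (K.tau m) = 0 := by
  rw [tau, map_sum]
  exact Finset.sum_eq_zero fun n _ => nab_symb_tcoef hK l m n

theorem tau_zero : K.tau 0 = 1 := by
  simp [tau, symb_zero_eq, tcoef]

/-- The recursion for the coefficients, on the level of symbols. -/
theorem eulerSymbol_tau_succ (m : ℕ) :
    eulerSymbol (K.tau (m + 1)) = K.metricSymbol * K.tau m - K.curvSymbol (K.tau m) := by
  have h0 : K.curvSymbol (symb 0 (tcoef K.G K.Rc m 0)) = 0 := by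
    rw [symb_zero_eq]; simp [curvSymbol, curvSymbolAux]
  have h1 : K.curvSymbol (K.tau m)
      = ∑ n ∈ Finset.range (m + 1), K.curvSymbol (symb (n + 1) (tcoef K.G K.Rc m (n + 1))) := by
    rw [tau, Finset.sum_range_succ', Finset.sum_range_succ, curvSymbol_add, h0, add_zero,
      tcoef_eq_zero K.G K.Rc (Nat.lt_succ_self m), symb_zero, curvSymbol_zero, add_zero,
      curvSymbol_sum]
  rw [h1, tau, eulerSymbol_sum, Finset.sum_range_succ', tau, Finset.mul_sum,
    ← Finset.sum_sub_distrib]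
  simp only [eulerSymbol_symb, natCast_mul_symb_tcoef_succ]
  simp

theorem ev_zero (f : A) (p : MvPolynomial Idx A) : K.ev f 0 p = 0 := map_zero (K.evLin f p)

/-- Symbols of positive degree give `0` on the constant function `1`. The Euler operator, which
multiplies them by their degree, makes a derivative of `1` appear. -/
theorem ev_one_symb_succ (f : A) (n : ℕ) (M : Matrix (Fin (n + 2)) (Fin (n + 2)) A) :
    K.ev f 1 (symb (n + 1) M) = 0 := by
  have h : K.ev f 1 (eulerSymbol (symb (n + 1) M)) = 0 := by
    simp [eulerSymbol, mul_comm (MvPolynomial.X _), ev_mul_X_inr, ev_zero]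
  rw [eulerSymbol_symb, ← map_natCast C, ev_C_mul] at h
  have h2 : (algebraMap ℂ A ((n + 1 : ℕ) : ℂ)⁻¹) * ((n + 1 : ℕ) : A) = 1 := by
    rw [← map_natCast (algebraMap ℂ A), ← map_mul, inv_mul_cancel₀ (Nat.cast_ne_zero.mpr n.succ_ne_zero), map_one]
  calc _ = (algebraMap ℂ A ((n + 1 : ℕ) : ℂ)⁻¹) * (((n + 1 : ℕ) : A)
        * K.ev f 1 (symb (n + 1) M)) := by rw [← mul_assoc, h2, one_mul]
    _ = 0 := by rw [h, mul_zero]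

theorem ev_finite_order (ε : A →ₐ[ℂ] ℂ) (p : MvPolynomial Idx A) :
    ∃ N, ∀ f, ∀ h ∈ K.vanish ε N, ε (K.ev f h p) = 0 := by
  induction p using MvPolynomial.induction_on with
  | C c => exact ⟨1, fun f h hh => by rw [ev_C, map_mul, map_mul, hh.1, mul_zero, mul_zero]⟩
  | add p q hp hq =>
    obtain ⟨N, hN⟩ := hp
    obtain ⟨N', hN'⟩ := hq
    exact ⟨max N N', fun f h hh => by
      rw [map_add, map_add, hN f h (vanish_anti (le_max_left _ _) hh),
        hN' f h (vanish_anti (le_max_right _ _) hh), add_zero]⟩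
  | mul_X p i hp =>
    obtain ⟨N, hN⟩ := hp
    rcases i with i | i
    · exact ⟨N, fun f h hh => by rw [ev_mul_X_inl]; exact hN _ h hh⟩
    · exact ⟨N + 1, fun f h hh => by rw [ev_mul_X_inr]; exact hN _ _ (D_mem_vanish hh i)⟩

/-- The operators with symbols `τ_m` satisfy the conditions that determine left multiplication. -/
theorem isLeftMul_evLin_tau (hK : K.LocallySymmetric) (P : Set (A →ₐ[ℂ] ℂ)) (f : A) :
    K.IsLeftMul P f fun m => K.evLin f (K.tau m) := by
  have hE : ∀ p h, ∑ l, (K.ev f (K.a l * K.D l h) p - K.a l * K.ev f (K.D l h) p)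
      = K.ev f h (eulerSymbol p) := by
    intro p h
    rw [eulerSymbol, map_sum]
    refine Finset.sum_congr rfl fun l _ => ?_
    rw [ev_a_mul, add_sub_cancel_left, mul_comm (MvPolynomial.X _), ev_mul_X_inr]
  constructor
  · rw [evLin_apply, tau_zero, ← C_1, ev_C]; simp
  · intro m
    rw [evLin_apply, tau, Finset.sum_range_succ', map_add, map_sum]
    rw [Finset.sum_eq_zero fun n _ => ev_one_symb_succ f n _]
    simp [tcoef, symb_zero]
  · intro m k h
    simp only [evLin_apply, ev_zb_mul]
  · intro m ε _
    obtain ⟨N, hN⟩ := ev_finite_order (K := K) ε (K.tau m)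
    exact ⟨N, hN f⟩
  · intro h
    simp only [evLin_apply, hE]
    rw [tau_zero, ← C_1]
    simp [eulerSymbol]
  · intro m h
    simp only [evLin_apply, hE]
    have h1 : ∀ l, K.d (Sum.inr l) (K.ev f (K.D l h) (K.tau m))
        - K.ev f (K.d (Sum.inr l) (K.D l h)) (K.tau m)
        = K.ev f h ((∑ k, C (K.G k l) * X (Sum.inl k) * K.tau m) * X (Sum.inr l))
          - (1 / 2 : ℂ) • K.ev f h (K.curvSymbolAux l (K.tau m) * X (Sum.inr l)) := by
      intro l
      rw [d_inr_ev hK, nab_tau hK, ev_mul_X_inr, ev_mul_X_inr, map_zero]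
      ring
    have h2 : ∀ (c : ℂ) p, K.ev f h (c • p) = c • K.ev f h p := fun c p => by
      rw [← algebraMap_smul A c p, map_smul, algebraMap_smul]
    simp only [h1]
    rw [eulerSymbol_tau_succ]
    generalize K.tau m = p
    have e1 : K.metricSymbol * p
        = ∑ l, (∑ k, C (K.G k l) * X (Sum.inl k) * p) * X (Sum.inr l) := by
      simp only [metricSymbol, Fin.sum_univ_two]; ring
    have e2 : K.curvSymbol p = (1 / 2 : ℂ) • ∑ l, K.curvSymbolAux l p * X (Sum.inr l) := by
      simp only [curvSymbol, mul_comm (MvPolynomial.X _)]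
    rw [map_sub, e1, e2, h2, Finset.sum_sub_distrib, ← Finset.smul_sum, map_sum, map_sum]

/-- The left multiplication operators are uniquely determined, and given by the symbols `τ_m`. -/
theorem IsLeftMul.eq_ev_tau (hK : K.LocallySymmetric) {P : Set (A →ₐ[ℂ] ℂ)}
    (hP : ∀ a b : A, (∀ ε ∈ P, ε a = ε b) → a = b) {f : A} {L : ℕ → A →ₗ[ℂ] A}
    (hL : K.IsLeftMul P f L) (m : ℕ) (h : A) :
    L m h = K.ev f h (K.tau m) := by
  rw [hL.unique hP (isLeftMul_evLin_tau hK P f) m, evLin_apply]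

/-- The evaluation of the symbol of a matrix. -/
theorem ev_symb (f h : A) (n : ℕ) (M : Matrix (Fin (n + 1)) (Fin (n + 1)) A) :
    K.ev f h (symb n M) = ∑ i, ∑ j, M i j *
      ((K.E 0)^[n - (i : ℕ)] ((K.E 1)^[(i : ℕ)] f)
        * (K.D 0)^[n - (j : ℕ)] ((K.D 1)^[(j : ℕ)] h)) := by
  rw [symb, map_sum]
  refine Finset.sum_congr rfl fun i _ => ?_
  rw [map_sum]
  refine Finset.sum_congr rfl fun j _ => ?_
  have e : (monos Sum.inl n i * monos Sum.inr n j : MvPolynomial Idx A)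
      = monomial (Finsupp.single (Sum.inl 0) (n - (i : ℕ)) + Finsupp.single (Sum.inl 1) (i : ℕ)
        + (Finsupp.single (Sum.inr 0) (n - (j : ℕ)) + Finsupp.single (Sum.inr 1) (j : ℕ))) 1 := by
    simp only [monos, X_pow_eq_monomial, monomial_mul, mul_one]
  rw [ev_C_mul, e, ev_monomial]
  simp

end KaehlerAlgebra

/-! ### The explicit formula for the matrices -/

namespace StarCoeff

open PowerSeries in
theorem X_mul_XInv (R : Fin 2 → Fin 2 → Fin 2 → Fin 2 → ℂ) {k : ℕ} (hk : 1 ≤ k) :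
    X R k * XInv R k = 1 ∧ XInv R k * X R k = 1 := by
  have hk' : (k : ℂ) ≠ 0 := Nat.cast_ne_zero.mpr (by omega)
  have hcast : (k : PowerSeries ℂ) = C (k : ℂ) := (map_natCast (C (R := ℂ)) k).symm
  constructor
  · ext i j p
    rw [X, hcast, Matrix.add_mul, smul_mul_assoc, one_mul, smul_mul_assoc, Matrix.add_apply,
      Matrix.smul_apply, Matrix.smul_apply, smul_eq_mul, smul_eq_mul, map_add, coeff_C_mul,
      Matrix.mul_apply]
    rcases p with _ | p
    · simp only [XInv, Matrix.of_apply, coeff_mk, coeff_zero_X_mul]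
      simp [Matrix.one_apply, apply_ite (coeff (R := ℂ) 0), hk']
    · rw [coeff_succ_X_mul, map_sum]
      simp only [XInv, Matrix.of_apply, coeff_mk, Matrix.map_apply, coeff_C_mul]
      have e : ∀ x, H R k i x * ((-1) ^ p / (k : ℂ) ^ (p + 1) * (H R k ^ p) x j)
          = (-1) ^ p / (k : ℂ) ^ (p + 1) * (H R k i x * (H R k ^ p) x j) := fun x => by ring
      simp only [e, ← Finset.mul_sum, ← Matrix.mul_apply, ← pow_succ' (H R k)]
      have : coeff (p + 1) ((1 : Matrix (Fin (k + 1)) (Fin (k + 1)) (PowerSeries ℂ)) i j) = 0 := by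
        rw [Matrix.one_apply]; split_ifs <;> simp [coeff_one]
      rw [this]
      field_simp
      ring
  · ext i j p
    rw [X, hcast, Matrix.mul_add, mul_smul_comm, mul_one, mul_smul_comm, Matrix.add_apply,
      Matrix.smul_apply, Matrix.smul_apply, smul_eq_mul, smul_eq_mul, map_add, coeff_C_mul,
      Matrix.mul_apply]
    rcases p with _ | p
    · simp only [XInv, Matrix.of_apply, coeff_mk, coeff_zero_X_mul]
      simp [Matrix.one_apply, apply_ite (coeff (R := ℂ) 0), hk']
    · rw [coeff_succ_X_mul, map_sum]
      simp only [XInv, Matrix.of_apply, coeff_mk, Matrix.map_apply, coeff_mul_C]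
      simp only [mul_assoc, ← Finset.mul_sum, ← Matrix.mul_apply, ← pow_succ (H R k)]
      have : coeff (p + 1) ((1 : Matrix (Fin (k + 1)) (Fin (k + 1)) (PowerSeries ℂ)) i j) = 0 := by
        rw [Matrix.one_apply]; split_ifs <;> simp [coeff_one]
      rw [this]
      field_simp
      ring

/-- The matrix `T_n` for the values `G` of the metric and `R` of the curvature at a point. -/
def TMat (G : Matrix (Fin 2) (Fin 2) ℂ) (R : Fin 2 → Fin 2 → Fin 2 → Fin 2 → ℂ) (n : ℕ) :
    Matrix (Fin (n + 1)) (Fin (n + 1)) (PowerSeries ℂ) :=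
  Matrix.of fun i j => PowerSeries.mk fun m => tcoef G R m n i j

/-- A sum over `Fin n → α`, with the last value split off. -/
theorem sum_pi_fin_succ {α β : Type*} [Fintype α] [AddCommMonoid β] (n : ℕ)
    (F : (Fin (n + 1) → α) → β) :
    ∑ p, F p = ∑ q : α, ∑ p : Fin n → α, F (Fin.snoc p q) := by
  rw [← Fintype.sum_prod_type', ← (Fin.snocEquiv fun _ => α).sum_comp]
  rfl

open PowerSeries in
/-- `T_{n+1} X_{n+1} = ħ ∑ g_{k l̄} inc_k T_n inc_lᵀ`. -/
theorem TMat_succ_mul_X (G : Matrix (Fin 2) (Fin 2) ℂ) (R : Fin 2 → Fin 2 → Fin 2 → Fin 2 → ℂ)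
    (n : ℕ) : TMat G R (n + 1) * X R (n + 1) = (PowerSeries.X : PowerSeries ℂ) •
      ∑ k, ∑ l, C (G k l) •
        (inc (PowerSeries ℂ) n k * TMat G R n * (inc (PowerSeries ℂ) n l).transpose) := by
  have hcast : ((n + 1 : ℕ) : PowerSeries ℂ) = C ((n + 1 : ℕ) : ℂ) :=
    (map_natCast (C (R := ℂ)) (n + 1)).symm
  have hn : (n + 1 : ℂ) ≠ 0 := Nat.cast_add_one_ne_zero n
  have hinc : ∀ k i j, inc (PowerSeries ℂ) n k i j = C (inc ℂ n k i j) := fun k i j => by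
    simp only [inc, Matrix.of_apply]; split_ifs <;> simp
  have hcoeff : ∀ m i j k l, coeff m ((inc (PowerSeries ℂ) n k * TMat G R n *
      (inc (PowerSeries ℂ) n l).transpose) i j)
      = (inc ℂ n k * tcoef G R m n * (inc ℂ n l).transpose) i j := by
    intro m i j k l
    simp only [Matrix.mul_apply, Matrix.transpose_apply, hinc, map_sum, coeff_mul_C, coeff_C_mul,
      TMat, Matrix.of_apply, coeff_mk]
  ext i j m
  rw [X, hcast, Matrix.mul_add, mul_smul_comm, mul_one, mul_smul_comm, Matrix.add_apply,
    Matrix.smul_apply, Matrix.smul_apply, smul_eq_mul, smul_eq_mul, map_add, coeff_C_mul,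
    Matrix.mul_apply, Matrix.smul_apply, smul_eq_mul]
  rcases m with _ | m
  · simp [TMat, tcoef]
  · rw [coeff_succ_X_mul, coeff_succ_X_mul, map_sum]
    have hT : ∀ m n i j, coeff m (TMat G R n i j) = tcoef G R m n i j := fun m n i j => by
      rw [TMat, Matrix.of_apply, coeff_mk]
    simp only [hT, Matrix.map_apply, coeff_mul_C]
    rw [← HMat_eq_H, ← Matrix.mul_apply, tcoef]
    simp only [Fin.sum_univ_two, Matrix.add_apply, Matrix.smul_apply, Matrix.sub_apply, smul_eq_mul,
      map_add, coeff_C_mul, hcoeff]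
    push_cast
    field_simp
    ring

theorem TMat_succ (G : Matrix (Fin 2) (Fin 2) ℂ) (R : Fin 2 → Fin 2 → Fin 2 → Fin 2 → ℂ)
    (n : ℕ) : TMat G R (n + 1) = (PowerSeries.X : PowerSeries ℂ) •
      ((∑ k, ∑ l, PowerSeries.C (G k l) •
        (inc (PowerSeries ℂ) n k * TMat G R n * (inc (PowerSeries ℂ) n l).transpose))
          * XInv R (n + 1)) := by
  rw [← smul_mul_assoc, ← TMat_succ_mul_X, mul_assoc,
    (X_mul_XInv R (Nat.succ_pos n)).1, mul_one]

/-- Extension of a vector by zero. -/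
def extVec {m : ℕ} (v : Fin m → PowerSeries ℂ) (i : ℕ) : PowerSeries ℂ :=
  if h : i < m then v ⟨i, h⟩ else 0

/-- The first column of the product `F^{p_n} ⋯ F^{p_1}`. -/
def lvec (θ : Fin 4 → Fin 2 → ℂ) : (n : ℕ) → (Fin n → Fin 4) → Fin (n + 1) → PowerSeries ℂ
  | 0, _ => 1
  | n + 1, p => ∑ k, PowerSeries.C (θ (p (Fin.last n)) k) •
      (inc (PowerSeries ℂ) n k).mulVec (lvec θ n fun k => p k.castSucc)

/-- The first row of the product `(B^{p_1} X_1⁻¹) ⋯ (B^{p_n} X_n⁻¹)`. -/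
def rvec (R : Fin 2 → Fin 2 → Fin 2 → Fin 2 → ℂ) (θ' : Fin 4 → Fin 2 → ℂ) :
    (n : ℕ) → (Fin n → Fin 4) → Fin (n + 1) → PowerSeries ℂ
  | 0, _ => 1
  | n + 1, p => Matrix.vecMul (∑ l, PowerSeries.C (θ' (p (Fin.last n)) l) •
      (inc (PowerSeries ℂ) n l).mulVec (rvec R θ' n fun k => p k.castSucc)) (XInv R (n + 1))

theorem inc_mulVec (n : ℕ) (k : Fin 2) (v : Fin (n + 1) → PowerSeries ℂ) (i : Fin (n + 2)) :
    (inc (PowerSeries ℂ) n k).mulVec v i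
      = if (k : ℕ) ≤ i then extVec v ((i : ℕ) - k) else 0 := by
  have hi := i.2
  simp only [Matrix.mulVec, dotProduct, inc, Matrix.of_apply, ite_mul, one_mul, zero_mul]
  split_ifs with h
  · rw [extVec]
    split_ifs with h'
    · rw [Finset.sum_eq_single ⟨(i : ℕ) - k, h'⟩]
      · rw [if_pos]; show (i : ℕ) = i - k + k; omega
      · intro b _ hb
        refine if_neg fun h2 => hb (Fin.ext ?_)
        show (b : ℕ) = i - k; omega
      · simp
    · refine Finset.sum_eq_zero fun b _ => if_neg fun h2 => h' ?_
      have := b.2; omega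
  · exact Finset.sum_eq_zero fun b _ => if_neg fun h2 => h (by omega)

theorem extVec_sum_inc (n : ℕ) (c : Fin 2 → ℂ) (v : Fin (n + 1) → PowerSeries ℂ) (i : ℕ) :
    extVec (∑ k, PowerSeries.C (c k) • (inc (PowerSeries ℂ) n k).mulVec v) i
      = PowerSeries.C (c 0) * extVec v i
        + PowerSeries.C (c 1) * (if 1 ≤ i then extVec v (i - 1) else 0) := by
  by_cases h : i < n + 2
  · rw [extVec, dif_pos h]
    simp [Fin.sum_univ_two, inc_mulVec]
  · rw [extVec, dif_neg h, extVec, dif_neg (by omega), if_pos (by omega), extVec,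
      dif_neg (by omega)]
    simp

theorem sum_inc_mulVec_mul (n : ℕ) (l : Fin 2) (v : Fin (n + 1) → PowerSeries ℂ)
    (y : Fin (n + 2) → PowerSeries ℂ) :
    ∑ x, (inc (PowerSeries ℂ) n l).mulVec v x * y x = ∑ k, v k * extVec y ((k : ℕ) + l) := by
  simp only [Matrix.mulVec, dotProduct, Finset.sum_mul, inc, Matrix.of_apply, ite_mul, one_mul,
    zero_mul]
  rw [Finset.sum_comm]
  refine Finset.sum_congr rfl fun k _ => ?_
  have hk : (k : ℕ) + l < n + 2 := by omega
  rw [Finset.sum_eq_single ⟨(k : ℕ) + l, hk⟩]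
  · rw [if_pos rfl, extVec, dif_pos hk]
  · exact fun x _ hx => if_neg fun h => hx (Fin.ext h)
  · simp

theorem mulInf_Fmat (θ : Fin 2 → ℂ) (A : InfMat) (i j : ℕ) :
    mulInf (Fmat θ) A i j = PowerSeries.C (θ 0) * A i j
      + PowerSeries.C (θ 1) * (if 1 ≤ i then A (i - 1) j else 0) := by
  rw [mulInf, Matrix.of_apply, finsum_eq_sum_of_support_subset (s := Finset.range (i + 1))]
  · rcases i with _ | i
    · simp [Fmat, shiftDown]
    · rw [Finset.sum_range_succ, Finset.sum_range_succ, Finset.sum_eq_zero]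
      · simp [Fmat, shiftDown]; ring
      · intro k hk
        have hk := Finset.mem_range.mp hk
        simp [Fmat, shiftDown, show i + 1 ≠ k by omega, show i ≠ k by omega]
  · intro k hk
    by_contra h
    have h' : ¬ k < i + 1 := by simpa using h
    apply hk
    simp [Fmat, shiftDown, show i ≠ k by omega, show i ≠ k + 1 by omega]

theorem mulInf_Bmat (θ : Fin 2 → ℂ) (A : InfMat) (i j : ℕ) :
    mulInf (Bmat θ) A i j = PowerSeries.C (θ 0) * A i j + PowerSeries.C (θ 1) * A (i + 1) j := by
  rw [mulInf, Matrix.of_apply, finsum_eq_sum_of_support_subset (s := {i, i + 1})]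
  · rw [Finset.sum_pair (by omega)]
    simp [Bmat, shiftRight, shiftDown]
  · intro k hk
    by_contra h
    apply hk
    simp only [Finset.coe_insert, Finset.coe_singleton, Set.mem_insert_iff, Set.mem_singleton_iff,
      not_or] at h
    simp [Bmat, shiftRight, shiftDown, h.2, show i ≠ k from fun h' => h.1 h'.symm]

theorem leftProd_col (θ : Fin 4 → Fin 2 → ℂ) (n : ℕ) (p : Fin n → Fin 4) (i : ℕ) :
    leftProd θ n p i 0 = extVec (lvec θ n p) i := by
  induction n generalizing i with
  | zero =>
    rcases i with _ | i <;> simp [leftProd, lvec, extVec]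
  | succ n ih =>
    rw [leftProd, mulInf_Fmat, lvec, extVec_sum_inc, ih, ih]

theorem rightProd_row (R : Fin 2 → Fin 2 → Fin 2 → Fin 2 → ℂ) (θ' : Fin 4 → Fin 2 → ℂ) (n : ℕ)
    (p : Fin n → Fin 4) (j : ℕ) :
    rightProd R θ' n p 0 j = extVec (rvec R θ' n p) j := by
  induction n generalizing j with
  | zero => rcases j with _ | j <;> simp [rightProd, rvec, extVec]
  | succ n ih =>
    rw [rightProd, mulInf, Matrix.of_apply,
      finsum_eq_sum_of_support_subset (s := Finset.range (n + 1))]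
    · simp only [mulInf_Bmat, ih]
      by_cases h : j < n + 2
      · rw [Finset.sum_range, extVec, dif_pos h, rvec]
        have hY : ∀ k, embed (XInv R (n + 1)) k j = extVec (fun x => XInv R (n + 1) x ⟨j, h⟩) k := by
          intro k
          by_cases hk : k < n + 2
          · rw [embed, Matrix.of_apply, dif_pos ⟨hk, h⟩, extVec, dif_pos hk]
          · rw [embed, Matrix.of_apply, dif_neg (fun h => hk h.1), extVec, dif_neg hk]
        have hr : ∀ k : Fin (n + 1), extVec (rvec R θ' n fun k => p k.castSucc) k
            = rvec R θ' n (fun k => p k.castSucc) k := fun k => by rw [extVec, dif_pos k.2]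
        simp only [Matrix.vecMul, dotProduct, Fin.sum_univ_two, Pi.add_apply, Pi.smul_apply,
          smul_eq_mul, add_mul, Finset.sum_add_distrib, mul_assoc, ← Finset.mul_sum,
          sum_inc_mulVec_mul, hY, hr]
        simp only [Finset.mul_sum, ← Finset.sum_add_distrib]
        refine Finset.sum_congr rfl fun k _ => ?_
        simp only [Fin.val_zero, Fin.val_one, add_zero]
        ring
      · rw [extVec, dif_neg h]
        refine Finset.sum_eq_zero fun k _ => ?_
        simp [embed, show ¬ j ≤ n + 1 by omega]
    · intro k hk
      by_contra h
      apply hk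
      have h' : rightProd R θ' n (fun k => p k.castSucc) 0 k = 0 := by
        rw [ih, extVec, dif_neg (by simpa using h)]
      simp only [h', zero_mul]

/-- A factorization of the metric turns each term of the recursion into a product of an operation on
the rows and an operation on the columns; so it is solved by sums of rank one matrices. -/
theorem TMat_eq_sum_vecMulVec {G : Matrix (Fin 2) (Fin 2) ℂ}
    (R : Fin 2 → Fin 2 → Fin 2 → Fin 2 → ℂ) {θ θ' : Fin 4 → Fin 2 → ℂ}
    (hG : ∀ k l, G k l = ∑ p, θ' p l * θ p k) (n : ℕ) :
    TMat G R n = (PowerSeries.X : PowerSeries ℂ) ^ n •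
      ∑ p, Matrix.vecMulVec (lvec θ n p) (rvec R θ' n p) := by
  induction n with
  | zero =>
    ext i j m
    rcases m with _ | m <;>
      simp [TMat, tcoef, lvec, rvec, Matrix.vecMulVec, Fin.fin_one_eq_zero, PowerSeries.coeff_one]
  | succ n ih =>
    rw [TMat_succ, ih, sum_pi_fin_succ]
    have e : ∀ (q : Fin 4) (p : Fin n → Fin 4),
        Matrix.vecMulVec (lvec θ (n + 1) (Fin.snoc p q)) (rvec R θ' (n + 1) (Fin.snoc p q))
        = (∑ k, ∑ l, PowerSeries.C (θ' q l * θ q k) • (inc (PowerSeries ℂ) n k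
          * Matrix.vecMulVec (lvec θ n p) (rvec R θ' n p) * (inc (PowerSeries ℂ) n l).transpose))
          * XInv R (n + 1) := by
      intro q p
      rw [lvec, rvec]
      simp only [Fin.snoc_last, Fin.snoc_castSucc, Matrix.mul_vecMulVec, Matrix.vecMulVec_mul,
        Matrix.vecMul_transpose, Fin.sum_univ_two, Matrix.vecMulVec_add, Matrix.add_vecMulVec,
        Matrix.smul_vecMulVec, Matrix.vecMulVec_smul, map_mul, Matrix.add_mul, smul_mul_assoc,
        Matrix.add_vecMul, Matrix.smul_vecMul, smul_smul, mul_comm (PowerSeries.C (θ' _ _)),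
        smul_add]
      abel
    have e2 : ∀ k l, PowerSeries.C (G k l) • (inc (PowerSeries ℂ) n k
        * ((PowerSeries.X : PowerSeries ℂ) ^ n • ∑ p, Matrix.vecMulVec (lvec θ n p) (rvec R θ' n p))
          * (inc (PowerSeries ℂ) n l).transpose)
        = (PowerSeries.X : PowerSeries ℂ) ^ n • ∑ q, ∑ p, PowerSeries.C (θ' q l * θ q k) •
          (inc (PowerSeries ℂ) n k * Matrix.vecMulVec (lvec θ n p) (rvec R θ' n p)
            * (inc (PowerSeries ℂ) n l).transpose) := by
      intro k l
      rw [Matrix.mul_smul, Matrix.smul_mul, smul_comm, Matrix.mul_sum, Matrix.sum_mul, hG, map_sum,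
        Finset.sum_smul]
      simp only [Finset.smul_sum]
    simp only [e, e2, ← Matrix.sum_mul, ← Finset.smul_sum]
    rw [smul_mul_assoc, smul_smul, ← pow_succ']
    congr 2
    simp only [Fin.sum_univ_two, Finset.sum_add_distrib, Matrix.sum_mul, Finset.smul_sum]

/-- The explicit formula for `T_n`: multiplication by `T_0(∞)` leaves only the first column of the
left and the first row of the right product. -/
theorem embed_TMat {G : Matrix (Fin 2) (Fin 2) ℂ}
    (R : Fin 2 → Fin 2 → Fin 2 → Fin 2 → ℂ) {θ θ' : Fin 4 → Fin 2 → ℂ}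
    (hG : ∀ k l, G k l = ∑ p, θ' p l * θ p k) (n : ℕ) :
    embed (TMat G R n) = formulaT R θ θ' n := by
  have hT0 : ∀ p i j, mulInf (leftProd θ n p) T0 i j = if j = 0 then extVec (lvec θ n p) i else 0 := by
    intro p i j
    rw [mulInf, Matrix.of_apply, finsum_eq_single _ 0]
    · rw [leftProd_col]
      rcases j with _ | j <;> simp [T0, embed]
    · intro k hk
      simp [T0, embed, hk]
  have hp : ∀ p i j, mulInf (mulInf (leftProd θ n p) T0) (rightProd R θ' n p) i j
      = extVec (lvec θ n p) i * extVec (rvec R θ' n p) j := by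
    intro p i j
    rw [mulInf, Matrix.of_apply, finsum_eq_single _ 0]
    · rw [hT0, if_pos rfl, rightProd_row]
    · intro k hk
      rw [hT0, if_neg hk, zero_mul]
  ext1 i j
  rw [formulaT, Matrix.smul_apply, Matrix.sum_apply, TMat_eq_sum_vecMulVec R hG, embed,
    Matrix.of_apply]
  simp only [hp, extVec]
  by_cases hi : i < n + 1
  · by_cases hj : j < n + 1
    · rw [dif_pos ⟨hi, hj⟩, Matrix.smul_apply, Matrix.sum_apply]
      simp only [dif_pos hi, dif_pos hj, Matrix.vecMulVec_apply]
    · rw [dif_neg fun h => hj h.2]; simp [hj]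
  · rw [dif_neg fun h => hi h.1]; simp [hi]

end StarCoeff

end

noncomputable section

/-! ### The algebra of smooth functions on an open set -/

namespace KaehlerLocal

/-- The real directions that enter the Wirtinger derivatives. -/
def dirRe : Idx → C2
  | Sum.inl k => Pi.single k 1
  | Sum.inr k => Pi.single k 1

/-- The imaginary directions that enter the Wirtinger derivatives. -/
def dirIm : Idx → C2
  | Sum.inl k => Pi.single k Complex.I
  | Sum.inr k => Pi.single k Complex.I

/-- The coefficient of the imaginary direction in the Wirtinger derivatives. -/
def sgnI : Idx → ℂ
  | Sum.inl _ => -Complex.I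
  | Sum.inr _ => Complex.I

theorem pd_eq (A : Idx) (F : C2 → ℂ) (z : C2) :
    pd A F z = (fderiv ℝ F z (dirRe A) + sgnI A * fderiv ℝ F z (dirIm A)) / 2 := by
  rcases A with k | k
  · simp only [pd, dirRe, dirIm, sgnI]; ring
  · simp only [pd, dirRe, dirIm, sgnI]

variable {W : Set C2} {F F' : C2 → ℂ}

theorem pd_congr (hW : IsOpen W) (h : Set.EqOn F F' W) (A : Idx) : Set.EqOn (pd A F) (pd A F') W := by
  intro z hz
  have : F =ᶠ[nhds z] F' := Filter.eventuallyEq_of_mem (hW.mem_nhds hz) h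
  rw [pd_eq, pd_eq, this.fderiv_eq]

theorem contDiffOn_pd (hW : IsOpen W) (hF : ContDiffOn ℝ ∞ F W) (A : Idx) :
    ContDiffOn ℝ ∞ (pd A F) W := by
  have h := hF.fderiv_of_isOpen (m := ∞) hW (by simp)
  have h1 : ∀ v, ContDiffOn ℝ ∞ (fun z => fderiv ℝ F z v) W := fun v =>
    h.clm_apply contDiffOn_const
  have h2 : pd A F = fun z => (fderiv ℝ F z (dirRe A) + sgnI A * fderiv ℝ F z (dirIm A)) / 2 :=
    funext (pd_eq A F)
  rw [h2]
  exact ((h1 _).add (contDiffOn_const.mul (h1 _))).div_const 2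

theorem pd_add {z : C2} (hF : DifferentiableAt ℝ F z) (hF' : DifferentiableAt ℝ F' z) (A : Idx) :
    pd A (F + F') z = pd A F z + pd A F' z := by
  simp only [pd_eq, fderiv_add hF hF', add_apply]
  ring

theorem pd_smul {z : C2} (hF : DifferentiableAt ℝ F z) (c : ℂ) (A : Idx) :
    pd A (c • F) z = c * pd A F z := by
  simp only [pd_eq, fderiv_const_smul hF, smul_apply, smul_eq_mul]
  ring

theorem pd_mul {z : C2} (hF : DifferentiableAt ℝ F z) (hF' : DifferentiableAt ℝ F' z) (A : Idx) :
    pd A (F * F') z = F z * pd A F' z + F' z * pd A F z := by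
  simp only [pd_eq, fderiv_mul hF hF', add_apply, smul_apply,
    smul_eq_mul]
  ring

theorem pd_comm {z : C2} (hF : ContDiffAt ℝ ∞ F z) (A B : Idx) :
    pd A (pd B F) z = pd B (pd A F) z := by
  have hsymm : IsSymmSndFDerivAt ℝ F z :=
    hF.isSymmSndFDerivAt (by
      rw [minSmoothness_of_isRCLikeNormedField]
      exact WithTop.coe_le_coe.mpr le_top)
  have hd : DifferentiableAt ℝ (fderiv ℝ F) z :=
    (hF.fderiv_right (m := ∞) (by simp)).differentiableAt (by simp)
  have h1 : ∀ v, DifferentiableAt ℝ (fun w => fderiv ℝ F w v) z := fun v =>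
    hd.clm_apply (differentiableAt_const v)
  have h2 : ∀ u v, fderiv ℝ (fun w => fderiv ℝ F w v) z u = fderiv ℝ (fderiv ℝ F) z u v := by
    intro u v
    rw [fderiv_clm_apply hd (differentiableAt_const v)]
    simp
  have h3 : ∀ A B, pd A (pd B F) z
      = (fderiv ℝ (fderiv ℝ F) z (dirRe A) (dirRe B)
        + sgnI B * fderiv ℝ (fderiv ℝ F) z (dirRe A) (dirIm B)
        + sgnI A * (fderiv ℝ (fderiv ℝ F) z (dirIm A) (dirRe B)
        + sgnI B * fderiv ℝ (fderiv ℝ F) z (dirIm A) (dirIm B))) / 4 := by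
    intro A B
    have h4 : pd B F = (2 : ℂ)⁻¹ • ((fun w => fderiv ℝ F w (dirRe B))
        + sgnI B • fun w => fderiv ℝ F w (dirIm B)) := by
      funext w
      rw [pd_eq]
      simp only [Pi.smul_apply, Pi.add_apply, smul_eq_mul]
      ring
    rw [h4, pd_smul ((h1 _).add ((h1 _).const_smul _)), pd_add (h1 _) ((h1 _).const_smul _),
      pd_smul (h1 _), pd_eq, pd_eq]
    simp only [h2]
    ring
  rw [h3, h3, hsymm.eq (dirRe A) (dirRe B), hsymm.eq (dirRe A) (dirIm B),
    hsymm.eq (dirIm A) (dirRe B), hsymm.eq (dirIm A) (dirIm B)]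
  ring

end KaehlerLocal

open KaehlerLocal

/-- Extension of a function on `W` by zero. -/
def extZero {W : Set C2} (f : W → ℂ) : C2 → ℂ :=
  open Classical in fun z => if h : z ∈ W then f ⟨z, h⟩ else 0

theorem extZero_of_mem {W : Set C2} (f : W → ℂ) {z : C2} (h : z ∈ W) :
    extZero f z = f ⟨z, h⟩ := dif_pos h

theorem extZero_of_notMem {W : Set C2} (f : W → ℂ) {z : C2} (h : z ∉ W) :
    extZero f z = 0 := dif_neg h

/-- The algebra of smooth complex valued functions on `W`. Smoothness is expressed through the
extension by zero, because derivatives are taken of functions on `ℂ²`. -/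
def smoothAlg (W : Set C2) : Subalgebra ℂ (W → ℂ) where
  carrier := {f | ContDiffOn ℝ ∞ (extZero f) W}
  mul_mem' {f h} hf hh := (ContDiffOn.mul hf hh).congr fun z hz => by
    simp [extZero_of_mem _ hz]
  add_mem' {f h} hf hh := (ContDiffOn.add hf hh).congr fun z hz => by
    simp [extZero_of_mem _ hz]
  algebraMap_mem' c := (contDiffOn_const (c := c)).congr fun z hz => by
    simp [extZero_of_mem _ hz]

namespace smoothAlg

variable {W : Set C2}

/-- The function on `ℂ²` given by an element of the algebra, extended by zero. -/
def toFun (a : smoothAlg W) : C2 → ℂ := extZero a.1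

theorem contDiffOn (a : smoothAlg W) : ContDiffOn ℝ ∞ (toFun a) W := a.2

/-- The restriction to `W` of a function that is smooth there. -/
def ofFun (F : C2 → ℂ) (hF : ContDiffOn ℝ ∞ F W) : smoothAlg W :=
  ⟨fun z => F z, hF.congr fun z hz => by rw [extZero_of_mem _ hz]⟩

theorem toFun_ofFun (F : C2 → ℂ) (hF : ContDiffOn ℝ ∞ F W) : Set.EqOn (toFun (ofFun F hF)) F W :=
  fun _ hz => extZero_of_mem _ hz

theorem ext_toFun {a b : smoothAlg W} (h : Set.EqOn (toFun a) (toFun b) W) : a = b := by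
  apply Subtype.ext
  funext z
  have := h z.2
  rwa [toFun, toFun, extZero_of_mem _ z.2, extZero_of_mem _ z.2] at this

/-- Evaluation at a point of `W`. -/
def eval (z : W) : smoothAlg W →ₐ[ℂ] ℂ := (Pi.evalAlgHom ℂ (fun _ => ℂ) z).comp (smoothAlg W).val

theorem eval_apply (z : W) (a : smoothAlg W) : eval z a = toFun a z :=
  (extZero_of_mem a.1 z.2).symm

theorem toFun_add (a b : smoothAlg W) : toFun (a + b) = toFun a + toFun b := by
  funext z
  by_cases h : z ∈ W
  · simp [toFun, extZero_of_mem _ h]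
  · simp [toFun, extZero_of_notMem _ h]

theorem toFun_mul (a b : smoothAlg W) : toFun (a * b) = toFun a * toFun b := by
  funext z
  by_cases h : z ∈ W
  · simp [toFun, extZero_of_mem _ h]
  · simp [toFun, extZero_of_notMem _ h]

theorem toFun_smul (c : ℂ) (a : smoothAlg W) : toFun (c • a) = c • toFun a := by
  funext z
  by_cases h : z ∈ W
  · simp [toFun, extZero_of_mem _ h]
  · simp [toFun, extZero_of_notMem _ h]

theorem toFun_zero : toFun (0 : smoothAlg W) = 0 := by
  funext z
  by_cases h : z ∈ W
  · simp [toFun, extZero_of_mem _ h]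
  · simp [toFun, extZero_of_notMem _ h]

theorem toFun_one {z : C2} (h : z ∈ W) : toFun (1 : smoothAlg W) z = 1 := by
  simp [toFun, extZero_of_mem _ h]

theorem toFun_neg (a : smoothAlg W) : toFun (-a) = -toFun a := by
  rw [← neg_one_smul ℂ, toFun_smul, neg_one_smul]

theorem toFun_sub (a b : smoothAlg W) : toFun (a - b) = toFun a - toFun b := by
  rw [sub_eq_add_neg, toFun_add, toFun_neg, sub_eq_add_neg]

theorem toFun_sum {ι : Type*} (s : Finset ι) (a : ι → smoothAlg W) :
    toFun (∑ i ∈ s, a i) = ∑ i ∈ s, toFun (a i) :=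
  map_sum (⟨⟨toFun, toFun_zero⟩, toFun_add⟩ : smoothAlg W →+ (C2 → ℂ)) a s

theorem contDiffAt (hW : IsOpen W) (a : smoothAlg W) {z : C2} (hz : z ∈ W) :
    ContDiffAt ℝ ∞ (toFun a) z := (contDiffOn a).contDiffAt (hW.mem_nhds hz)

theorem differentiableAt (hW : IsOpen W) (a : smoothAlg W) {z : C2} (hz : z ∈ W) :
    DifferentiableAt ℝ (toFun a) z := (contDiffAt hW a hz).differentiableAt (by simp)

/-- The Wirtinger derivatives as derivations of the algebra of smooth functions. -/
def pdDer (hW : IsOpen W) (A : Idx) : Derivation ℂ (smoothAlg W) (smoothAlg W) :=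
  Derivation.mk'
    { toFun := fun a => ofFun (pd A (toFun a)) (contDiffOn_pd hW (contDiffOn a) A)
      map_add' := fun a b => ext_toFun fun z hz => by
        rw [toFun_ofFun _ _ hz, toFun_add, toFun_add, Pi.add_apply, toFun_ofFun _ _ hz,
          toFun_ofFun _ _ hz, pd_add (differentiableAt hW a hz) (differentiableAt hW b hz)]
      map_smul' := fun c a => ext_toFun fun z hz => by
        rw [toFun_ofFun _ _ hz, toFun_smul, RingHom.id_apply, toFun_smul, Pi.smul_apply,
          toFun_ofFun _ _ hz, pd_smul (differentiableAt hW a hz), smul_eq_mul] }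
    fun a b => ext_toFun fun z hz => by
      simp only [LinearMap.coe_mk, AddHom.coe_mk, smul_eq_mul]
      rw [toFun_ofFun _ _ hz, toFun_mul, toFun_add, toFun_mul, toFun_mul, Pi.add_apply, Pi.mul_apply,
        Pi.mul_apply, toFun_ofFun _ _ hz, toFun_ofFun _ _ hz,
        pd_mul (differentiableAt hW a hz) (differentiableAt hW b hz)]

theorem toFun_pdDer (hW : IsOpen W) (A : Idx) (a : smoothAlg W) :
    Set.EqOn (toFun (pdDer hW A a)) (pd A (toFun a)) W :=
  toFun_ofFun _ (contDiffOn_pd hW (contDiffOn a) A)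

/-- If `a` represents `F` on `W`, then `∂_A a` represents `∂_A F`. -/
theorem eqOn_pd (hW : IsOpen W) {F : C2 → ℂ} {a : smoothAlg W} (h : Set.EqOn F (toFun a) W)
    (A : Idx) : Set.EqOn (pd A F) (toFun (pdDer hW A a)) W := fun z hz => by
  rw [toFun_pdDer hW A a hz, pd_congr hW h A hz]

theorem pdDer_comm (hW : IsOpen W) (A B : Idx) (a : smoothAlg W) :
    pdDer hW A (pdDer hW B a) = pdDer hW B (pdDer hW A a) := by
  refine ext_toFun fun z hz => ?_
  rw [toFun_pdDer hW _ _ hz, toFun_pdDer hW _ _ hz, pd_congr hW (toFun_pdDer hW B a) A hz,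
    pd_congr hW (toFun_pdDer hW A a) B hz, pd_comm (contDiffAt hW a hz)]

theorem eq_of_forall_eval {a b : smoothAlg W}
    (h : ∀ ε ∈ Set.range (eval (W := W)), ε a = ε b) : a = b :=
  Subtype.ext <| funext fun z => h (eval z) ⟨z, rfl⟩

end smoothAlg

/-! ### The Kähler algebra of a coordinate domain with a potential -/

namespace KaehlerLocal

theorem contDiffOn_inv {W : Set C2} {G : C2 → Matrix (Fin 2) (Fin 2) ℂ}
    (hG : ∀ k l, ContDiffOn ℝ ∞ (fun z => G z k l) W) (hdet : ∀ z ∈ W, (G z).det ≠ 0) (k l : Fin 2) :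
    ContDiffOn ℝ ∞ (fun z => (G z)⁻¹ k l) W := by
  have h1 : ContDiffOn ℝ ∞ (fun z => (G z).det) W := by
    simp only [Matrix.det_fin_two]
    exact ((hG 0 0).mul (hG 1 1)).sub ((hG 0 1).mul (hG 1 0))
  have h2 : ContDiffOn ℝ ∞ (fun z => (G z).adjugate k l) W := by
    simp only [Matrix.adjugate_fin_two]
    fin_cases k <;> fin_cases l <;> simp
    · exact hG 1 1
    · exact (hG 0 1).neg
    · exact (hG 1 0).neg
    · exact hG 0 0
  refine ((h1.inv hdet).mul h2).congr fun z hz => ?_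
  simp [Matrix.inv_def]

theorem pd_inl_conj (k l : Fin 2) (z : C2) :
    pd (Sum.inl k) (fun z => (starRingEnd ℂ) (z l)) z = 0 := by
  have h : (fun z : C2 => (starRingEnd ℂ) (z l))
      = (Complex.conjCLE : ℂ →L[ℝ] ℂ) ∘L ContinuousLinearMap.proj l := rfl
  rw [pd, h, ContinuousLinearMap.fderiv]
  by_cases hkl : l = k
  · subst hkl; simp
  · simp [hkl]

theorem pd_inr_conj (k l : Fin 2) (z : C2) :
    pd (Sum.inr k) (fun z => (starRingEnd ℂ) (z l)) z = if k = l then 1 else 0 := by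
  have h : (fun z : C2 => (starRingEnd ℂ) (z l))
      = (Complex.conjCLE : ℂ →L[ℝ] ℂ) ∘L ContinuousLinearMap.proj l := rfl
  rw [pd, h, ContinuousLinearMap.fderiv]
  by_cases hkl : l = k
  · subst hkl; simp
  · simp [hkl, Ne.symm (a := l) (b := k) hkl]

theorem contDiff_conj (l : Fin 2) : ContDiff ℝ ∞ (fun z : C2 => (starRingEnd ℂ) (z l)) :=
  Complex.conjCLE.contDiff.comp (contDiff_apply ℝ ℂ l)

open smoothAlg

variable {W : Set C2} (hW : IsOpen W) {G : C2 → Matrix (Fin 2) (Fin 2) ℂ} {Φ : C2 → ℂ}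
  (hΦ : ContDiffOn ℝ ∞ Φ W)
  (hG : ∀ z ∈ W, ∀ k l, G z k l = pd (Sum.inl k) (pd (Sum.inr l) Φ) z)
  (hdet : ∀ z ∈ W, (G z).det ≠ 0)

theorem contDiffOn_metric {W : Set C2} (hW : IsOpen W) {G : C2 → Matrix (Fin 2) (Fin 2) ℂ}
    {Φ : C2 → ℂ} (hΦ : ContDiffOn ℝ ∞ Φ W)
    (hG : ∀ z ∈ W, ∀ k l, G z k l = pd (Sum.inl k) (pd (Sum.inr l) Φ) z) (k l : Fin 2) : ContDiffOn ℝ ∞ (fun z => G z k l) W :=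
  (contDiffOn_pd hW (contDiffOn_pd hW hΦ (Sum.inr l)) (Sum.inl k)).congr fun z hz => hG z hz k l

theorem eqOn_metric {W : Set C2} (hW : IsOpen W) {G : C2 → Matrix (Fin 2) (Fin 2) ℂ}
    {Φ : C2 → ℂ} (hΦ : ContDiffOn ℝ ∞ Φ W)
    (hG : ∀ z ∈ W, ∀ k l, G z k l = pd (Sum.inl k) (pd (Sum.inr l) Φ) z) (k l : Fin 2) : Set.EqOn (fun z => G z k l)
    (toFun (pdDer hW (Sum.inl k) (pdDer hW (Sum.inr l) (ofFun Φ hΦ)))) W := fun z hz => by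
  rw [← eqOn_pd hW (eqOn_pd hW (toFun_ofFun Φ hΦ).symm (Sum.inr l)) (Sum.inl k) hz]
  exact hG z hz k l

/-- The Kähler algebra of smooth functions on a coordinate domain with a potential. -/
def kaehlerAlgebra : KaehlerAlgebra (smoothAlg W) where
  d := pdDer hW
  d_comm := pdDer_comm hW
  pot := ofFun Φ hΦ
  Gi := Matrix.of fun k l => ofFun (fun z => (G z)⁻¹ k l)
    (contDiffOn_inv (contDiffOn_metric hW hΦ hG) hdet k l)
  G_mul_Gi := by
    ext1 k l
    refine ext_toFun fun z hz => ?_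
    rw [Matrix.mul_apply, toFun_sum]
    simp only [Matrix.of_apply, toFun_mul, Finset.sum_apply, Pi.mul_apply,
      ← eqOn_metric hW hΦ hG _ _ hz, toFun_ofFun _ _ hz]
    rw [← Matrix.mul_apply, Matrix.mul_nonsing_inv _ (isUnit_iff_ne_zero.mpr (hdet z hz)),
      Matrix.one_apply, Matrix.one_apply]
    split_ifs
    · rw [toFun_one hz]
    · rw [toFun_zero, Pi.zero_apply]
  Gi_mul_G := by
    ext1 k l
    refine ext_toFun fun z hz => ?_
    rw [Matrix.mul_apply, toFun_sum]
    simp only [Matrix.of_apply, toFun_mul, Finset.sum_apply, Pi.mul_apply,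
      ← eqOn_metric hW hΦ hG _ _ hz, toFun_ofFun _ _ hz]
    rw [← Matrix.mul_apply, Matrix.nonsing_inv_mul _ (isUnit_iff_ne_zero.mpr (hdet z hz)),
      Matrix.one_apply, Matrix.one_apply]
    split_ifs
    · rw [toFun_one hz]
    · rw [toFun_zero, Pi.zero_apply]
  zb := fun k => ofFun _ (contDiff_conj k).contDiffOn
  d_inl_zb := fun k l => ext_toFun fun z hz => by
    rw [← eqOn_pd hW (toFun_ofFun _ _).symm _ hz, pd_inl_conj, toFun_zero, Pi.zero_apply]
  d_inr_zb := fun k l => ext_toFun fun z hz => by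
    rw [← eqOn_pd hW (toFun_ofFun _ _).symm _ hz, pd_inr_conj]
    split_ifs
    · rw [toFun_one hz]
    · rw [toFun_zero, Pi.zero_apply]

end KaehlerLocal

/-! ### The curvature tensor of a Kähler algebra -/

namespace KaehlerAlgebra

variable {A : Type*} [CommRing A] [Algebra ℂ A] (K : KaehlerAlgebra A)

/-- The matrix `g_{BC}`. -/
def metric : Matrix Idx Idx A := Matrix.fromBlocks 0 K.G K.G.transpose 0

/-- The matrix `g^{BC}`. -/
def metricInv : Matrix Idx Idx A := Matrix.fromBlocks 0 K.Gi.transpose K.Gi 0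

/-- The Christoffel symbols `Γ^B_{CD}` of the Levi-Civita connection. -/
def chr (B C D : Idx) : A :=
  (1 / 2 : ℂ) • ∑ E, K.metricInv B E *
    (K.d C (K.metric E D) + K.d D (K.metric E C) - K.d E (K.metric C D))

/-- The components `R_{BCD}^E` of the curvature. -/
def riem (B C D E : Idx) : A :=
  K.d B (K.chr E C D) - K.d C (K.chr E B D)
    + ∑ F, (K.chr F C D * K.chr E B F - K.chr F B D * K.chr E C F)

/-- The components `∇_E R_{ABC}^D` of the covariant derivative of the curvature. -/
def nablaRiem (E I B C D : Idx) : A :=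
  K.d E (K.riem I B C D)
    + ∑ F, (K.chr D E F * K.riem I B C F - K.chr F E I * K.riem F B C D
      - K.chr F E B * K.riem I F C D - K.chr F E C * K.riem I B F D)

theorem half_smul_two_mul (x : A) : (1 / 2 : ℂ) • (2 * x) = x := by
  have : (2 : A) * x = (2 : ℂ) • x := by rw [two_smul, two_mul]
  rw [this, smul_smul]; norm_num

theorem chr_inl_inl_inl (k l m : Fin 2) :
    K.chr (Sum.inl k) (Sum.inl l) (Sum.inl m) = K.gamh k l m := by
  have h : ∀ n, K.d (Sum.inl m) (K.G l n) = K.d (Sum.inl l) (K.G m n) := fun n => K.d_inl_G _ _ _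
  rw [← half_smul_two_mul (K.gamh k l m), chr, gamh, Finset.mul_sum]
  simp only [metricInv, metric, Fintype.sum_sum_type, Matrix.fromBlocks_apply₁₁,
    Matrix.fromBlocks_apply₁₂, Matrix.fromBlocks_apply₂₁, Matrix.transpose_apply, Matrix.zero_apply,
    zero_mul, Finset.sum_const_zero, zero_add, map_zero, sub_zero, h]
  exact congrArg _ (Finset.sum_congr rfl fun n _ => by ring)

theorem chr_inr_inr_inr (k l m : Fin 2) :
    K.chr (Sum.inr k) (Sum.inr l) (Sum.inr m) = K.Gam k l m := by
  have h : ∀ n, K.d (Sum.inr m) (K.G n l) = K.d (Sum.inr l) (K.G n m) := fun n => K.d_inr_G _ _ _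
  rw [← half_smul_two_mul (K.Gam k l m), chr, Gam, Finset.mul_sum]
  simp only [metricInv, metric, Fintype.sum_sum_type, Matrix.fromBlocks_apply₂₂,
    Matrix.fromBlocks_apply₁₂, Matrix.fromBlocks_apply₂₁, Matrix.zero_apply,
    zero_mul, Finset.sum_const_zero, add_zero, map_zero, sub_zero, h]
  exact congrArg _ (Finset.sum_congr rfl fun n _ => by ring)

/-- Christoffel symbols with indices of both types vanish. -/
theorem chr_inl_inr_left (k l : Fin 2) (B : Idx) : K.chr (Sum.inl k) (Sum.inr l) B = 0 := by
  rcases B with m | m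
  · simp [chr, metricInv, metric, Fintype.sum_sum_type, K.d_inr_G l m]
  · simp [chr, metricInv, metric, Fintype.sum_sum_type]

theorem chr_inl_inr_right (k l : Fin 2) (B : Idx) : K.chr (Sum.inl k) B (Sum.inr l) = 0 := by
  rcases B with m | m
  · simp [chr, metricInv, metric, Fintype.sum_sum_type, K.d_inr_G l m]
  · simp [chr, metricInv, metric, Fintype.sum_sum_type]

theorem chr_inr_inl_left (k l : Fin 2) (B : Idx) : K.chr (Sum.inr k) (Sum.inl l) B = 0 := by
  rcases B with m | m
  · simp [chr, metricInv, metric, Fintype.sum_sum_type]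
  · simp [chr, metricInv, metric, Fintype.sum_sum_type, K.d_inl_G l]

theorem chr_inr_inl_right (k l : Fin 2) (B : Idx) : K.chr (Sum.inr k) B (Sum.inl l) = 0 := by
  rcases B with m | m
  · simp [chr, metricInv, metric, Fintype.sum_sum_type]
  · simp [chr, metricInv, metric, Fintype.sum_sum_type, K.d_inl_G l]

theorem riem_eq_rh (i p q m : Fin 2) :
    K.riem (Sum.inr i) (Sum.inl p) (Sum.inl q) (Sum.inl m) = K.rh i p q m := by
  simp [riem, rh, Fintype.sum_sum_type, chr_inl_inl_inl, chr_inl_inr_left, chr_inl_inr_right,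
    chr_inr_inl_right]

theorem locallySymmetric_of_nablaRiem (h : ∀ E I B C D, K.nablaRiem E I B C D = 0) :
    K.LocallySymmetric where
  inl e i p q m := by
    rw [← h (Sum.inl e) (Sum.inr i) (Sum.inl p) (Sum.inl q) (Sum.inl m)]
    simp only [nablaRiem, Fintype.sum_sum_type, chr_inl_inl_inl,
      chr_inl_inr_right, chr_inr_inl_left, chr_inr_inl_right, riem_eq_rh, zero_mul, sub_zero,
      Finset.sum_const_zero, add_zero]
  inr e i p q m := by
    rw [← h (Sum.inr e) (Sum.inr i) (Sum.inl p) (Sum.inl q) (Sum.inl m)]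
    simp only [nablaRiem, Fintype.sum_sum_type, chr_inr_inr_inr, chr_inl_inr_left,
      chr_inl_inr_right, chr_inr_inl_right, riem_eq_rh, zero_mul, Finset.sum_const_zero, zero_add,
      sub_eq_add_neg, neg_zero, add_zero, Finset.sum_neg_distrib]

end KaehlerAlgebra

/-! ### Tensors in coordinates -/

namespace KaehlerLocal

open smoothAlg

theorem gUp_eq {G : C2 → Matrix (Fin 2) (Fin 2) ℂ} {z : C2} (h : (G z).det ≠ 0) :
    gUp G z = Matrix.fromBlocks 0 ((G z)⁻¹).transpose (G z)⁻¹ 0 := by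
  refine Matrix.inv_eq_right_inv ?_
  have h1 : (G z).transpose * ((G z)⁻¹).transpose = 1 := by
    rw [← Matrix.transpose_mul, Matrix.nonsing_inv_mul _ (isUnit_iff_ne_zero.mpr h),
      Matrix.transpose_one]
  rw [gLow, Matrix.fromBlocks_multiply]
  simp [h1, Matrix.mul_nonsing_inv _ (isUnit_iff_ne_zero.mpr h)]

variable {W : Set C2} (hW : IsOpen W) {G : C2 → Matrix (Fin 2) (Fin 2) ℂ} {Φ : C2 → ℂ}
  (hΦ : ContDiffOn ℝ ∞ Φ W)
  (hG : ∀ z ∈ W, ∀ k l, G z k l = pd (Sum.inl k) (pd (Sum.inr l) Φ) z)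
  (hdet : ∀ z ∈ W, (G z).det ≠ 0)

theorem eqOn_G (k l : Fin 2) : Set.EqOn (fun z => G z k l)
    (toFun ((kaehlerAlgebra hW hΦ hG hdet).G k l)) W :=
  eqOn_metric hW hΦ hG k l

theorem eqOn_Gi (k l : Fin 2) : Set.EqOn (fun z => (G z)⁻¹ k l)
    (toFun ((kaehlerAlgebra hW hΦ hG hdet).Gi k l)) W :=
  (toFun_ofFun (fun z => (G z)⁻¹ k l)
    (contDiffOn_inv (contDiffOn_metric hW hΦ hG) hdet k l)).symm

theorem eqOn_gLow (B C : Idx) : Set.EqOn (fun z => gLow G z B C)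
    (toFun ((kaehlerAlgebra hW hΦ hG hdet).metric B C)) W := by
  intro z hz
  rcases B with k | k <;> rcases C with l | l
  · simp [gLow, KaehlerAlgebra.metric, toFun_zero]
  · exact eqOn_G hW hΦ hG hdet k l hz
  · exact eqOn_G hW hΦ hG hdet l k hz
  · simp [gLow, KaehlerAlgebra.metric, toFun_zero]

theorem eqOn_gUp (B C : Idx) : Set.EqOn (fun z => gUp G z B C)
    (toFun ((kaehlerAlgebra hW hΦ hG hdet).metricInv B C)) W := by
  intro z hz
  simp only [gUp_eq (hdet z hz)]
  rcases B with k | k <;> rcases C with l | l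
  · simp [KaehlerAlgebra.metricInv, toFun_zero]
  · exact eqOn_Gi hW hΦ hG hdet l k hz
  · exact eqOn_Gi hW hΦ hG hdet k l hz
  · simp [KaehlerAlgebra.metricInv, toFun_zero]

theorem eqOn_christoffel (B C D : Idx) : Set.EqOn (christoffel G B C D)
    (toFun ((kaehlerAlgebra hW hΦ hG hdet).chr B C D)) W := by
  intro z hz
  have h := fun P Q R => eqOn_pd hW (eqOn_gLow hW hΦ hG hdet P Q) R hz
  have h' := fun P Q => eqOn_gUp hW hΦ hG hdet P Q hz
  simp only at h'
  simp only [christoffel, KaehlerAlgebra.chr, toFun_smul, toFun_sum, toFun_mul, toFun_add,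
    toFun_sub, Pi.smul_apply, Pi.mul_apply, Pi.add_apply, Pi.sub_apply, Finset.sum_apply,
    smul_eq_mul, h, h']
  rfl

theorem eqOn_riem (B C D E : Idx) : Set.EqOn (riem G B C D E)
    (toFun ((kaehlerAlgebra hW hΦ hG hdet).riem B C D E)) W := by
  intro z hz
  have h := fun P Q R => eqOn_christoffel hW hΦ hG hdet P Q R hz
  have h' := fun P Q R S => eqOn_pd hW (eqOn_christoffel hW hΦ hG hdet P Q R) S hz
  simp only [riem, KaehlerAlgebra.riem, toFun_sum, toFun_mul, toFun_add,
    toFun_sub, Pi.mul_apply, Pi.add_apply, Pi.sub_apply, Finset.sum_apply, h, h']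
  rfl

theorem eqOn_nablaRiem (E I B C D : Idx) : Set.EqOn (nablaRiem G E I B C D)
    (toFun ((kaehlerAlgebra hW hΦ hG hdet).nablaRiem E I B C D)) W := by
  intro z hz
  have h := fun P Q R => eqOn_christoffel hW hΦ hG hdet P Q R hz
  have h' := fun P Q R S => eqOn_riem hW hΦ hG hdet P Q R S hz
  have h2 := fun P Q R S T => eqOn_pd hW (eqOn_riem hW hΦ hG hdet P Q R S) T hz
  simp only [nablaRiem, KaehlerAlgebra.nablaRiem, toFun_sum, toFun_mul, toFun_add,
    toFun_sub, Pi.mul_apply, Pi.add_apply, Pi.sub_apply, Finset.sum_apply, h, h', h2]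
  rfl

theorem locallySymmetric (h : ∀ z ∈ W, ∀ E I B C D, nablaRiem G E I B C D z = 0) :
    (kaehlerAlgebra hW hΦ hG hdet).LocallySymmetric :=
  KaehlerAlgebra.locallySymmetric_of_nablaRiem _ fun E I B C D => ext_toFun fun z hz => by
    rw [← eqOn_nablaRiem hW hΦ hG hdet E I B C D hz, h z hz, toFun_zero, Pi.zero_apply]

theorem eqOn_curv (i k l c : Fin 2) : Set.EqOn (curv G i k l c)
    (toFun ((kaehlerAlgebra hW hΦ hG hdet).cv i k l c)) W := by
  intro z hz
  have h1 := fun k l => eqOn_G hW hΦ hG hdet k l hz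
  have h2 := fun k l => eqOn_Gi hW hΦ hG hdet k l hz
  have h3 := fun p q m => eqOn_riem hW hΦ hG hdet (Sum.inr i) (Sum.inl p) (Sum.inl q) (Sum.inl m) hz
  simp only [KaehlerAlgebra.riem_eq_rh] at h1 h2 h3
  simp only [curv, riemLow, gUp_eq (hdet z hz), KaehlerAlgebra.cv, gLow, Fintype.sum_sum_type,
    Matrix.fromBlocks_apply₂₁, Matrix.fromBlocks_apply₂₂, Matrix.transpose_apply,
    Matrix.zero_apply, zero_mul, Finset.sum_const_zero, add_zero,
    toFun_sum, toFun_mul, Pi.mul_apply, Finset.sum_apply, h1, h2, h3]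

theorem eqOn_Dhol {F : C2 → ℂ} {a : smoothAlg W} (h : Set.EqOn F (toFun a) W) (k : Fin 2) :
    Set.EqOn (Dhol G k F) (toFun ((kaehlerAlgebra hW hΦ hG hdet).E k a)) W := by
  intro z hz
  have h1 := fun k l => eqOn_Gi hW hΦ hG hdet k l hz
  have h2 := fun l => eqOn_pd hW h (Sum.inr l) hz
  simp only at h1
  simp only [Dhol, gUp_eq (hdet z hz), KaehlerAlgebra.E_apply, Matrix.fromBlocks_apply₁₂,
    Matrix.transpose_apply, toFun_sum, toFun_mul, Pi.mul_apply, Finset.sum_apply, h1, h2]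
  rfl

theorem eqOn_Dbar {F : C2 → ℂ} {a : smoothAlg W} (h : Set.EqOn F (toFun a) W) (k : Fin 2) :
    Set.EqOn (Dbar G k F) (toFun ((kaehlerAlgebra hW hΦ hG hdet).D k a)) W := by
  intro z hz
  have h1 := fun k l => eqOn_Gi hW hΦ hG hdet k l hz
  have h2 := fun l => eqOn_pd hW h (Sum.inl l) hz
  simp only at h1
  simp only [Dbar, gUp_eq (hdet z hz), KaehlerAlgebra.D_apply, Matrix.fromBlocks_apply₂₁,
    toFun_sum, toFun_mul, Pi.mul_apply, Finset.sum_apply, h1, h2]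
  rfl

theorem eqOn_DholPow {F : C2 → ℂ} {a : smoothAlg W} (h : Set.EqOn F (toFun a) W) (r s : ℕ) :
    Set.EqOn (DholPow G r s F) (toFun (((kaehlerAlgebra hW hΦ hG hdet).E 0)^[r]
      (((kaehlerAlgebra hW hΦ hG hdet).E 1)^[s] a))) W := by
  have h1 : ∀ (k : Fin 2) (r : ℕ) {F : C2 → ℂ} {a : smoothAlg W}, Set.EqOn F (toFun a) W →
      Set.EqOn ((Dhol G k)^[r] F) (toFun (((kaehlerAlgebra hW hΦ hG hdet).E k)^[r] a)) W := by
    intro k r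
    induction r with
    | zero => exact fun h => h
    | succ r ih => exact fun h => ih (eqOn_Dhol hW hΦ hG hdet h k)
  exact h1 0 r (h1 1 s h)

theorem eqOn_DbarPow {F : C2 → ℂ} {a : smoothAlg W} (h : Set.EqOn F (toFun a) W) (r s : ℕ) :
    Set.EqOn (DbarPow G r s F) (toFun (((kaehlerAlgebra hW hΦ hG hdet).D 0)^[r]
      (((kaehlerAlgebra hW hΦ hG hdet).D 1)^[s] a))) W := by
  have h1 : ∀ (k : Fin 2) (r : ℕ) {F : C2 → ℂ} {a : smoothAlg W}, Set.EqOn F (toFun a) W →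
      Set.EqOn ((Dbar G k)^[r] F) (toFun (((kaehlerAlgebra hW hΦ hG hdet).D k)^[r] a)) W := by
    intro k r
    induction r with
    | zero => exact fun h => h
    | succ r ih => exact fun h => ih (eqOn_Dbar hW hΦ hG hdet h k)
  exact h1 0 r (h1 1 s h)

end KaehlerLocal

/-! ### Holomorphic charts and real smoothness -/

theorem mem_contDiffGroupoid_real {e : OpenPartialHomeomorph C2 C2}
    (h : e ∈ contDiffGroupoid ω 𝓘(ℂ, C2)) : e ∈ contDiffGroupoid ∞ 𝓘(ℝ, C2) := by
  have h' : ContDiffOn ℂ ω e e.source ∧ ContDiffOn ℂ ω e.symm e.target := by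
    rw [contDiffGroupoid, mem_groupoid_of_pregroupoid] at h
    simpa [contDiffPregroupoid] using h
  rw [contDiffGroupoid, mem_groupoid_of_pregroupoid]
  have h2 : ContDiffOn ℝ ∞ e e.source ∧ ContDiffOn ℝ ∞ e.symm e.target :=
    ⟨(h'.1.restrict_scalars ℝ).of_le le_top, (h'.2.restrict_scalars ℝ).of_le le_top⟩
  simpa [contDiffPregroupoid] using h2

section Charts

variable {M : Type*} [TopologicalSpace M] [ChartedSpace C2 M]

theorem isManifold_real [IsManifold 𝓘(ℂ, C2) ω M] : IsManifold 𝓘(ℝ, C2) ∞ M :=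
  { compatible := fun he he' => mem_contDiffGroupoid_real
      (StructureGroupoid.compatible (contDiffGroupoid ω 𝓘(ℂ, C2)) he he') }

theorem mem_maximalAtlas_real {φ : OpenPartialHomeomorph M C2} (hφ : φ ∈ holCharts M) :
    φ ∈ IsManifold.maximalAtlas 𝓘(ℝ, C2) ∞ M := by
  intro e he
  exact ⟨mem_contDiffGroupoid_real (hφ e he).1, mem_contDiffGroupoid_real (hφ e he).2⟩

theorem smoothOn_iff [IsManifold 𝓘(ℂ, C2) ω M] {φ : OpenPartialHomeomorph M C2} (hφ : φ ∈ holCharts M) {V : Set M}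
    (hV : V ⊆ φ.source) {f : M → ℂ} :
    SmoothOn f V ↔ ContDiffOn ℝ ∞ (f ∘ φ.symm) (φ.target ∩ φ.symm ⁻¹' V) := by
  have : IsManifold 𝓘(ℝ, C2) ∞ M := isManifold_real
  have h1 := contMDiffOn_iff_of_mem_maximalAtlas' (I := 𝓘(ℝ, C2)) (I' := 𝓘(ℝ, ℂ)) (n := ∞) (f := f)
    (mem_maximalAtlas_real hφ)
    (e' := OpenPartialHomeomorph.refl ℂ) (IsManifold.chart_mem_maximalAtlas (I := 𝓘(ℝ, ℂ)) (0 : ℂ)) hV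
    (fun _ _ => trivial)
  have h2 : φ.target ∩ φ.symm ⁻¹' V = φ '' V := by
    rw [φ.image_eq_target_inter_inv_preimage hV]
  rw [SmoothOn, h1, h2]
  simp [Function.comp_def]

theorem mfderiv_symm_injective [IsManifold 𝓘(ℂ, C2) ω M] {φ : OpenPartialHomeomorph M C2}
    (hφ : φ ∈ holCharts M) {z : C2} (hz : z ∈ φ.target) :
    Function.Injective (mfderiv 𝓘(ℂ, C2) 𝓘(ℂ, C2) φ.symm z) := by
  have h : φ.MDifferentiable 𝓘(ℂ, C2) 𝓘(ℂ, C2) :=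
    ⟨(contMDiffOn_of_mem_maximalAtlas hφ).mdifferentiableOn (by simp),
      (contMDiffOn_symm_of_mem_maximalAtlas hφ).mdifferentiableOn (by simp)⟩
  exact h.symm.mfderiv_injective hz

theorem linearMap_eq_sum_single {T : Type*} [AddCommGroup T] [Module ℂ T] (F : C2 →ₗ[ℂ] T)
    (v : C2) : F v = v 0 • F (Pi.single 0 1) + v 1 • F (Pi.single 1 1) := by
  rw [← map_smul, ← map_smul, ← map_add]
  congr 1
  ext i
  fin_cases i <;> simp

/-- Positivity of the metric makes the matrix of its components invertible. -/
theorem det_comp_ne_zero [IsManifold 𝓘(ℂ, C2) ω M] (g : KaehlerMetric M) {φ : OpenPartialHomeomorph M C2}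
    (hφ : φ ∈ holCharts M) {z : C2} (hz : z ∈ φ.target) : (g.comp φ z).det ≠ 0 := by
  intro hdet
  obtain ⟨v, hv, hv0⟩ := Matrix.exists_vecMul_eq_zero_iff.mpr hdet
  have hinj := mfderiv_symm_injective hφ hz
  set F := mfderiv 𝓘(ℂ, C2) 𝓘(ℂ, C2) φ.symm z with hF
  have hdec : F v = v 0 • F (Pi.single 0 (1 : ℂ) : C2) + v 1 • F (Pi.single 1 (1 : ℂ) : C2) :=
    linearMap_eq_sum_single F.toLinearMap v
  have h1 : ∀ w, g.form (φ.symm z) (F v) w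
      = v 0 * g.form (φ.symm z) (F (Pi.single 0 (1 : ℂ) : C2)) w
        + v 1 * g.form (φ.symm z) (F (Pi.single 1 (1 : ℂ) : C2)) w := by
    intro w
    rw [hdec, g.form_add, g.form_smul, g.form_smul]
  have h2 : ∀ l, g.form (φ.symm z) (F v) (F (Pi.single l (1 : ℂ) : C2)) = 0 := by
    intro l
    have := congrFun hv0 l
    rw [h1]
    simpa [Matrix.vecMul, dotProduct, KaehlerMetric.comp, hermComponents, Fin.sum_univ_two]
      using this
  have h3 : g.form (φ.symm z) (F v) (F v) = 0 := by
    rw [h1, g.form_symm _ (F v), h2, g.form_symm _ (F v), h2]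
    simp
  have h4 : F v ≠ 0 := fun h => hv (hinj (by rw [h]; exact (map_zero F).symm))
  have h5 := g.form_pos _ _ h4
  rw [h3] at h5
  simp at h5

end Charts

/-! ### Functions near a point of a coordinate system -/

open KaehlerLocal smoothAlg

/-- An open subset `V` of the domain of a holomorphic coordinate system `φ`. -/
structure CoordDomain (M : Type*) [TopologicalSpace M] [ChartedSpace C2 M] where
  /-- the coordinate system -/
  φ : OpenPartialHomeomorph M C2
  mem : φ ∈ holCharts M
  /-- the domain -/
  V : Set M
  isOpen : IsOpen V
  subset : V ⊆ φ.source

namespace CoordDomain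

variable {M : Type*} [TopologicalSpace M] [ChartedSpace C2 M]

variable (X : CoordDomain M)

/-- The image of the domain under the coordinates. -/
def W : Set C2 := X.φ.target ∩ X.φ.symm ⁻¹' X.V

theorem isOpen_W : IsOpen X.W := X.φ.symm.isOpen_inter_preimage X.isOpen

theorem φ_mem_W {x : M} (hx : x ∈ X.V) : X.φ x ∈ X.W :=
  ⟨X.φ.map_source (X.subset hx), by
    rw [Set.mem_preimage, X.φ.left_inv (X.subset hx)]; exact hx⟩

theorem symm_mem_V {z : C2} (hz : z ∈ X.W) : X.φ.symm z ∈ X.V := hz.2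

theorem right_inv {z : C2} (hz : z ∈ X.W) : X.φ (X.φ.symm z) = z := X.φ.right_inv hz.1

theorem left_inv {x : M} (hx : x ∈ X.V) : X.φ.symm (X.φ x) = x := X.φ.left_inv (X.subset hx)

/-- On the domain, the function `f` is the element `a` of the algebra of smooth functions in
coordinates. -/
def Rep (f : M → ℂ) (a : smoothAlg X.W) : Prop := Set.EqOn (f ∘ X.φ.symm) (toFun a) X.W

variable {X}

theorem Rep.apply {f : M → ℂ} {a : smoothAlg X.W} (h : X.Rep f a) {x : M} (hx : x ∈ X.V) :
    f x = toFun a (X.φ x) := by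
  rw [← h (X.φ_mem_W hx), Function.comp_apply, X.left_inv hx]

theorem Rep.add {f f' : M → ℂ} {a a' : smoothAlg X.W} (h : X.Rep f a) (h' : X.Rep f' a') :
    X.Rep (f + f') (a + a') := fun z hz => by
  rw [toFun_add, Pi.add_apply, ← h hz, ← h' hz]; rfl

theorem Rep.mul {f f' : M → ℂ} {a a' : smoothAlg X.W} (h : X.Rep f a) (h' : X.Rep f' a') :
    X.Rep (f * f') (a * a') := fun z hz => by
  rw [toFun_mul, Pi.mul_apply, ← h hz, ← h' hz]; rfl

theorem Rep.zero : X.Rep 0 0 := fun z _ => by rw [toFun_zero]; rfl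

theorem Rep.one : X.Rep 1 1 := fun z hz => by rw [toFun_one hz]; rfl

theorem Rep.sum {ι : Type*} (s : Finset ι) {f : ι → M → ℂ} {a : ι → smoothAlg X.W}
    (h : ∀ i, X.Rep (f i) (a i)) : X.Rep (∑ i ∈ s, f i) (∑ i ∈ s, a i) := fun z hz => by
  rw [toFun_sum, Finset.sum_apply, Function.comp_apply, Finset.sum_apply]
  exact Finset.sum_congr rfl fun i _ => h i hz

theorem Rep.chartPd {f : M → ℂ} {a : smoothAlg X.W} (h : X.Rep f a) (A : Idx) :
    X.Rep (chartPd X.φ A f) (pdDer X.isOpen_W A a) := fun z hz => by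
  rw [Function.comp_apply, _root_.chartPd, X.right_inv hz, eqOn_pd X.isOpen_W h A hz]

theorem Rep.unique {f f' : M → ℂ} {a a' : smoothAlg X.W} (h : X.Rep f a) (h' : X.Rep f' a')
    (e : Set.EqOn f f' X.V) : a = a' := ext_toFun fun z hz => by
  rw [← h hz, ← h' hz]; exact e (X.symm_mem_V hz)

variable (X) in
/-- The function on the manifold given by an element of the algebra. -/
def lift (a : smoothAlg X.W) : M → ℂ := toFun a ∘ X.φ

theorem rep_lift (a : smoothAlg X.W) : X.Rep (X.lift a) a := fun z hz => by
  rw [lift, Function.comp_apply, Function.comp_apply, X.right_inv hz]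

/-- The multiple derivatives `∂^I` in the algebra of smooth functions. -/
def pdMultiDer {W : Set C2} (hW : IsOpen W) (I : Idx → ℕ) (a : smoothAlg W) : smoothAlg W :=
  (pdDer hW (Sum.inl 0))^[I (Sum.inl 0)] ((pdDer hW (Sum.inl 1))^[I (Sum.inl 1)]
    ((pdDer hW (Sum.inr 0))^[I (Sum.inr 0)] ((pdDer hW (Sum.inr 1))^[I (Sum.inr 1)] a)))

theorem eqOn_iterate_pd {W : Set C2} (hW : IsOpen W) {F : C2 → ℂ} {a : smoothAlg W}
    (h : Set.EqOn F (toFun a) W) (A : Idx) (n : ℕ) :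
    Set.EqOn ((pd A)^[n] F) (toFun ((pdDer hW A)^[n] a)) W := by
  induction n generalizing F a with
  | zero => exact h
  | succ n ih => exact ih (eqOn_pd hW h A)

theorem eqOn_pdMulti {W : Set C2} (hW : IsOpen W) {F : C2 → ℂ} {a : smoothAlg W}
    (h : Set.EqOn F (toFun a) W) (I : Idx → ℕ) :
    Set.EqOn (pdMulti I F) (toFun (pdMultiDer hW I a)) W :=
  eqOn_iterate_pd hW (eqOn_iterate_pd hW (eqOn_iterate_pd hW (eqOn_iterate_pd hW h _ _) _ _) _ _) _ _

theorem pdMultiDer_linear {W : Set C2} (hW : IsOpen W) (I : Idx → ℕ) :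
    ∃ L : smoothAlg W →ₗ[ℂ] smoothAlg W, ∀ a, L a = pdMultiDer hW I a :=
  ⟨((pdDer hW (Sum.inl 0) : smoothAlg W →ₗ[ℂ] smoothAlg W) ^ I (Sum.inl 0)) ∘ₗ
    ((pdDer hW (Sum.inl 1) : smoothAlg W →ₗ[ℂ] smoothAlg W) ^ I (Sum.inl 1)) ∘ₗ
    ((pdDer hW (Sum.inr 0) : smoothAlg W →ₗ[ℂ] smoothAlg W) ^ I (Sum.inr 0)) ∘ₗ
    ((pdDer hW (Sum.inr 1) : smoothAlg W →ₗ[ℂ] smoothAlg W) ^ I (Sum.inr 1)),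
    fun a => by
      simp only [LinearMap.comp_apply, Module.End.pow_apply]; rfl⟩

variable [IsManifold 𝓘(ℂ, C2) ω M]

theorem Rep.smoothOn {f : M → ℂ} {a : smoothAlg X.W} (h : X.Rep f a) : SmoothOn f X.V :=
  (smoothOn_iff X.mem X.subset).mpr ((contDiffOn a).congr h)

theorem exists_rep {f : M → ℂ} (h : SmoothOn f X.V) : ∃ a, X.Rep f a :=
  ⟨ofFun _ ((smoothOn_iff X.mem X.subset).mp h), (toFun_ofFun _ _).symm⟩

end CoordDomain

/-! ### Bidifferential operators in coordinates -/

theorem iterate_d_mem_vanish {A : Type*} [CommRing A] [Algebra ℂ A] {K : KaehlerAlgebra A}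
    {ε : A →ₐ[ℂ] ℂ} (B : Idx) {n r : ℕ} {h : A} (hh : h ∈ K.vanish ε (n + r)) :
    (K.d B)^[r] h ∈ K.vanish ε n := by
  induction r generalizing h with
  | zero => exact hh
  | succ r ih => exact ih (hh.2 B)

namespace CoordDomain

variable {M : Type*} [TopologicalSpace M] [ChartedSpace C2 M] {X : CoordDomain M}

theorem exists_local_form {B : (M → ℂ) → (M → ℂ) → M → ℂ} [IsManifold 𝓘(ℂ, C2) ω M]
    (hB : IsBidifferential B) {x : M} (hx : x ∈ X.V) :
    ∃ V' : Set M, IsOpen V' ∧ x ∈ V' ∧ V' ⊆ X.V ∧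
      ∃ (S : Finset ((Idx → ℕ) × (Idx → ℕ))) (c : (Idx → ℕ) × (Idx → ℕ) → M → ℂ),
        (∀ IJ ∈ S, SmoothOn (c IJ) V') ∧
        ∀ (f h : M → ℂ) (a b : smoothAlg X.W), X.Rep f a → X.Rep h b → ∀ y ∈ V',
          B f h y = ∑ IJ ∈ S, c IJ y * toFun (pdMultiDer X.isOpen_W IJ.1 a) (X.φ y) *
            toFun (pdMultiDer X.isOpen_W IJ.2 b) (X.φ y) := by
  obtain ⟨V₀, hV₀, hxV₀, -, S, c, hc, h⟩ := hB X.φ X.mem x (X.subset hx)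
  refine ⟨V₀ ∩ X.V, hV₀.inter X.isOpen, ⟨hxV₀, hx⟩, Set.inter_subset_right, S, c,
    fun IJ hIJ => (hc IJ hIJ).mono Set.inter_subset_left, fun f k a b ha hb y hy => ?_⟩
  rw [h (V₀ ∩ X.V) (hV₀.inter X.isOpen) Set.inter_subset_left f k
    (ha.smoothOn.mono Set.inter_subset_right) (hb.smoothOn.mono Set.inter_subset_right) y hy]
  refine Finset.sum_congr rfl fun IJ _ => ?_
  rw [eqOn_pdMulti X.isOpen_W ha IJ.1 (X.φ_mem_W hy.2),
    eqOn_pdMulti X.isOpen_W hb IJ.2 (X.φ_mem_W hy.2)]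

theorem smoothOn_bidifferential {B : (M → ℂ) → (M → ℂ) → M → ℂ} [IsManifold 𝓘(ℂ, C2) ω M]
    (hB : IsBidifferential B) {f h : M → ℂ} {a b : smoothAlg X.W} (ha : X.Rep f a)
    (hb : X.Rep h b) : SmoothOn (B f h) X.V := by
  intro x hx
  obtain ⟨V', hV', hxV', hsub, S, c, hc, hform⟩ := exists_local_form hB hx
  have hsub' : V' ⊆ X.φ.source := hsub.trans X.subset
  have hW : X.φ.target ∩ X.φ.symm ⁻¹' V' ⊆ X.W :=
    Set.inter_subset_inter_right _ (Set.preimage_mono hsub)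
  have h1 : SmoothOn (B f h) V' := by
    rw [smoothOn_iff X.mem hsub']
    have h2 : ContDiffOn ℝ ∞ (fun z => ∑ IJ ∈ S, (c IJ ∘ X.φ.symm) z *
        toFun (pdMultiDer X.isOpen_W IJ.1 a) z * toFun (pdMultiDer X.isOpen_W IJ.2 b) z)
        (X.φ.target ∩ X.φ.symm ⁻¹' V') :=
      ContDiffOn.sum fun IJ hIJ => (((smoothOn_iff X.mem hsub').mp (hc IJ hIJ)).mul
        ((contDiffOn _).mono hW)).mul ((contDiffOn _).mono hW)
    refine h2.congr fun z hz => ?_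
    rw [Function.comp_apply, hform f h a b ha hb _ hz.2, X.φ.right_inv hz.1]
    rfl
  exact ((h1 x hxV').contMDiffAt (hV'.mem_nhds hxV')).contMDiffWithinAt

/-- A bidifferential operator induces a bilinear map on the smooth functions in coordinates, which
is of finite order in its second argument at each point. -/
theorem exists_bilinear {B : (M → ℂ) → (M → ℂ) → M → ℂ} [IsManifold 𝓘(ℂ, C2) ω M]
    (hB : IsBidifferential B) {K : KaehlerAlgebra (smoothAlg X.W)}
    (hK : K.d = pdDer X.isOpen_W) :
    ∃ β : smoothAlg X.W →ₗ[ℂ] smoothAlg X.W →ₗ[ℂ] smoothAlg X.W,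
      (∀ (f h : M → ℂ) (a b : smoothAlg X.W), X.Rep f a → X.Rep h b → X.Rep (B f h) (β a b)) ∧
      ∀ a, ∀ ε ∈ Set.range (eval (W := X.W)), ∃ N, ∀ b ∈ K.vanish ε N, ε (β a b) = 0 := by
  choose β₀ hβ₀ using fun a b : smoothAlg X.W => exists_rep (X := X)
    (smoothOn_bidifferential hB (rep_lift a) (rep_lift b))
  -- at each point, the operator is a fixed combination of products of derivatives
  have key : ∀ z ∈ X.W, ∃ (S : Finset ((Idx → ℕ) × (Idx → ℕ))) (c : (Idx → ℕ) × (Idx → ℕ) → ℂ),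
      (∀ a b, toFun (β₀ a b) z = ∑ IJ ∈ S, c IJ * toFun (pdMultiDer X.isOpen_W IJ.1 a) z *
            toFun (pdMultiDer X.isOpen_W IJ.2 b) z) ∧
      ∀ f h a b, X.Rep f a → X.Rep h b → B f h (X.φ.symm z) = toFun (β₀ a b) z := by
    intro z hz
    obtain ⟨V', hV', hxV', hsub, S, c, hc, hform⟩ := exists_local_form hB (X.symm_mem_V hz)
    have h1 : ∀ a b, toFun (β₀ a b) z = ∑ IJ ∈ S, c IJ (X.φ.symm z) *
        toFun (pdMultiDer X.isOpen_W IJ.1 a) z * toFun (pdMultiDer X.isOpen_W IJ.2 b) z := by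
      intro a b
      rw [← hβ₀ a b hz, Function.comp_apply, hform _ _ a b (rep_lift a) (rep_lift b) _ hxV',
        X.right_inv hz]
    refine ⟨S, fun IJ => c IJ (X.φ.symm z), h1, fun f h a b ha hb => ?_⟩
    rw [h1, hform f h a b ha hb _ hxV', X.right_inv hz]
  choose L hL using fun I => pdMultiDer_linear X.isOpen_W I
  refine ⟨LinearMap.mk₂ ℂ β₀ ?_ ?_ ?_ ?_, ?_, ?_⟩
  · intro a a' b
    refine ext_toFun fun z hz => ?_
    obtain ⟨S, c, h1, -⟩ := key z hz
    simp only [toFun_add, Pi.add_apply, h1, ← hL, map_add, ← Finset.sum_add_distrib]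
    exact Finset.sum_congr rfl fun _ _ => by ring
  · intro r a b
    refine ext_toFun fun z hz => ?_
    obtain ⟨S, c, h1, -⟩ := key z hz
    simp only [toFun_smul, Pi.smul_apply, h1, ← hL, map_smul, smul_eq_mul, Finset.mul_sum]
    exact Finset.sum_congr rfl fun _ _ => by ring
  · intro a b b'
    refine ext_toFun fun z hz => ?_
    obtain ⟨S, c, h1, -⟩ := key z hz
    simp only [toFun_add, Pi.add_apply, h1, ← hL, map_add, ← Finset.sum_add_distrib]
    exact Finset.sum_congr rfl fun _ _ => by ring
  · intro r a b
    refine ext_toFun fun z hz => ?_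
    obtain ⟨S, c, h1, -⟩ := key z hz
    simp only [toFun_smul, Pi.smul_apply, h1, ← hL, map_smul, smul_eq_mul, Finset.mul_sum]
    exact Finset.sum_congr rfl fun _ _ => by ring
  · intro f h a b ha hb z hz
    obtain ⟨S, c, -, h2⟩ := key z hz
    exact h2 f h a b ha hb
  · rintro a _ ⟨z, rfl⟩
    obtain ⟨S, c, h1, -⟩ := key z z.2
    refine ⟨1 + S.sup fun IJ => IJ.2 (Sum.inr 1) + IJ.2 (Sum.inr 0) + IJ.2 (Sum.inl 1)
      + IJ.2 (Sum.inl 0), fun b hb => ?_⟩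
    rw [LinearMap.mk₂_apply, eval_apply, h1]
    refine Finset.sum_eq_zero fun IJ hIJ => ?_
    have h3 : b ∈ K.vanish (eval z) (1 + IJ.2 (Sum.inl 0) + IJ.2 (Sum.inl 1)
        + IJ.2 (Sum.inr 0) + IJ.2 (Sum.inr 1)) := by
      refine KaehlerAlgebra.vanish_anti ?_ hb
      have := Finset.le_sup (f := fun IJ : (Idx → ℕ) × (Idx → ℕ) => IJ.2 (Sum.inr 1)
        + IJ.2 (Sum.inr 0) + IJ.2 (Sum.inl 1) + IJ.2 (Sum.inl 0)) hIJ
      omega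
    have h4 := iterate_d_mem_vanish (Sum.inl 0) (iterate_d_mem_vanish (Sum.inl 1)
      (iterate_d_mem_vanish (Sum.inr 0) (iterate_d_mem_vanish (Sum.inr 1) h3)))
    have h5 := h4.1
    rw [hK, eval_apply] at h5
    rw [show toFun (pdMultiDer X.isOpen_W IJ.2 b) z = 0 from h5, mul_zero]

end CoordDomain

/-! ### Star products in coordinates -/

section Sequences

variable {A : Type*} [CommRing A] [Algebra ℂ A]

/-- The product of formal power series, given by their sequences of coefficients, that is defined
by bilinear cochains. -/
def cochainMul (β : ℕ → A →ₗ[ℂ] A →ₗ[ℂ] A) (F H : ℕ → A) (n : ℕ) : A :=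
  ∑ p ∈ Finset.HasAntidiagonal.antidiagonal n, ∑ q ∈ Finset.HasAntidiagonal.antidiagonal p.2, β p.1 (F q.1) (H q.2)

/-- The coefficients of a constant power series. -/
def constSeq (a : A) (n : ℕ) : A := if n = 0 then a else 0

/-- The coefficients of `(a + ħ ∂) F`. -/
def potentialSeq (a : A) (d : Derivation ℂ A A) (F : ℕ → A) : ℕ → A
  | 0 => a * F 0
  | n + 1 => a * F (n + 1) + d (F n)

variable (β : ℕ → A →ₗ[ℂ] A →ₗ[ℂ] A)

theorem cochainMul_const_left (a : A) (H : ℕ → A) (n : ℕ) :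
    cochainMul β (constSeq a) H n = ∑ p ∈ Finset.HasAntidiagonal.antidiagonal n, β p.1 a (H p.2) := by
  refine Finset.sum_congr rfl fun p _ => ?_
  rw [Finset.sum_eq_single (0, p.2)]
  · simp [constSeq]
  · rintro ⟨i, j⟩ hij hne
    rw [Finset.HasAntidiagonal.mem_antidiagonal] at hij
    have : i ≠ 0 := by
      rintro rfl
      exact hne (by simpa using hij)
    simp [constSeq, this]
  · intro h; simp at h

theorem cochainMul_const_right (F : ℕ → A) (b : A) (n : ℕ) :
    cochainMul β F (constSeq b) n = ∑ p ∈ Finset.HasAntidiagonal.antidiagonal n, β p.1 (F p.2) b := by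
  refine Finset.sum_congr rfl fun p _ => ?_
  rw [Finset.sum_eq_single (p.2, 0)]
  · simp [constSeq]
  · rintro ⟨i, j⟩ hij hne
    rw [Finset.HasAntidiagonal.mem_antidiagonal] at hij
    have : j ≠ 0 := by
      rintro rfl
      exact hne (by simpa using hij)
    simp [constSeq, this]
  · intro h; simp at h

theorem cochainMul_const_const (a b : A) (n : ℕ) :
    cochainMul β (constSeq a) (constSeq b) n = β n a b := by
  rw [cochainMul_const_left, Finset.sum_eq_single (n, 0)]
  · simp [constSeq]
  · rintro ⟨i, j⟩ hij hne
    rw [Finset.HasAntidiagonal.mem_antidiagonal] at hij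
    have : j ≠ 0 := by
      rintro rfl
      exact hne (by simpa using hij)
    simp [constSeq, this]
  · intro h; simp at h

variable {β}

/-- Associativity and `h ∗ b = h b` give `a ∗ (h b) = (a ∗ h) b`. -/
theorem cochain_apply_mul_right {b : A}
    (hb : ∀ h n, β n h b = constSeq (h * b) n)
    (hassoc : ∀ a h n, cochainMul β (constSeq a) (cochainMul β (constSeq h) (constSeq b)) n
      = cochainMul β (cochainMul β (constSeq a) (constSeq h)) (constSeq b) n)
    (a h : A) (n : ℕ) : β n a (h * b) = β n a h * b := by
  have h0 := hassoc a h n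
  rw [cochainMul_const_left, cochainMul_const_right] at h0
  simp only [cochainMul_const_const, hb] at h0
  rw [Finset.sum_eq_single (n, 0), Finset.sum_eq_single (0, n)] at h0
  · simpa [constSeq] using h0
  · rintro ⟨i, j⟩ hij hne
    rw [Finset.HasAntidiagonal.mem_antidiagonal] at hij
    have : i ≠ 0 := by
      rintro rfl
      exact hne (by simpa using hij)
    simp [constSeq, this]
  · intro h; simp at h
  · rintro ⟨i, j⟩ hij hne
    rw [Finset.HasAntidiagonal.mem_antidiagonal] at hij
    have : j ≠ 0 := by
      rintro rfl
      exact hne (by simpa using hij)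
    simp [constSeq, this]
  · intro h; simp at h

/-- The coefficients of the condition that `f ∗ ·` commutes with `a + ħ ∂`. -/
theorem cochain_potential {f h a : A} {d : Derivation ℂ A A}
    (hkar : ∀ n, cochainMul β (constSeq f) (potentialSeq a d (constSeq h)) n
      = potentialSeq a d (cochainMul β (constSeq f) (constSeq h)) n) :
    β 0 f (a * h) = a * β 0 f h ∧
      ∀ n, β (n + 1) f (a * h) + β n f (d h) = a * β (n + 1) f h + d (β n f h) := by
  constructor
  · have := hkar 0
    rw [potentialSeq, cochainMul_const_const, cochainMul_const_left] at this
    simpa [potentialSeq, constSeq] using this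
  · intro n
    have := hkar (n + 1)
    rw [potentialSeq, cochainMul_const_const, cochainMul_const_const, cochainMul_const_left] at this
    rw [← this, Finset.Nat.sum_antidiagonal_succ',
      Finset.sum_eq_single (n, 0)]
    · simp [potentialSeq, constSeq]
    · rintro ⟨i, j⟩ hij hne
      rw [Finset.HasAntidiagonal.mem_antidiagonal] at hij
      have : j ≠ 0 := by
        rintro rfl
        exact hne (by simpa using hij)
      simp [potentialSeq, constSeq, this]
    · intro h; simp at h

end Sequences

namespace CoordDomain

variable {M : Type*} [TopologicalSpace M] [ChartedSpace C2 M] {X : CoordDomain M}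

/-- The coefficients of a power series, in coordinates. -/
def RepSeq (F : PowerSeries (M → ℂ)) (a : ℕ → smoothAlg X.W) : Prop :=
  ∀ n, X.Rep (PowerSeries.coeff n F) (a n)

theorem RepSeq.unique {F H : PowerSeries (M → ℂ)} {a b : ℕ → smoothAlg X.W} (ha : RepSeq F a)
    (hb : RepSeq H b) (e : SeriesEqOn F H X.V) (n : ℕ) : a n = b n :=
  (ha n).unique (hb n) fun x hx => by
    have := congrArg (PowerSeries.coeff n) (e x hx)
    simpa [seriesAt] using this

theorem Rep.C {f : M → ℂ} {a : smoothAlg X.W} (h : X.Rep f a) :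
    RepSeq (PowerSeries.C f) (constSeq a) := fun n => by
  rw [PowerSeries.coeff_C, constSeq]
  split_ifs
  · exact h
  · exact Rep.zero

theorem RepSeq.starOf {B : ℕ → (M → ℂ) → (M → ℂ) → M → ℂ}
    {β : ℕ → smoothAlg X.W →ₗ[ℂ] smoothAlg X.W →ₗ[ℂ] smoothAlg X.W}
    (hβ : ∀ n (f h : M → ℂ) (a b : smoothAlg X.W), X.Rep f a → X.Rep h b →
      X.Rep (B n f h) (β n a b))
    {F H : PowerSeries (M → ℂ)} {a b : ℕ → smoothAlg X.W} (ha : RepSeq F a) (hb : RepSeq H b) :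
    RepSeq (starOf B F H) (cochainMul β a b) := fun n => by
  rw [_root_.starOf, PowerSeries.coeff_mk]
  exact Rep.sum _ fun p => Rep.sum _ fun q => hβ _ _ _ _ _ (ha _) (hb _)

theorem RepSeq.rightPotential {Φ : M → ℝ} {l : Fin 2}
    {F : PowerSeries (M → ℂ)} {u : smoothAlg X.W} {a : ℕ → smoothAlg X.W}
    (hu : X.Rep (fun y => (Φ y : ℂ)) u) (ha : RepSeq F a) :
    RepSeq (StarProduct.rightPotential X.φ Φ l F)
      (potentialSeq (pdDer X.isOpen_W (Sum.inr l) u) (pdDer X.isOpen_W (Sum.inr l)) a) := by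
  rintro (_ | n)
  · rw [StarProduct.rightPotential, map_add, PowerSeries.coeff_C_mul, PowerSeries.coeff_zero_X_mul,
      add_zero]
    exact (hu.chartPd _).mul (ha 0)
  · rw [StarProduct.rightPotential, map_add, PowerSeries.coeff_C_mul,
      PowerSeries.coeff_succ_X_mul, PowerSeries.coeff_mk]
    exact ((hu.chartPd _).mul (ha _)).add ((ha _).chartPd _)

theorem RepSeq.seriesSmoothOn [IsManifold 𝓘(ℂ, C2) ω M] {F : PowerSeries (M → ℂ)}
    {a : ℕ → smoothAlg X.W} (ha : RepSeq F a) : SeriesSmoothOn F X.V := fun n => (ha n).smoothOn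

variable {g : KaehlerMetric M}

theorem contDiffOn_potential [IsManifold 𝓘(ℂ, C2) ω M] {Φ : M → ℝ} (hΦ : g.IsPotential Φ X.V) :
    ContDiffOn ℝ ∞ ((fun y => (Φ y : ℂ)) ∘ X.φ.symm) X.W :=
  (smoothOn_iff X.mem X.subset).mp hΦ.1

theorem comp_eq_of_potential {Φ : M → ℝ} (hΦ : g.IsPotential Φ X.V) :
    ∀ z ∈ X.W, ∀ k l, g.comp X.φ z k l
      = pd (Sum.inl k) (pd (Sum.inr l) ((fun y => (Φ y : ℂ)) ∘ X.φ.symm)) z := by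
  intro z hz k l
  have h1 := hΦ.2 X.φ X.mem (X.φ.symm z) ⟨X.symm_mem_V hz, X.subset (X.symm_mem_V hz)⟩ k l
  rw [X.right_inv hz] at h1
  rw [KaehlerMetric.comp, h1, _root_.chartPd, X.right_inv hz]
  refine pd_congr X.isOpen_W (fun w hw => ?_) _ hz
  rw [Function.comp_apply, _root_.chartPd, X.right_inv hw]

theorem mdifferentiableOn_coord (k : Fin 2) :
    MDifferentiableOn 𝓘(ℂ, C2) 𝓘(ℂ, ℂ) (fun y => X.φ y k) X.V := by
  have h1 : MDifferentiableOn 𝓘(ℂ, C2) 𝓘(ℂ, C2) X.φ X.φ.source :=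
    (contMDiffOn_of_mem_maximalAtlas X.mem).mdifferentiableOn (by simp)
  have h2 : MDifferentiable 𝓘(ℂ, C2) 𝓘(ℂ, ℂ) (fun z : C2 => z k) :=
    (ContinuousLinearMap.proj (R := ℂ) (φ := fun _ : Fin 2 => ℂ) k).mdifferentiable
  exact h2.comp_mdifferentiableOn (h1.mono X.subset)

variable [IsManifold 𝓘(ℂ, C2) ω M]

/-- The Kähler algebra of smooth functions in coordinates. -/
def algebra {Φ : M → ℝ} (hΦ : g.IsPotential Φ X.V) : KaehlerAlgebra (smoothAlg X.W) :=
  kaehlerAlgebra X.isOpen_W (contDiffOn_potential hΦ) (comp_eq_of_potential hΦ)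
    fun _ hz => det_comp_ne_zero g X.mem hz.1

theorem rep_zb {Φ : M → ℝ} (hΦ : g.IsPotential Φ X.V) (k : Fin 2) :
    X.Rep (fun y => (starRingEnd ℂ) (X.φ y k)) ((algebra hΦ).zb k) := fun z hz => by
  rw [Function.comp_apply, X.right_inv hz]
  exact (toFun_ofFun (fun z => (starRingEnd ℂ) (z k)) (contDiff_conj k).contDiffOn hz).symm

theorem rep_pot {Φ : M → ℝ} (hΦ : g.IsPotential Φ X.V) :
    X.Rep (fun y => (Φ y : ℂ)) (algebra hΦ).pot :=
  (toFun_ofFun _ (contDiffOn_potential hΦ)).symm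

/-- Karabegov's star product satisfies, in the coordinates of a domain with a potential, the
conditions which determine the left multiplication operators. -/
theorem exists_isLeftMul (S : StarProduct g) (hsep : S.SeparatesVariables) (hkar : S.IsKarabegov)
    {Φ : M → ℝ} (hΦ : g.IsPotential Φ X.V) :
    ∃ β : ℕ → smoothAlg X.W →ₗ[ℂ] smoothAlg X.W →ₗ[ℂ] smoothAlg X.W,
      (∀ n (f h : M → ℂ) (a b : smoothAlg X.W), X.Rep f a → X.Rep h b →
        X.Rep (S.B n f h) (β n a b)) ∧
      ∀ a, (algebra hΦ).IsLeftMul (Set.range (eval (W := X.W))) a fun n => β n a := by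
  choose β hβ hfin using fun n => exists_bilinear (X := X) (S.bidifferential n)
    (K := algebra hΦ) rfl
  have hβ' : ∀ {F H : PowerSeries (M → ℂ)} {a b : ℕ → smoothAlg X.W}, RepSeq F a → RepSeq H b →
      RepSeq (starOf S.B F H) (cochainMul β a b) := RepSeq.starOf hβ
  refine ⟨β, hβ, fun a => ?_⟩
  have hunit : ∀ n, β n a 1 = constSeq a n := by
    intro n
    have h1 : RepSeq (X := X) (1 : PowerSeries (M → ℂ)) (constSeq 1) := by
      rw [← map_one (PowerSeries.C (R := M → ℂ))]
      exact Rep.one.C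
    have h2 := (hβ' (rep_lift a).C h1).unique (rep_lift a).C
      (S.unit X.V X.isOpen _ (rep_lift a).C.seriesSmoothOn).1 n
    rwa [cochainMul_const_const] at h2
  have hzb : ∀ k h n, β n h ((algebra hΦ).zb k) = constSeq (h * (algebra hΦ).zb k) n := by
    intro k h n
    have hz := rep_zb hΦ k
    have h2 := (hβ' (rep_lift h).C hz.C).unique ((rep_lift h).mul hz).C
      ((hsep X.V X.isOpen _ (rep_lift h).smoothOn).2 _ (by
        simpa using mdifferentiableOn_coord (X := X) k)) n
    rwa [cochainMul_const_const] at h2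
  have hassoc : ∀ a h b n, cochainMul β (constSeq a) (cochainMul β (constSeq h) (constSeq b)) n
      = cochainMul β (cochainMul β (constSeq a) (constSeq h)) (constSeq b) n := by
    intro a h b n
    have ha := (rep_lift a).C
    have hh := (rep_lift h).C
    have hb := (rep_lift b).C
    exact (hβ' ha (hβ' hh hb)).unique (hβ' (hβ' ha hh) hb)
      (S.assoc X.V X.isOpen _ _ _ ha.seriesSmoothOn hh.seriesSmoothOn hb.seriesSmoothOn) n
  have hpot := fun l h => cochain_potential (β := β) (f := a) (h := h) (a := (algebra hΦ).a l)
    (d := (algebra hΦ).d (Sum.inr l)) fun n => by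
      have ha := (rep_lift a).C
      have hh := (rep_lift h).C
      exact (hβ' ha (RepSeq.rightPotential (l := l) (rep_pot hΦ) hh)).unique
        (RepSeq.rightPotential (l := l) (rep_pot hΦ) (hβ' ha hh))
        (hkar X.φ X.mem X.V X.isOpen X.subset Φ hΦ l _ _ (rep_lift a).smoothOn
          (rep_lift h).smoothOn) n
  exact
    { one_zero := by simpa [constSeq] using hunit 0
      one_succ := fun m => by simpa [constSeq] using hunit (m + 1)
      zb := fun m k h => by
        rw [mul_comm, cochain_apply_mul_right (hzb k) (fun a h n => hassoc a h _ n), mul_comm]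
      finite_order := fun m => hfin m a
      euler_zero := fun h => Finset.sum_eq_zero fun l _ => by rw [(hpot l _).1, sub_self]
      euler_succ := fun m h => Finset.sum_congr rfl fun l _ => by
        linear_combination (hpot l ((algebra hΦ).D l h)).2 m }

end CoordDomain

/-! ### The expansion of the star product -/

section Expansion

variable {M : Type*} [TopologicalSpace M] [ChartedSpace C2 M]

theorem KaehlerMetric.IsPotential.mono {g : KaehlerMetric M} {Φ : M → ℝ} {V V' : Set M}
    (h : g.IsPotential Φ V) (hV : V' ⊆ V) : g.IsPotential Φ V' :=
  ⟨h.1.mono hV, fun φ hφ y hy => h.2 φ hφ y ⟨hV hy.1, hy.2⟩⟩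

variable [IsManifold 𝓘(ℂ, C2) ω M]

/-- The trivial factorization: `Θ^p_ν = δ_{pν}` and `Θ^p_μ̄ = g_{μ̄ p}`. -/
theorem exists_isFactorization (g : KaehlerMetric M) {φ : OpenPartialHomeomorph M C2}
    (hφ : φ ∈ holCharts M) {U : Set M} (hUφ : U ⊆ φ.source) :
    ∃ Θ Θ' : Fin 4 → Fin 2 → M → ℂ, IsFactorization g φ U Θ Θ' := by
  have hzero : SmoothOn (0 : M → ℂ) U := (smoothOn_iff hφ hUφ).mpr contDiffOn_const
  have hone : SmoothOn (1 : M → ℂ) U := (smoothOn_iff hφ hUφ).mpr contDiffOn_const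
  have hg : ∀ ν μ, SmoothOn (fun x => g.comp φ (φ x) ν μ) U := by
    intro ν μ
    refine (smoothOn_iff hφ hUφ).mpr (((g.smooth φ hφ ν μ).mono Set.inter_subset_left).congr ?_)
    intro z hz
    rw [Function.comp_apply, φ.right_inv hz.1, KaehlerMetric.comp]
  refine ⟨![![1, 0], ![0, 1], 0, 0],
    ![fun μ x => g.comp φ (φ x) 0 μ, fun μ x => g.comp φ (φ x) 1 μ, 0, 0], ?_, ?_⟩
  · intro p μ
    fin_cases p <;> fin_cases μ <;>
      first
        | exact ⟨hone, hg _ _⟩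
        | exact ⟨hzero, hg _ _⟩
        | exact ⟨hzero, hzero⟩
  · intro x _ μ ν
    fin_cases ν <;> simp [Fin.sum_univ_four, gLow]

/-- Only the terms with `n ≤ m` contribute to the coefficient of `ħ^m`, since `T_n` is divisible by
`ħ^n`. -/
theorem hasFormalSum_TMat {G : Matrix (Fin 2) (Fin 2) ℂ} {R : Fin 2 → Fin 2 → Fin 2 → Fin 2 → ℂ}
    {s : PowerSeries ℂ} (u v : ℕ → ℕ → ℂ)
    (hs : ∀ m, PowerSeries.coeff m s = ∑ n ∈ Finset.range (m + 1), ∑ i : Fin (n + 1),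
      ∑ j : Fin (n + 1), StarCoeff.tcoef G R m n i j * (u n i * v n j)) :
    StarCoeff.HasFormalSum (fun n => ∑ i : Fin (n + 1), ∑ j : Fin (n + 1),
      StarCoeff.TMat G R n i j * PowerSeries.C (u n i * v n j)) s := by
  intro m
  filter_upwards [eventually_ge_atTop (m + 1)] with N hN
  rw [hs, map_sum]
  simp only [map_sum, PowerSeries.coeff_mul_C, StarCoeff.TMat, Matrix.of_apply,
    PowerSeries.coeff_mk]
  symm
  refine Finset.sum_subset (Finset.range_subset_range.mpr hN) fun n _ hn => ?_
  rw [Finset.mem_range, not_lt] at hn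
  refine Finset.sum_eq_zero fun i _ => Finset.sum_eq_zero fun j _ => ?_
  rw [StarCoeff.tcoef_eq_zero G R (by omega), Matrix.zero_apply, zero_mul]

/-- The coefficients of the star product at a point. -/
theorem coeff_star_eq (g : KaehlerMetric M) (hsym : g.IsLocallySymmetric)
    (S : StarProduct g) (hsep : S.SeparatesVariables) (hkar : S.IsKarabegov)
    (φ : OpenPartialHomeomorph M C2) (hφ : φ ∈ holCharts M)
    (U : Set M) (hU : IsOpen U) (hUφ : U ⊆ φ.source) (f₁ f₂ : M → ℂ) (h₁ : SmoothOn f₁ U)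
    (h₂ : SmoothOn f₂ U) {x : M} (hx : x ∈ U) (m : ℕ) :
    PowerSeries.coeff m (seriesAt x (S.star (PowerSeries.C f₁) (PowerSeries.C f₂)))
      = ∑ n ∈ Finset.range (m + 1), ∑ i : Fin (n + 1), ∑ j : Fin (n + 1),
        StarCoeff.tcoef (g.comp φ (φ x)) (g.curvAt φ x) m n i j *
          (DholPow (g.comp φ) (n - (i : ℕ)) (i : ℕ) (f₁ ∘ φ.symm) (φ x) *
            DbarPow (g.comp φ) (n - (j : ℕ)) (j : ℕ) (f₂ ∘ φ.symm) (φ x)) := by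
  obtain ⟨V, hV, hxV, Φ, hΦV⟩ := g.potential x
  let X : CoordDomain M := ⟨φ, hφ, V ∩ U, hV.inter hU, Set.inter_subset_right.trans hUφ⟩
  have hxX : x ∈ X.V := ⟨hxV, hx⟩
  have hΦ : g.IsPotential Φ X.V := KaehlerMetric.IsPotential.mono hΦV Set.inter_subset_left
  have hz : φ x ∈ X.W := X.φ_mem_W hxX
  have hK : (CoordDomain.algebra hΦ).LocallySymmetric :=
    locallySymmetric _ _ _ _ fun z hz => hsym φ hφ z hz.1
  obtain ⟨β, hβ, hL⟩ := CoordDomain.exists_isLeftMul S hsep hkar hΦ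
  obtain ⟨a, ha⟩ := CoordDomain.exists_rep (X := X) (h₁.mono Set.inter_subset_right)
  obtain ⟨b, hb⟩ := CoordDomain.exists_rep (X := X) (h₂.mono Set.inter_subset_right)
  have e1 := (CoordDomain.RepSeq.starOf hβ ha.C hb.C m).apply hxX
  rw [cochainMul_const_const, (hL a).eq_ev_tau hK (fun _ _ => eq_of_forall_eval),
    KaehlerAlgebra.tau, map_sum] at e1
  rw [seriesAt, PowerSeries.coeff_mk, StarProduct.star, e1, ← eval_apply ⟨φ x, hz⟩, map_sum]
  refine Finset.sum_congr rfl fun n _ => ?_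
  have hG : (CoordDomain.algebra hΦ).G.map (eval ⟨φ x, hz⟩) = g.comp φ (φ x) := by
    ext k l
    rw [Matrix.map_apply, eval_apply]
    exact (eqOn_G _ _ _ _ k l hz).symm
  have hR : (fun i k l c => eval ⟨φ x, hz⟩ ((CoordDomain.algebra hΦ).Rc i k l c))
      = g.curvAt φ x := by
    funext i k l c
    rw [← KaehlerAlgebra.cv_eq_Rc, eval_apply]
    exact (eqOn_curv _ _ _ _ i k l c hz).symm
  rw [KaehlerAlgebra.ev_symb, map_sum]
  refine Finset.sum_congr rfl fun i _ => ?_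
  rw [map_sum]
  refine Finset.sum_congr rfl fun j _ => ?_
  rw [map_mul, map_mul, ← hG, ← hR, ← StarCoeff.tcoef_map, Matrix.map_apply]
  congr 2
  · rw [eval_apply]
    exact (eqOn_DholPow X.isOpen_W _ (CoordDomain.comp_eq_of_potential hΦ) _ ha _ _ hz).symm
  · rw [eval_apply]
    exact (eqOn_DbarPow X.isOpen_W _ (CoordDomain.comp_eq_of_potential hΦ) _ hb _ _ hz).symm

end Expansion

end

theorem mainTheorem1 {M : Type*} [TopologicalSpace M] [ChartedSpace C2 M]
    [IsManifold 𝓘(ℂ, C2) ω M]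
    (g : KaehlerMetric M) (hsym : g.IsLocallySymmetric)
    (S : StarProduct g) (hsep : S.SeparatesVariables) (hkar : S.IsKarabegov)
    (φ : OpenPartialHomeomorph M C2) (hφ : φ ∈ holCharts M)
    (U : Set M) (hU : IsOpen U) (hUφ : U ⊆ φ.source) :
    -- each `X_k`, `k ≥ 1`, is invertible and its inverse is the stated power series in `ħ`
    (∀ x ∈ U, ∀ k : ℕ, 1 ≤ k →
      StarCoeff.X (g.curvAt φ x) k * StarCoeff.XInv (g.curvAt φ x) k = 1 ∧
        StarCoeff.XInv (g.curvAt φ x) k * StarCoeff.X (g.curvAt φ x) k = 1) ∧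
    -- factorizations of the metric exist
    (∃ Θ Θ' : Fin 4 → Fin 2 → M → ℂ, IsFactorization g φ U Θ Θ') ∧
    ∃ T : (n : ℕ) → M → Matrix (Fin (n + 1)) (Fin (n + 1)) (PowerSeries ℂ),
      -- for every factorization, `T_n(∞)` is given by the explicit formula
      (∀ Θ Θ' : Fin 4 → Fin 2 → M → ℂ, IsFactorization g φ U Θ Θ' → ∀ x ∈ U, ∀ n,
        StarCoeff.embed (T n x) =
          StarCoeff.formulaT (g.curvAt φ x)
            (fun p μ => Θ p μ x) (fun p μ => Θ' p μ x) n) ∧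
      -- expansion of the star product
      ∀ f₁ f₂ : M → ℂ, SmoothOn f₁ U → SmoothOn f₂ U → ∀ x ∈ U,
        StarCoeff.HasFormalSum
          (fun n => ∑ i : Fin (n + 1), ∑ j : Fin (n + 1), T n x i j *
            PowerSeries.C
              (KaehlerLocal.DholPow (g.comp φ) (n - (i : ℕ)) (i : ℕ) (f₁ ∘ φ.symm) (φ x) *
                KaehlerLocal.DbarPow (g.comp φ) (n - (j : ℕ)) (j : ℕ) (f₂ ∘ φ.symm) (φ x)))
          (seriesAt x (S.star (PowerSeries.C f₁) (PowerSeries.C f₂))) := by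
  refine ⟨fun x _ k hk => StarCoeff.X_mul_XInv _ hk, exists_isFactorization g hφ hUφ,
    fun n x => StarCoeff.TMat (g.comp φ (φ x)) (g.curvAt φ x) n, ?_, ?_⟩
  · intro Θ Θ' hΘ x hx n
    exact StarCoeff.embed_TMat _ (fun k l => hΘ.2 x hx l k) n
  · intro f₁ f₂ h₁ h₂ x hx
    exact hasFormalSum_TMat
      (fun n i => KaehlerLocal.DholPow (g.comp φ) (n - i) i (f₁ ∘ φ.symm) (φ x))
      (fun n j => KaehlerLocal.DbarPow (g.comp φ) (n - j) j (f₂ ∘ φ.symm) (φ x))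
      (coeff_star_eq g hsym S hsep hkar φ hφ U hU hUφ f₁ f₂ h₁ h₂ hx)
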